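/- Let $n\ge 2$ and $\zeta=\exp(\pi\sqrt{-1}/n)$, and let $\mathcal X=[\mathbb C^2/\mu_n]$ be the type $A_{n-1}$ surface singularity and $Y$ its crepant resolution. **Moduli space.** The $B$-model moduli space is $\mathcal M_B=\mathbb C\times(\mathbb C^{n-1}/\mu_n)$, with co-ordinates $(x_0,x_1,\dots,x_{n-1})$, where $c\in\mu_n$ acts by $(x_1,\dots,x_{n-1})\mapsto(cx_1,c^2x_2,\dots,c^{n-1}x_{n-1})$. On the set where $x_1,\dots,x_{n-1}\neq0$ we also use the co-ordinates $y_0=x_0$, $y_i=x_{i-1}x_i^{-2}x_{i+1}$ ($1\le i\le n-1$, where factors $x_0$ and $x_n$ are omitted from the latter formula). The large-radius limit points for $\mathcal X$ and $Y$ are $x=0$ and $y=0$. **Flat co-ordinates for $\mathcal X$.** For $b\in\mathbb Z_{\ge0}^{n-1}$ put $b(0)=-\frac1n\sum_{k=1}^{n-1}(n-k)b(k)$ and $b(n)=-\frac1n\sum_{k=1}^{n-1}kb(k)$. Then $f_0(x)=x_0$ and, for $1\le k<n$, $$f_k(x)=\sum_{b:\ n\langle -b(n)\rangle=k}\frac{\Gamma(1-\frac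 kn)}{\Gamma(1+b(0))}\,\frac{\Gamma(\frac kn)}{\Gamma(1+b(n))}\,\frac{x_1^{b(1)}\cdots x_{n-1}^{b(n-1)}}{b(1)!\cdots b(n-1)!},$$ where $\langle r\rangle$ is the fractional part of $r$. **Flat co-ordinates for $Y$.** The $T=(\mathbb C^\times)^2$-equivariant cohomology of $Y$ is $$H_T^\bullet(Y;\mathbb C)=\mathbb C[\lambda_1,\lambda_2,\gamma_1,\dots,\gamma_{n-1}]/\langle\omega_i\omega_j: i-j>1\rangle,$$ where $\omega_0=\lambda_1+\gamma_1$, $\omega_j=\gamma_{j-1}-2\gamma_j+\gamma_{j+1}$ for $1\le j\le n-1$ (terms $\gamma_0$ and $\gamma_n$ omitted), and $\omega_n=\lambda_2+\gamma_{n-1}$. It has the $\mathbb C[\lambda_1,\lambda_2]$-basis $1,\gamma_1,\dots,\gamma_{n-1}$. Let $$I_Y(y,z)=z\,e^{y_0/z}\,e^{(\gamma_1\log y_1+\dots+\gamma_{n-1}\log y_{n-1})/z}\sum_{d\in\mathbb Z_{\ge0}^{n-1}}\ \prod_{j=0}^n\frac{\prod_{m\le0}(\omega_j+mz)}{\prod_{m\le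 D_j(d)}(\omega_j+mz)}\ y_1^{d_1}\cdots y_{n-1}^{d_{n-1}},$$ where $D_j(d)=d_{j-1}-2d_j+d_{j+1}$ (with $d_i=0$ for $i\notin\{1,\dots,n-1\}$). The flat co-ordinates $g_0(y),\dots,g_{n-1}(y)$ are the components of the coefficient of $z^0$ in the Laurent expansion of $I_Y$ at $z=\infty$: that coefficient is $g_0(y)+g_1(y)\gamma_1+\dots+g_{n-1}(y)\gamma_{n-1}$. For $1\le i<n$, $g_i(y)$ is $\log y_i$ plus a power series in $y_1,\dots,y_{n-1}$. **Proposition.** There is $r>0$ such that the series defining the $f_k$ converge for $|x_1|,\dots,|x_{n-1}|<r$ and those defining the $g_i$ converge for $0<|y_1|,\dots,|y_{n-1}|<r$. Moreover there is a path from the large-radius limit point for $Y$ to the large-radius limit point for $\mathcal X$, which apart from its initial point lies in $\mathcal M_B$ and avoids the discriminant locus of $W_{\mathcal X}(\kappa)=\kappa^n+x_{n-1}\kappa^{n-1}+\dots+x_1\kappa+1$, and along which $y_1,\dots,y_{n-1}\notin(-\infty,0]$ near the initial point, with the following property. For $1\le i<n$, the function $g_i(y)$, taken near the initial point with the principal branches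 of $\log y_1,\dots,\log y_{n-1}$, continues analytically along the path to a function which near $x=0$ (on the uniformizing chart $\mathbb C\times\mathbb C^{n-1}$) equals $$-\frac{2\pi\sqrt{-1}}n+\frac1n\sum_{k=1}^{n-1}\zeta^{2ki}\left(\zeta^{-k}-\zeta^{k}\right)f_k(x).$$ -/

import Mathlib

open Filter Topology

noncomputable section

namespace CrepantA

/-- Reads a tuple `(v₁, …, v_{n-1})` at an index `j`, with the value `a` at every `j` outside
`{1, …, n-1}`. -/
def entry {R : Type*} {n : ℕ} (v : Fin (n - 1) → R) (a : R) (j : ℕ) : R :=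
  if h : 1 ≤ j ∧ j ≤ n - 1 then v ⟨j - 1, by omega⟩ else a

/-! ### The B-model moduli space -/

/-- Points `(x₀, (x₁, …, x_{n-1}))` of the uniformizing chart `ℂ × ℂ^{n-1}` of
`M_B = ℂ × (ℂ^{n-1} / μ_n)`; also used for points `(y₀, (y₁, …, y_{n-1}))`. -/
abbrev Chart (n : ℕ) : Type := ℂ × (Fin (n - 1) → ℂ)

/-- The co-ordinates `y` as functions of the co-ordinates `x`: `y₀ = x₀` and
`y_i = x_{i-1} x_i⁻² x_{i+1}` for `1 ≤ i ≤ n - 1`, where factors of index `0` and `n` are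
omitted.  (The value is meaningful where `x₁, …, x_{n-1}` are all non-zero; elsewhere some `y_i`
is given the value `0`.) -/
def toY (n : ℕ) (x : Chart n) : Chart n :=
  (x.1, fun i => entry x.2 1 i * (x.2 i ^ 2)⁻¹ * entry x.2 1 (i + 2))

/-- `W_X(κ) = κⁿ + x_{n-1} κ^{n-1} + ⋯ + x₁ κ + 1`. -/
def WX (n : ℕ) (x : Chart n) : Polynomial ℂ :=
  Polynomial.X ^ n + (∑ k : Fin (n - 1), Polynomial.C (x.2 k) * Polynomial.X ^ ((k : ℕ) + 1)) + 1

/-- `F t`, `t ∈ I`, is an analytic continuation of function elements along the path `p`: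
each `F t` is analytic at `p t`, and for `s` close to `t` the elements `F s` and `F t` agree
near `p s`. -/
def IsAnalyticContinuation {E : Type*} [NormedAddCommGroup E] [NormedSpace ℂ E]
    (I : Set ℝ) (p : ℝ → E) (F : ℝ → E → ℂ) : Prop :=
  ∀ t ∈ I, AnalyticAt ℂ (F t) (p t) ∧ ∀ᶠ s in 𝓝[I] t, F s =ᶠ[𝓝 (p s)] F t

/-! ### Flat co-ordinates for the orbifold `[ℂ² / μ_n]` -/

/-- `b(0) = -(1/n) ∑_{k=1}^{n-1} (n - k) b(k)`. -/
def beta0 (n : ℕ) (b : Fin (n - 1) → ℕ) : ℚ :=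
  -(1 / (n : ℚ)) * ∑ k : Fin (n - 1), ((n : ℚ) - ((k : ℕ) + 1)) * b k

/-- `b(n) = -(1/n) ∑_{k=1}^{n-1} k b(k)`. -/
def betaN (n : ℕ) (b : Fin (n - 1) → ℕ) : ℚ :=
  -(1 / (n : ℚ)) * ∑ k : Fin (n - 1), (((k : ℕ) : ℚ) + 1) * b k

open Classical in
/-- The term of the series `f_k(x)` that belongs to the effective class `b`; it is present only
if `i(b) = n ⟨-b(n)⟩` equals `k`. -/
def fTerm (n k : ℕ) (x : Chart n) (b : Fin (n - 1) → ℕ) : ℂ :=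
  if (n : ℚ) * Int.fract (-betaN n b) = k then
    (Complex.Gamma (1 - (k : ℂ) / n) / Complex.Gamma (1 + (beta0 n b : ℂ))) *
      (Complex.Gamma ((k : ℂ) / n) / Complex.Gamma (1 + (betaN n b : ℂ))) *
      ((∏ j, x.2 j ^ b j) / (∏ j, ((b j).factorial : ℂ)))
  else 0

/-- `f 0, …, f (n-1)` are the values at `x` of the flat co-ordinates `f₀, …, f_{n-1}`. -/
def HasFlatCoordinatesX (n : ℕ) (x : Chart n) (f : ℕ → ℂ) : Prop :=
  f 0 = x.1 ∧ ∀ k : ℕ, 1 ≤ k → k < n → HasSum (fTerm n k x) (f k)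

/-! ### Equivariant cohomology, the `I`-function and the flat co-ordinates for `Y` -/

/-- `ℂ[λ₁, λ₂]`. -/
abbrev LambdaRing : Type := MvPolynomial (Fin 2) ℂ

/-- `γ_j` in `ℂ[λ₁, λ₂][γ₁, …, γ_{n-1}]`, and `0` for `j` outside `{1, …, n-1}`. -/
def gammaPoly (n j : ℕ) : MvPolynomial (Fin (n - 1)) LambdaRing :=
  entry (fun i => MvPolynomial.X i) 0 j

/-- The toric divisor classes `ω₀ = λ₁ + γ₁`, `ω_j = γ_{j-1} - 2 γ_j + γ_{j+1}` for `0 < j < n`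
(with `γ₀` and `γ_n` omitted), `ω_n = λ₂ + γ_{n-1}`. -/
def omegaPoly (n j : ℕ) : MvPolynomial (Fin (n - 1)) LambdaRing :=
  gammaPoly n (j - 1) - 2 * gammaPoly n j + gammaPoly n (j + 1) +
    (if j = 0 then MvPolynomial.C (MvPolynomial.X 0) else 0) +
    (if j = n then MvPolynomial.C (MvPolynomial.X 1) else 0)

/-- The ideal generated by the products `ω_i ω_j` with `i - j > 1`. -/
def relations (n : ℕ) : Ideal (MvPolynomial (Fin (n - 1)) LambdaRing) :=
  Ideal.span {a | ∃ i j : ℕ, i ≤ n ∧ j + 1 < i ∧ a = omegaPoly n i * omegaPoly n j}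

/-- The `T`-equivariant cohomology ring of `Y`. -/
def HTY (n : ℕ) : Type := MvPolynomial (Fin (n - 1)) LambdaRing ⧸ relations n

instance (n : ℕ) : CommRing (HTY n) :=
  inferInstanceAs (CommRing (MvPolynomial (Fin (n - 1)) LambdaRing ⧸ relations n))

instance (n : ℕ) : Algebra LambdaRing (HTY n) :=
  inferInstanceAs (Algebra LambdaRing (MvPolynomial (Fin (n - 1)) LambdaRing ⧸ relations n))

instance (n : ℕ) : Algebra ℂ (HTY n) :=
  inferInstanceAs (Algebra ℂ (MvPolynomial (Fin (n - 1)) LambdaRing ⧸ relations n))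

instance (n : ℕ) : IsScalarTower ℂ LambdaRing (HTY n) :=
  inferInstanceAs
    (IsScalarTower ℂ LambdaRing (MvPolynomial (Fin (n - 1)) LambdaRing ⧸ relations n))

/-- The class `γ_j` for `1 ≤ j < n`. -/
def gam (n j : ℕ) : HTY n := Ideal.Quotient.mk (relations n) (gammaPoly n j)

/-- The class `ω_j` for `0 ≤ j ≤ n`. -/
def om (n j : ℕ) : HTY n := Ideal.Quotient.mk (relations n) (omegaPoly n j)

/-- The `ℂ[λ₁, λ₂]`-basis `γ₀ = 1, γ₁, …, γ_{n-1}` of the equivariant cohomology of `Y`. -/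
def gammaBasis (n j : ℕ) : HTY n := if j = 0 then 1 else gam n j

/-- The degrees `D_j(β)` of the toric divisors on `β = d₁ β₁ + ⋯ + d_{n-1} β_{n-1}`. -/
def degD (n : ℕ) (d : Fin (n - 1) → ℕ) (j : ℕ) : ℤ :=
  entry (fun i => (d i : ℤ)) 0 (j - 1) - 2 * entry (fun i => (d i : ℤ)) 0 j +
    entry (fun i => (d i : ℤ)) 0 (j + 1)

/-- The variable `z` in the ring of Laurent series in `z⁻¹`, in which `z⁻¹` is the series
variable. -/
def zVar (R : Type*) [CommRing R] : LaurentSeries R := HahnSeries.single (-1 : ℤ) 1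

/-- `exp (a / z)` as a Laurent series in `z⁻¹`. -/
def expOverZ {R : Type*} [CommRing R] [Algebra ℂ R] (a : R) : LaurentSeries R :=
  HahnSeries.ofPowerSeries ℤ R (PowerSeries.mk fun m => ((m.factorial : ℂ)⁻¹) • a ^ m)

/-- The summand of `I_Y(y, z)` of degree `d`, Laurent-expanded at `z = ∞`:
`z e^{y₀/z} ∏_k e^{γ_k log y_k / z} ∏_{j=0}^n (∏_{m ≤ 0} (ω_j + m z) / ∏_{m ≤ D_j} (ω_j + m z))
∏_k y_k^{d_k}`.  After cancellation the quotient for `j` has the factors with `D_j < m ≤ 0` in the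
numerator and those with `0 < m ≤ D_j` in the denominator; the latter are invertible.  The
principal branch of the logarithm is used. -/
def IYterm (n : ℕ) (y : Chart n) (d : Fin (n - 1) → ℕ) : LaurentSeries (HTY n) :=
  zVar (HTY n) * expOverZ (algebraMap ℂ (HTY n) y.1) *
    (∏ k : Fin (n - 1), expOverZ (Complex.log (y.2 k) • gam n ((k : ℕ) + 1))) *
    (∏ j ∈ Finset.range (n + 1),
      (∏ m ∈ Finset.Ioc (degD n d j) 0,
        (HahnSeries.C (om n j) + (m : LaurentSeries (HTY n)) * zVar (HTY n))) *
      Ring.inverse (∏ m ∈ Finset.Ioc 0 (degD n d j),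
        (HahnSeries.C (om n j) + (m : LaurentSeries (HTY n)) * zVar (HTY n)))) *
    HahnSeries.C (algebraMap ℂ (HTY n) (∏ k, y.2 k ^ d k))

/-- `g 0, …, g (n-1)` are the values at `y` of the (principal branch of the) flat co-ordinates
`g₀, …, g_{n-1}` for `Y`: the coefficient of `z⁰` in `I_Y(y, z)` is
`g₀ γ₀ + g₁ γ₁ + ⋯ + g_{n-1} γ_{n-1}`.  Here `c d i` is the component along `γ_i` of the
contribution of `d`, a polynomial in `λ₁, λ₂`, and the sum over `d` is taken componentwise, for
all values `l` of `(λ₁, λ₂)`. -/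
def HasFlatCoordinatesY (n : ℕ) (y : Chart n) (g : ℕ → ℂ) : Prop :=
  ∃ c : (Fin (n - 1) → ℕ) → ℕ → LambdaRing,
    (∀ d, (IYterm n y d).coeff 0 = ∑ i ∈ Finset.range n, c d i • gammaBasis n i) ∧
    ∀ l : Fin 2 → ℂ, ∀ i < n, HasSum (fun d => MvPolynomial.eval l (c d i)) (g i)

/-! ### The classes `γ₀, …, γ_{n-1}` are independent, so flat co-ordinates are unique -/

/-- Restriction of `γ_{k+1}` to the torus-fixed point of `Y` that corresponds to the cone spanned
by the rays `p` and `p + 1`. -/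
def fixedPt (n p : ℕ) (k : Fin (n - 1)) : LambdaRing :=
  if (k : ℕ) + 1 ≤ p then -(((k : ℕ) : LambdaRing) + 1) * MvPolynomial.X 0
  else -((n : LambdaRing) - (((k : ℕ) : LambdaRing) + 1)) * MvPolynomial.X 1

theorem fixedPt_gamma (n p j : ℕ) (hp : p < n) (hj : j ≤ n) :
    MvPolynomial.aeval (fixedPt n p) (gammaPoly n j) =
      if j ≤ p then -(j : LambdaRing) * MvPolynomial.X 0
      else -((n : LambdaRing) - (j : LambdaRing)) * MvPolynomial.X 1 := by
  unfold gammaPoly entry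
  split_ifs with h1 h2 h2
  · rw [MvPolynomial.aeval_X, fixedPt]
    obtain ⟨j, rfl⟩ : ∃ i, j = i + 1 := ⟨j - 1, by omega⟩
    simp only [Nat.add_sub_cancel]
    rw [if_pos h2]; push_cast; ring
  · rw [MvPolynomial.aeval_X, fixedPt]
    obtain ⟨j, rfl⟩ : ∃ i, j = i + 1 := ⟨j - 1, by omega⟩
    simp only [Nat.add_sub_cancel]
    rw [if_neg h2]; push_cast; ring
  · obtain rfl : j = 0 := by omega
    simp
  · obtain rfl : j = n := by omega
    simp

theorem fixedPt_omega (n p j : ℕ) (hp : p < n) (hj : j ≤ n) (h1 : j ≠ p) (h2 : j ≠ p + 1) :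
    MvPolynomial.aeval (fixedPt n p) (omegaPoly n j) = 0 := by
  unfold omegaPoly
  have hlast : gammaPoly n (n + 1) = 0 := by
    unfold gammaPoly entry
    rw [dif_neg (by omega)]
  simp only [map_add, map_sub, map_mul, map_ofNat]
  rcases Nat.eq_zero_or_pos j with h0 | h0
  · subst h0
    rw [fixedPt_gamma n p _ hp (by omega), fixedPt_gamma n p _ hp (by omega),
      if_pos (by omega), if_pos (by omega), if_pos rfl, if_neg (by omega)]
    simp
  · rw [if_neg (by omega : ¬ j = 0)]
    rcases Nat.lt_or_ge j n with h | h
    · rw [fixedPt_gamma n p _ hp (by omega), fixedPt_gamma n p _ hp (by omega),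
        fixedPt_gamma n p _ hp (by omega), if_neg (by omega : ¬ j = n)]
      obtain ⟨j, rfl⟩ : ∃ i, j = i + 1 := ⟨j - 1, by omega⟩
      rcases Nat.lt_or_ge (j + 1) p with h3 | h3
      · rw [if_pos (by omega), if_pos (by omega), if_pos (by omega)]
        push_cast [Nat.add_sub_cancel]
        simp only [map_zero]
        ring
      · rw [if_neg (by omega), if_neg (by omega), if_neg (by omega)]
        push_cast [Nat.add_sub_cancel]
        simp only [map_zero]
        ring
    · obtain rfl : j = n := by omega
      rw [hlast, fixedPt_gamma j p _ hp (by omega), fixedPt_gamma j p _ hp (by omega),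
        if_neg (by omega), if_neg (by omega), if_pos rfl]
      obtain ⟨j, rfl⟩ : ∃ i, j = i + 1 := ⟨j - 1, by omega⟩
      simp

/-- Restriction to a torus-fixed point. -/
def restrict (n p : ℕ) (hp : p < n) : HTY n →+* LambdaRing :=
  Ideal.Quotient.lift (relations n)
    (MvPolynomial.aeval (R := LambdaRing) (fixedPt n p)).toRingHom (by
      have : relations n ≤
          RingHom.ker (MvPolynomial.aeval (R := LambdaRing) (fixedPt n p)).toRingHom := by
        unfold relations
        rw [Ideal.span_le]
        rintro a ⟨i, j, hi, hij, rfl⟩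
        simp only [SetLike.mem_coe, RingHom.mem_ker, map_mul, AlgHom.toRingHom_eq_coe,
          RingHom.coe_coe, mul_eq_zero]
        by_cases h : i = p ∨ i = p + 1
        · exact Or.inr (fixedPt_omega n p j hp (by omega) (by omega) (by omega))
        · exact Or.inl (fixedPt_omega n p i hp hi (by tauto) (by tauto))
      intro a ha
      exact this ha)

theorem restrict_smul (n p : ℕ) (hp : p < n) (c : LambdaRing) (a : HTY n) :
    restrict n p hp (c • a) = c * restrict n p hp a := by
  obtain ⟨a, rfl⟩ := Ideal.Quotient.mk_surjective a
  exact map_smul (MvPolynomial.aeval (R := LambdaRing) (fixedPt n p)) c a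

theorem restrict_gammaBasis (n p j : ℕ) (hp : p < n) (hj : j < n) :
    restrict n p hp (gammaBasis n j) = if j = 0 then 1 else
      if j ≤ p then -(j : LambdaRing) * MvPolynomial.X 0
      else -((n : LambdaRing) - (j : LambdaRing)) * MvPolynomial.X 1 := by
  unfold gammaBasis
  split_ifs with h
  · exact map_one _
  all_goals
    refine (fixedPt_gamma n p j hp hj.le).trans ?_
    simp [*]

theorem gammaBasis_independent (n : ℕ) (c : ℕ → LambdaRing)
    (hc : ∑ i ∈ Finset.range n, c i • gammaBasis n i = 0) : ∀ i < n, c i = 0 := by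
  have key : ∀ p (hp : p < n),
      ∑ i ∈ Finset.range n, c i * restrict n p hp (gammaBasis n i) = 0 := by
    intro p hp
    have := congrArg (restrict n p hp) hc
    simpa only [map_sum, restrict_smul, map_zero] using this
  have hpos : ∀ i, i ≠ 0 → i < n → c i = 0 := by
    intro i h0 hi
    have h := (key i hi).trans (key (i - 1) (by omega)).symm
    rw [← sub_eq_zero, ← Finset.sum_sub_distrib, Finset.sum_eq_single i] at h
    · rw [restrict_gammaBasis _ _ _ _ hi, restrict_gammaBasis _ _ _ _ hi, if_neg h0, if_neg h0,
        if_pos le_rfl, if_neg (by omega), ← mul_sub] at h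
      rcases mul_eq_zero.1 h with h | h
      · exact h
      · exfalso
        have := congrArg (MvPolynomial.eval (fun t : Fin 2 => if t = 0 then (1 : ℂ) else 0)) h
        simp [h0] at this
    · intro j hj hji
      have hj := Finset.mem_range.1 hj
      rw [restrict_gammaBasis _ _ _ _ hj, restrict_gammaBasis _ _ _ _ hj]
      by_cases hz : j = 0
      · simp [hz]
      · by_cases h1 : j ≤ i
        · simp [hz, h1, show j ≤ i - 1 by omega]
        · simp [hz, h1, show ¬ j ≤ i - 1 by omega]
    · intro h1
      exact absurd (Finset.mem_range.2 hi) h1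
  intro i hi
  by_cases h0 : i = 0
  · subst h0
    have h := key 0 hi
    rw [Finset.sum_eq_single 0] at h
    · simpa [restrict_gammaBasis _ _ _ hi hi] using h
    · intro j hj hj0
      rw [hpos j hj0 (Finset.mem_range.1 hj), zero_mul]
    · intro h1
      exact absurd (Finset.mem_range.2 hi) h1
  · exact hpos i h0 hi

theorem HasFlatCoordinatesY.unique {n : ℕ} {y : Chart n} {g g' : ℕ → ℂ}
    (h : HasFlatCoordinatesY n y g) (h' : HasFlatCoordinatesY n y g') :
    ∀ i < n, g i = g' i := by
  obtain ⟨c, hc, hs⟩ := h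
  obtain ⟨c', hc', hs'⟩ := h'
  intro i hi
  have e : ∀ d, c d i = c' d i := by
    intro d
    have := gammaBasis_independent n (fun i => c d i - c' d i) (by
      simp only [sub_smul, Finset.sum_sub_distrib]
      rw [← hc, ← hc', sub_self]) i hi
    exact sub_eq_zero.1 this
  have h1 := hs 0 i hi
  simp only [e] at h1
  exact h1.unique (hs' 0 i hi)

end CrepantA

end

noncomputable section

namespace CrepantA

/-! Both systems of flat co-ordinates are made of logarithms of the roots κ_0, …, κ_{n-1} of W =
`WX`. Near y = 0 one has g_i = log κ_{i-1} - log κ_i; near x = 0 a root satisfies log κ = log c +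
(1/n) ∑ c^k f_k, where c is the nth root of -1 from which it starts. The logarithm of a simple root
continues analytically wherever the discriminant does not vanish (`exists_continuation_log_root`),
so one path on which all roots are known decides the matter.

Near x = 0, the substitution κ = c e^u turns W(κ) = 0 into e^{nu} = 1 + ∑ a_k e^{ku} with a_k = c^k
x_k. A weighted argument principle and an integration by parts write u as a contour integral of a
logarithm (`eq_logIntegral`). Expanding that logarithm, evaluating the residues
(`circleIntegral_exp_div_pow`) and using the reflection formula for Gamma (`Gamma_quotient`) gives
the series f_k term by term (`rootTerm_eq_sum_fTerm`).

Near y = 0, counting powers of z shows that d ≠ 0 contributes to the coefficient of z⁰ only if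
exactly one degree D_j is negative, and then with a coefficient of log(1 + ∑ z_i)
(`coeff_zero_IYterm`). Hence g_i = log y_i + S_{i-1} - 2 S_i + S_{i+1}, where S_j is the constant
Laurent coefficient of log(W(w) / (x_j w^j)) on a circle where x_j w^j dominates, with x_0 = x_n = 1
(`hasSum_toricTerm`). The circle separates the roots κ_k with k < j from the others, and splitting W
into linear factors gives e^{S_j} = ∏_{k ≥ j} (-κ_k) / x_j (`exp_toricSum`). The second difference
of these identities is e^{g_i} = κ_{i-1} / κ_i (`flatY_toY_eq`).

The path prescribes the roots κ_k = -q^{n-1-2k} with q = t e^{-π i t/n}; by the q-binomial theorem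
the x_i are powers of q times Gaussian binomials in q². As t → 0 the y_i are asymptotic to q², which
tends to 0 near the positive axis. At t = 1 the roots are all the nth roots of -1, so x = 0.
Throughout, log κ_{i-1} - log κ_i = 2 log q, which ends at -2πi/n. -/

theorem hasSum_of_eq {ι R : Type*} [AddCommMonoid R] [TopologicalSpace R] {f g : ι → R} {a b : R}
    (h : HasSum f a) (hf : ∀ i, g i = f i) (ha : b = a) : HasSum g b := by
  rw [ha, funext hf]
  exact h

/-! ### The expansion of `log (1 + ∑ z_i)` in several variables -/

/-- The coefficient of `z^e` in `log (1 + ∑ z_i)`. -/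
def logCoeff {ι : Type*} [Fintype ι] (e : ι → ℕ) : ℝ :=
  if ∑ i, e i = 0 then 0 else
    (-1) ^ (∑ i, e i - 1) * ((∑ i, e i - 1).factorial : ℝ) / ∏ i, ((e i).factorial : ℝ)

/-- The Taylor coefficient (-1)^(m+1)/m of log(1 + s) times the multinomial coefficient in s^m. -/
theorem logCoeff_eq_multinomial {ι : Type*} [Fintype ι] (e : ι → ℕ) :
    logCoeff e = (-1) ^ (∑ i, e i + 1) / ((∑ i, e i : ℕ) : ℝ) *
      (Nat.multinomial Finset.univ e : ℝ) := by
  unfold logCoeff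
  split_ifs with h
  -- In degree 0 the right side is a division by 0, hence 0, in agreement with the left.
  · rw [h]; simp
  · obtain ⟨m, hm⟩ : ∃ m, ∑ i, e i = m + 1 := ⟨_, (Nat.succ_pred h).symm⟩
    have h1 : ((∏ i, (e i).factorial : ℕ) : ℝ) * Nat.multinomial Finset.univ e =
        ((∑ i, e i).factorial : ℕ) := by
      rw [← Nat.cast_mul, Nat.multinomial_spec]
    have h2 : (∏ i, ((e i).factorial : ℝ)) ≠ 0 :=
      Finset.prod_ne_zero_iff.2 fun i _ => by positivity
    push_cast at h1
    rw [hm] at h1 ⊢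
    rw [Nat.factorial_succ] at h1
    push_cast at h1
    rw [Nat.add_sub_cancel, div_mul_eq_mul_div, div_eq_div_iff h2 (by positivity)]
    have h3 : ((-1 : ℝ)) ^ (m + 1 + 1) = (-1) ^ m := by ring
    push_cast
    rw [h3]
    linear_combination (-(-1 : ℝ) ^ m) * h1

theorem hasSum_degree_fiber {ι : Type*} [Fintype ι] {R : Type*} [NormedField R] [CharZero R]
    (z : ι → R) (m : ℕ) (c : R) :
    HasSum (fun e : {e : ι → ℕ // ∑ i, e i = m} =>
      c * (Nat.multinomial Finset.univ (e : ι → ℕ) : R) * ∏ i, z i ^ (e : ι → ℕ) i)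
      (c * (∑ i, z i) ^ m) := by
  classical
  let E : {e : ι → ℕ // ∑ i, e i = m} ≃ {e // e ∈ Finset.piAntidiag (Finset.univ : Finset ι) m} :=
    Equiv.subtypeEquivRight fun e => by simp [Finset.mem_piAntidiag]
  rw [← E.symm.hasSum_iff]
  rw [Finset.sum_pow_eq_sum_piAntidiag, Finset.mul_sum]
  exact hasSum_of_eq ((Finset.piAntidiag (Finset.univ : Finset ι) m).hasSum
    (fun e : ι → ℕ => c * ((Nat.multinomial Finset.univ e : R) * ∏ i, z i ^ e i)))
    (fun e => mul_assoc _ _ _) rfl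

/-- Grouping by total degree m gives ∑ σ^m / m with σ = ∑ β_i < 1. -/
theorem summable_abs_logCoeff {ι : Type*} [Fintype ι] (β : ι → ℝ) (h0 : ∀ i, 0 ≤ β i)
    (h1 : ∑ i, β i < 1) : Summable fun e : ι → ℕ => |logCoeff e| * ∏ i, β i ^ e i := by
  rw [← (Equiv.sigmaFiberEquiv fun e : ι → ℕ => ∑ i, e i).summable_iff]
  have hf : ∀ m, HasSum (fun e : {e : ι → ℕ // ∑ i, e i = m} =>
      |logCoeff (e : ι → ℕ)| * ∏ i, β i ^ (e : ι → ℕ) i) ((1 / (m : ℝ)) * (∑ i, β i) ^ m) := by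
    intro m
    refine hasSum_of_eq (hasSum_degree_fiber β m (1 / (m : ℝ))) (fun e => ?_) rfl
    rw [logCoeff_eq_multinomial, e.2, abs_mul, abs_div, abs_pow, abs_neg, abs_one, one_pow,
      Nat.abs_cast, Nat.abs_cast]
  have hs : 0 ≤ ∑ i, β i := Finset.sum_nonneg fun i _ => h0 i
  refine (summable_sigma_of_nonneg ?_).2 ⟨fun m => (hf m).summable, ?_⟩
  · intro x
    exact mul_nonneg (abs_nonneg _) (Finset.prod_nonneg fun i _ => pow_nonneg (h0 i) _)
  · refine (summable_geometric_of_lt_one hs h1).of_nonneg_of_le (fun m => ?_) (fun m => ?_)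
    · exact tsum_nonneg fun e =>
        mul_nonneg (abs_nonneg _) (Finset.prod_nonneg fun i _ => pow_nonneg (h0 i) _)
    · refine (hf m).tsum_eq.le.trans ?_
      have : 1 / (m : ℝ) ≤ 1 := by
        rcases Nat.eq_zero_or_pos m with rfl | h
        · simp
        · rw [div_le_one (by positivity)]; exact_mod_cast h
      exact mul_le_of_le_one_left (by positivity) this

theorem hasSum_logCoeff {ι : Type*} [Fintype ι] (z : ι → ℂ) (h1 : ∑ i, ‖z i‖ < 1) :
    HasSum (fun e : ι → ℕ => (logCoeff e : ℂ) * ∏ i, z i ^ e i) (Complex.log (1 + ∑ i, z i)) := by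
  rw [← (Equiv.sigmaFiberEquiv fun e : ι → ℕ => ∑ i, e i).hasSum_iff]
  refine (Complex.hasSum_taylorSeries_log ((norm_sum_le _ _).trans_lt h1)).sigma_of_hasSum
    (fun m => ?_) ?_
  · refine hasSum_of_eq (hasSum_degree_fiber z m ((-1) ^ (m + 1) / (m : ℂ))) (fun e => ?_) (by ring)
    change (logCoeff (e : ι → ℕ) : ℂ) * ∏ i, z i ^ (e : ι → ℕ) i = _
    rw [logCoeff_eq_multinomial, e.2]
    push_cast
    rfl
  · rw [(Equiv.sigmaFiberEquiv fun e : ι → ℕ => ∑ i, e i).summable_iff]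
    refine Summable.of_norm ?_
    refine (summable_abs_logCoeff (fun i => ‖z i‖) (fun i => norm_nonneg _) h1).congr fun e => ?_
    simp [norm_prod]

/-- The series of the logarithm is dominated on the circle by a convergent series in the β_i, so it
integrates term by term. Both expansions, at x = 0 and at y = 0, come from this. -/
theorem hasSum_circleIntegral_log {ι : Type*} [Fintype ι] {R : ℝ} (hR : 0 ≤ R) (c : ℂ)
    (z : ι → ℂ → ℂ) (β : ι → ℝ) (g : ℂ → ℂ) (hz : ∀ i, ContinuousOn (z i) (Metric.sphere c R))
    (hg : ContinuousOn g (Metric.sphere c R)) (hβ : ∀ i, ∀ u ∈ Metric.sphere c R, ‖z i u‖ ≤ β i)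
    (h1 : ∑ i, β i < 1) :
    HasSum (fun e : ι → ℕ => (logCoeff e : ℂ) * ∮ u in C(c, R), g u * ∏ i, z i u ^ e i)
      (∮ u in C(c, R), g u * Complex.log (1 + ∑ i, z i u)) := by
  have hmem : ∀ θ, circleMap c R θ ∈ Metric.sphere c R := fun θ => circleMap_mem_sphere c hR θ
  have h0 : ∀ i, 0 ≤ β i := fun i => (norm_nonneg _).trans (hβ i _ (hmem 0))
  have hcm : Continuous (circleMap c R) := continuous_circleMap c R
  have hgc : Continuous fun θ => g (circleMap c R θ) :=
    hg.comp_continuous hcm hmem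
  have hzc : ∀ i, Continuous fun θ => z i (circleMap c R θ) :=
    fun i => (hz i).comp_continuous hcm hmem
  simp_rw [← circleIntegral.integral_const_mul]
  have hdc : Continuous fun θ => deriv (circleMap c R) θ := by
    simp_rw [deriv_circleMap]
    exact (continuous_circleMap 0 R).mul continuous_const
  refine intervalIntegral.hasSum_integral_of_dominated_convergence
    (fun e θ => ‖deriv (circleMap c R) θ‖ * ‖g (circleMap c R θ)‖ *
      (|logCoeff e| * ∏ i, β i ^ e i)) (fun e => ?_) (fun e => ?_) ?_ ?_ ?_
  · refine Continuous.aestronglyMeasurable ?_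
    refine hdc.smul (continuous_const.mul (hgc.mul ?_))
    exact continuous_finsetProd _ fun i _ => (hzc i).pow _
  · refine Eventually.of_forall fun θ _ => ?_
    rw [norm_smul, norm_mul, norm_mul, norm_prod, Complex.norm_real, Real.norm_eq_abs]
    have : ∏ i, ‖z i (circleMap c R θ) ^ e i‖ ≤ ∏ i, β i ^ e i := by
      refine Finset.prod_le_prod (fun i _ => norm_nonneg _) fun i _ => ?_
      rw [norm_pow]
      exact pow_le_pow_left₀ (norm_nonneg _) (hβ i _ (hmem θ)) _
    calc _ = ‖deriv (circleMap c R) θ‖ * ‖g (circleMap c R θ)‖ *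
        (|logCoeff e| * ∏ i, ‖z i (circleMap c R θ) ^ e i‖) := by ring
      _ ≤ _ := by gcongr
  · exact Eventually.of_forall fun θ _ => (summable_abs_logCoeff β h0 h1).mul_left _
  · simp_rw [tsum_mul_left]
    exact Continuous.intervalIntegrable
      ((hdc.norm.mul hgc.norm).mul continuous_const) _ _
  · refine Eventually.of_forall fun θ _ => ?_
    have h2 : ∑ i, ‖z i (circleMap c R θ)‖ < 1 :=
      (Finset.sum_le_sum fun i _ => hβ i _ (hmem θ)).trans_lt h1
    refine hasSum_of_eq ((hasSum_logCoeff (fun i => z i (circleMap c R θ)) h2).mul_left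
      (deriv (circleMap c R) θ * g (circleMap c R θ))) (fun e => ?_) ?_
    · rw [smul_eq_mul]; ring
    · rw [smul_eq_mul]; ring

/-! ### Lagrange inversion for the logarithm of a root -/

/-- By the mean value inequality Φ - c·id is Lipschitz with constant |c|/2 on the disc, so Φ is
injective there; its derivative cannot vanish either. Non-vanishing of `dslope` records both facts.
-/
theorem dslope_ne_zero_of_norm_deriv_sub_le {Φ : ℂ → ℂ} (hΦ : Differentiable ℂ Φ) {R : ℝ} {c : ℂ}
    (hc : c ≠ 0) (hd : ∀ v ∈ Metric.closedBall (0 : ℂ) R, ‖deriv Φ v - c‖ ≤ ‖c‖ / 2) {u : ℂ}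
    (hu : u ∈ Metric.closedBall (0 : ℂ) R) : ∀ v ∈ Metric.closedBall (0 : ℂ) R,
      dslope Φ u v ≠ 0 := by
  have hc' : 0 < ‖c‖ := norm_pos_iff.2 hc
  intro v hv h0
  by_cases huv : v = u
  · subst huv
    rw [dslope_same] at h0
    have := hd v hv
    rw [h0, zero_sub, norm_neg] at this
    linarith
  · have h1 : Φ v = Φ u := by
      have := sub_smul_dslope Φ u v
      rw [h0, smul_zero] at this
      exact (sub_eq_zero.1 this.symm)
    have hder : ∀ w, HasDerivAt (fun w => Φ w - c * w) (deriv Φ w - c) w := fun w =>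
      ((hΦ w).hasDerivAt.sub ((hasDerivAt_id w).const_mul c)).congr_deriv (by simp)
    have h2 := (convex_closedBall (0 : ℂ) R).norm_image_sub_le_of_norm_hasDerivWithin_le
      (fun w _ => (hder w).hasDerivWithinAt) hd hu hv
    rw [h1, show Φ u - c * v - (Φ u - c * u) = -(c * (v - u)) by ring, norm_neg, norm_mul] at h2
    have h3 : 0 < ‖v - u‖ := norm_pos_iff.2 (sub_ne_zero.2 huv)
    nlinarith [mul_pos hc' h3]

/-- Since Φ(v) = (v - u) `dslope Φ u v`, this is Cauchy's formula for ψ divided by the slope. -/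
theorem circleIntegral_div_of_simple_zero {Φ ψ : ℂ → ℂ} (hΦ : Differentiable ℂ Φ)
    (hψ : Differentiable ℂ ψ) {R : ℝ} {u : ℂ} (hu : u ∈ Metric.ball (0 : ℂ) R) (h0 : Φ u = 0)
    (hd : ∀ v ∈ Metric.closedBall (0 : ℂ) R, dslope Φ u v ≠ 0) :
    ∮ v in C(0, R), ψ v / Φ v = 2 * Real.pi * Complex.I * (ψ u / deriv Φ u) := by
  have hR : 0 < R := (dist_nonneg).trans_lt (Metric.mem_ball.1 hu)
  have hds : Differentiable ℂ (dslope Φ u) := by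
    have := (Complex.differentiableOn_dslope (f := Φ) (c := u) (s := Set.univ) univ_mem).2
      hΦ.differentiableOn
    exact differentiableOn_univ.1 this
  have h1 : DifferentiableOn ℂ (fun v => ψ v / dslope Φ u v) (Metric.closedBall 0 R) :=
    fun v hv => ((hψ v).div (hds v) (hd v hv)).differentiableWithinAt
  have h2 := h1.circleIntegral_sub_inv_smul hu
  rw [dslope_same] at h2
  rw [smul_eq_mul] at h2
  rw [← h2]
  refine circleIntegral.integral_congr hR.le fun v hv => ?_
  have hne : v - u ≠ 0 := by
    intro h
    rw [sub_eq_zero.1 h] at hv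
    exact absurd (Metric.mem_sphere.1 hv) (Metric.mem_ball.1 hu).ne
  have h3 : Φ v = (v - u) * dslope Φ u v := by
    have := sub_smul_dslope Φ u v
    rw [h0, sub_zero] at this
    exact this.symm
  have h4 := hd v (Metric.sphere_subset_closedBall hv)
  simp only [smul_eq_mul]
  rw [h3]
  field_simp

theorem norm_exp_mul_sub_one_le {n : ℕ} {v : ℂ} (hv : n * ‖v‖ ≤ 1 / 8) :
    ‖Complex.exp (n * v) - 1‖ ≤ 1 / 4 := by
  have h : ‖(n : ℂ) * v‖ ≤ 1 / 8 := by simpa using hv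
  have := Complex.norm_exp_sub_one_le (x := n * v) (by linarith)
  linarith

/-- From |e^x - 1 - x| ≤ |x|² with |x| = 1/8: the norm is at least 1/8 - 1/64. -/
theorem le_norm_exp_mul_sub_one {n : ℕ} {v : ℂ} (hv : n * ‖v‖ = 1 / 8) :
    1 / 16 ≤ ‖Complex.exp (n * v) - 1‖ := by
  have h : ‖(n : ℂ) * v‖ = 1 / 8 := by simpa using hv
  have h1 := Complex.norm_exp_sub_one_sub_id_le (x := n * v) (by linarith)
  rw [h] at h1
  have h2 := norm_sub_norm_le ((n : ℂ) * v) ((n : ℂ) * v - (Complex.exp (n * v) - 1))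
  rw [sub_sub_cancel, h] at h2
  rw [norm_sub_rev] at h1
  linarith

theorem hasDerivAt_exp_mul (c v : ℂ) :
    HasDerivAt (fun v => Complex.exp (c * v)) (c * Complex.exp (c * v)) v := by
  simpa [mul_comm] using ((hasDerivAt_id v).const_mul c).cexp

theorem hasDerivAt_exp_mul_sub_one (c v : ℂ) :
    HasDerivAt (fun v => Complex.exp (c * v) - 1) (c * Complex.exp (c * v)) v :=
  (hasDerivAt_exp_mul c v).sub_const 1

theorem dslope_exp_ne_zero {n : ℕ} (hn : 0 < n) : ∀ v ∈ Metric.closedBall (0 : ℂ) (1 / (8 * n)),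
    dslope (fun v => Complex.exp (n * v) - 1) 0 v ≠ 0 := by
  have hn' : (0 : ℝ) < n := by exact_mod_cast hn
  refine dslope_ne_zero_of_norm_deriv_sub_le (c := n)
    (fun v => (hasDerivAt_exp_mul_sub_one n v).differentiableAt) (by exact_mod_cast hn.ne') ?_
    (by simp)
  intro v hv
  rw [(hasDerivAt_exp_mul_sub_one n v).deriv, ← mul_sub_one, norm_mul]
  have := norm_exp_mul_sub_one_le (n := n) (v := v) (by
    have := mem_closedBall_zero_iff.1 hv
    calc (n : ℝ) * ‖v‖ ≤ n * (1 / (8 * n)) := by gcongr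
      _ = 1 / 8 := by field_simp)
  nlinarith [norm_nonneg (n : ℂ), Complex.norm_natCast n]

theorem exp_mul_sub_one_ne_zero {n : ℕ} (hn : 0 < n) {v : ℂ}
    (hv : v ∈ Metric.sphere (0 : ℂ) (1 / (8 * n))) : n * ‖v‖ = 1 / 8 ∧
      Complex.exp (n * v) - 1 ≠ 0 := by
  have hn' : (0 : ℝ) < n := by exact_mod_cast hn
  have h : n * ‖v‖ = 1 / 8 := by rw [mem_sphere_zero_iff_norm.1 hv]; field_simp
  refine ⟨h, fun h0 => ?_⟩
  have := le_norm_exp_mul_sub_one h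
  rw [h0, norm_zero] at this
  linarith

/-- In the variable s = e^{nv} - 1 the residue is the coefficient of s^m in (1/n)(1 + s)^{c/n - 1}.
Instead of a substitution, the induction integrates the derivative of e^{(c-n)v} / (e^{nv} -
1)^{m+1}, which ties the case (m + 1, c) to (m, c - n). -/
theorem circleIntegral_exp_div_pow {n : ℕ} (hn : 0 < n) (m : ℕ) (c : ℂ) :
    ∮ v in C(0, 1 / (8 * n)), Complex.exp (c * v) / (Complex.exp (n * v) - 1) ^ (m + 1) =
      2 * Real.pi * Complex.I * ((1 / n) * (∏ i ∈ Finset.range m, (c / n - (i + 1))) /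
        m.factorial) := by
  have hn' : (0 : ℝ) < n := by exact_mod_cast hn
  have hnC : (n : ℂ) ≠ 0 := by exact_mod_cast hn.ne'
  have hR : 0 < 1 / (8 * (n : ℝ)) := by positivity
  induction m generalizing c with
  | zero =>
    simp only [zero_add, pow_one]
    rw [circleIntegral_div_of_simple_zero (Φ := fun v => Complex.exp (n * v) - 1) (u := 0)
      (fun v => (hasDerivAt_exp_mul_sub_one n v).differentiableAt)
      (fun v => (hasDerivAt_exp_mul c v).differentiableAt) (by simpa using hn) (by simp)
      (dslope_exp_ne_zero hn), (hasDerivAt_exp_mul_sub_one n 0).deriv]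
    simp
  | succ m ih =>
    have key : ∮ v in C(0, 1 / (8 * n)),
        (((c - n) * (Complex.exp ((c - n) * v) / (Complex.exp (n * v) - 1) ^ (m + 1))) -
          (n * (m + 1)) * (Complex.exp (c * v) / (Complex.exp (n * v) - 1) ^ (m + 1 + 1))) = 0 := by
      refine circleIntegral.integral_eq_zero_of_hasDerivWithinAt
        (f := fun v => Complex.exp ((c - n) * v) / (Complex.exp (n * v) - 1) ^ (m + 1)) hR.le
        fun v hv => ?_
      have hE := (exp_mul_sub_one_ne_zero hn hv).2
      have := (hasDerivAt_exp_mul (c - n) v).div ((hasDerivAt_exp_mul_sub_one n v).pow (m + 1))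
        (pow_ne_zero _ hE)
      refine (this.congr_deriv ?_).hasDerivWithinAt
      rw [show c * v = (c - n) * v + n * v by ring, Complex.exp_add]
      simp only [Nat.add_sub_cancel, Pi.pow_apply]
      field_simp
      push_cast
      ring
    have hcont : ∀ (d : ℂ) (k : ℕ), CircleIntegrable
        (fun v => Complex.exp (d * v) / (Complex.exp (n * v) - 1) ^ k) 0 (1 / (8 * n)) := by
      intro d k
      refine ContinuousOn.circleIntegrable hR.le ?_
      refine ContinuousOn.div (by fun_prop) (by fun_prop) fun v hv => ?_
      exact pow_ne_zero _ (exp_mul_sub_one_ne_zero hn hv).2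
    have c1 := (hcont (c - n) (m + 1)).const_smul (a := c - n)
    have c2 := (hcont c (m + 1 + 1)).const_smul (a := (n * (m + 1) : ℂ))
    have key := (circleIntegral.integral_sub c1 c2).symm.trans key
    simp only [Pi.smul_apply, smul_eq_mul] at key
    rw [circleIntegral.integral_const_mul, circleIntegral.integral_const_mul, ih, sub_eq_zero] at key
    have hm : (m : ℂ) + 1 ≠ 0 := by exact_mod_cast m.succ_ne_zero
    have hf : (m.factorial : ℂ) ≠ 0 := by exact_mod_cast m.factorial_ne_zero
    have h3 : (n : ℂ) * (m + 1) ≠ 0 := mul_ne_zero hnC hm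
    refine mul_left_cancel₀ h3 (key.symm.trans ?_)
    -- Passing from c to c - n shifts the factors by one; the missing first factor c/n - 1 comes
    -- from the coefficient c - n.
    rw [Finset.prod_range_succ', Nat.factorial_succ]
    have : ∏ i ∈ Finset.range m, ((c - n) / n - ((i : ℂ) + 1)) =
        ∏ i ∈ Finset.range m, (c / n - (((i + 1 : ℕ) : ℂ) + 1)) := by
      refine Finset.prod_congr rfl fun i _ => ?_
      push_cast
      field_simp
      ring
    rw [this]
    push_cast
    field_simp
    ring

/-- The sum `∑ a_k e^{k v}` over `1 ≤ k ≤ n - 1`. -/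
def expSum (n : ℕ) (a : Fin (n - 1) → ℂ) (v : ℂ) : ℂ :=
  ∑ k : Fin (n - 1), a k * Complex.exp (((k : ℕ) + 1 : ℂ) * v)

theorem hasDerivAt_expSum (n : ℕ) (a : Fin (n - 1) → ℂ) (v : ℂ) :
    HasDerivAt (expSum n a) (∑ k : Fin (n - 1), a k * (((k : ℕ) + 1 : ℂ) *
      Complex.exp (((k : ℕ) + 1 : ℂ) * v))) v :=
  HasDerivAt.fun_sum fun k _ => (hasDerivAt_exp_mul _ v).const_mul (a k)

theorem norm_exp_index_le {n : ℕ} (k : Fin (n - 1)) {v : ℂ} (hv : n * ‖v‖ ≤ 1 / 8) :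
    ‖Complex.exp (((k : ℕ) + 1 : ℂ) * v)‖ ≤ 3 := by
  refine (Complex.norm_exp_le_exp_norm _).trans ((Real.exp_le_exp.2 ?_).trans
    Real.exp_one_lt_three.le)
  rw [norm_mul]
  have h1 : ‖((k : ℕ) + 1 : ℂ)‖ ≤ n := by
    have : ((k : ℕ) + 1 : ℂ) = ((k + 1 : ℕ) : ℂ) := by push_cast; rfl
    rw [this, Complex.norm_natCast]
    exact_mod_cast (by omega : (k : ℕ) + 1 ≤ n)
  nlinarith [norm_nonneg v]

theorem norm_deriv_expSum_le {n : ℕ} {a : Fin (n - 1) → ℂ} (ha : ∀ k, ‖a k‖ ≤ 1 / (100 * n))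
    {v : ℂ} (hv : n * ‖v‖ ≤ 1 / 8) : ‖deriv (expSum n a) v‖ ≤ n / 4 := by
  rw [(hasDerivAt_expSum n a v).deriv]
  rcases Nat.eq_zero_or_pos n with rfl | hn
  · simp
  have hn' : (0 : ℝ) < n := by exact_mod_cast hn
  have : ∀ k : Fin (n - 1), ‖a k * (((k : ℕ) + 1 : ℂ) *
      Complex.exp (((k : ℕ) + 1 : ℂ) * v))‖ ≤ 1 / (100 * n) * (n * 3) := by
    intro k
    have h1 : ‖((k : ℕ) + 1 : ℂ)‖ ≤ n := by
      have : ((k : ℕ) + 1 : ℂ) = ((k + 1 : ℕ) : ℂ) := by push_cast; rfl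
      rw [this, Complex.norm_natCast]
      exact_mod_cast (by omega : (k : ℕ) + 1 ≤ n)
    rw [norm_mul, norm_mul]
    have := norm_exp_index_le k hv
    have := ha k
    gcongr
  refine (norm_sum_le_of_le _ fun k _ => this k).trans ?_
  rw [Finset.sum_const, Finset.card_univ, Fintype.card_fin, nsmul_eq_mul]
  have h2 : ((n - 1 : ℕ) : ℝ) ≤ n := by exact_mod_cast Nat.sub_le n 1
  calc ((n - 1 : ℕ) : ℝ) * (1 / (100 * n) * (n * 3)) ≤ n * (1 / (100 * n) * (n * 3)) := by gcongr
    _ = 3 / 100 * n := by field_simp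
    _ ≤ n / 4 := by linarith

/-- The `k`-th summand of `- (∑ a_k e^{k v}) / (e^{n v} - 1)`. -/
def expRatio (n : ℕ) (a : Fin (n - 1) → ℂ) (k : Fin (n - 1)) (v : ℂ) : ℂ :=
  -(a k * Complex.exp (((k : ℕ) + 1 : ℂ) * v)) / (Complex.exp (n * v) - 1)

/-- Numerator at most 3/(100n), denominator at least 1/16. The n - 1 such bounds then add up to less
than 1, which is what the logarithmic series needs. -/
theorem norm_expRatio_le {n : ℕ} (hn : 0 < n) {a : Fin (n - 1) → ℂ}
    (ha : ∀ k, ‖a k‖ ≤ 1 / (100 * n)) (k : Fin (n - 1)) {v : ℂ}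
    (hv : v ∈ Metric.sphere (0 : ℂ) (1 / (8 * n))) : ‖expRatio n a k v‖ ≤ 48 / (100 * n) := by
  have hn' : (0 : ℝ) < n := by exact_mod_cast hn
  have h := (exp_mul_sub_one_ne_zero hn hv).1
  have h1 := le_norm_exp_mul_sub_one h
  have h2 := norm_exp_index_le k h.le
  have h3 := ha k
  rw [expRatio, norm_div, norm_neg, norm_mul]
  calc _ ≤ 1 / (100 * n) * 3 / (1 / 16 : ℝ) := by gcongr
    _ = _ := by field_simp; norm_num

theorem sum_expRatio_bound_lt_one {n : ℕ} (hn : 0 < n) :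
    ∑ _k : Fin (n - 1), 48 / (100 * (n : ℝ)) < 1 := by
  have hn' : (0 : ℝ) < n := by exact_mod_cast hn
  rw [Finset.sum_const, Finset.card_univ, Fintype.card_fin, nsmul_eq_mul]
  have h2 : ((n - 1 : ℕ) : ℝ) ≤ n := by exact_mod_cast Nat.sub_le n 1
  calc ((n - 1 : ℕ) : ℝ) * (48 / (100 * n)) ≤ n * (48 / (100 * n)) := by gcongr
    _ = 48 / 100 := by field_simp
    _ < 1 := by norm_num

theorem one_add_sum_expRatio {n : ℕ} (a : Fin (n - 1) → ℂ) {v : ℂ}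
    (hv : Complex.exp (n * v) - 1 ≠ 0) : 1 + ∑ k, expRatio n a k v =
      (Complex.exp (n * v) - 1 - expSum n a v) / (Complex.exp (n * v) - 1) := by
  have : ∑ k, expRatio n a k v = -expSum n a v / (Complex.exp (n * v) - 1) := by
    simp only [expRatio, expSum]
    rw [← Finset.sum_div, Finset.sum_neg_distrib]
  rw [this]
  field_simp
  ring

/-- The integral that computes the logarithm of a root. -/
def logIntegral (n : ℕ) (a : Fin (n - 1) → ℂ) : ℂ :=
  -(2 * Real.pi * Complex.I)⁻¹ *
    ∮ v in C(0, 1 / (8 * n)), Complex.log (1 + ∑ k, expRatio n a k v)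

/-- Put E = e^{nv} - 1 and Φ = E - ∑ a_k e^{kv}. In the disc u is the only zero of Φ and 0 the only
zero of E, both simple, so (1/2πi) ∮ v (Φ'/Φ - E'/E) = u. On the circle Φ/E stays in the slit plane,
so v log(Φ/E) is single-valued; integrating its derivative replaces the integral by -∮ log(Φ/E). -/
theorem eq_logIntegral {n : ℕ} (hn : 0 < n) {a : Fin (n - 1) → ℂ}
    (ha : ∀ k, ‖a k‖ ≤ 1 / (100 * n)) {u : ℂ} (hu : ‖u‖ < 1 / (8 * n))
    (hroot : Complex.exp (n * u) = 1 + expSum n a u) : u = logIntegral n a := by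
  have hn' : (0 : ℝ) < n := by exact_mod_cast hn
  have hnC : (n : ℂ) ≠ 0 := by exact_mod_cast hn.ne'
  have hR : 0 < 1 / (8 * (n : ℝ)) := by positivity
  set E : ℂ → ℂ := fun v => Complex.exp (n * v) - 1 with hEdef
  set Φ : ℂ → ℂ := fun v => E v - expSum n a v with hΦdef
  have hE : ∀ v, HasDerivAt E (n * Complex.exp (n * v)) v := hasDerivAt_exp_mul_sub_one n
  have hE1 : Differentiable ℂ E := fun v => (hE v).differentiableAt
  have hΦ1 : Differentiable ℂ Φ := fun v =>
    (hE1 v).sub (hasDerivAt_expSum n a v).differentiableAt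
  have hdE : Differentiable ℂ (deriv E) := hE1.deriv
  have hdΦ : Differentiable ℂ (deriv Φ) := hΦ1.deriv
  have hball : ∀ v ∈ Metric.closedBall (0 : ℂ) (1 / (8 * n)), n * ‖v‖ ≤ 1 / 8 := by
    intro v hv
    have := mem_closedBall_zero_iff.1 hv
    calc (n : ℝ) * ‖v‖ ≤ n * (1 / (8 * n)) := by gcongr
      _ = 1 / 8 := by field_simp
  have hu' : u ∈ Metric.ball (0 : ℂ) (1 / (8 * n)) := by simpa using hu
  -- On the disc the derivative of E is within n/4 of n and that of the exponential sum is at most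
  -- n/4, so Φ' is within n/2 of n.
  have hds : ∀ v ∈ Metric.closedBall (0 : ℂ) (1 / (8 * n)), dslope Φ u v ≠ 0 := by
    refine dslope_ne_zero_of_norm_deriv_sub_le (c := n) hΦ1 hnC (fun v hv => ?_)
      (Metric.ball_subset_closedBall hu')
    have h1 : deriv Φ v = n * Complex.exp (n * v) - deriv (expSum n a) v :=
      ((hE v).sub (hasDerivAt_expSum n a v).differentiableAt.hasDerivAt).deriv
    have h2 := norm_exp_mul_sub_one_le (hball v hv)
    have h3 := norm_deriv_expSum_le ha (hball v hv)
    rw [h1, Complex.norm_natCast]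
    calc _ = ‖n * (Complex.exp (n * v) - 1) - deriv (expSum n a) v‖ := by congr 1; ring
      _ ≤ ‖n * (Complex.exp (n * v) - 1)‖ + ‖deriv (expSum n a) v‖ := norm_sub_le _ _
      _ ≤ n * (1 / 4) + n / 4 := by
        rw [norm_mul, Complex.norm_natCast]; gcongr
      _ = _ := by ring
  have hΦu : Φ u = 0 := by simp only [hΦdef, hEdef, hroot]; ring
  have i1 := circleIntegral_div_of_simple_zero (ψ := fun v => v * deriv Φ v) hΦ1
    (differentiable_id.mul hdΦ) hu' hΦu hds
  have i2 := circleIntegral_div_of_simple_zero (Φ := E) (ψ := fun v => v * deriv E v) hE1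
    (differentiable_id.mul hdE) (u := 0) (by simpa using hn) (by simp [hEdef])
    (dslope_exp_ne_zero hn)
  have hd0 : deriv Φ u ≠ 0 := by
    have := hds u (Metric.ball_subset_closedBall hu')
    rwa [dslope_same] at this
  rw [mul_div_cancel_right₀ _ hd0] at i1
  rw [zero_mul, zero_div, mul_zero] at i2
  have hEne : ∀ v ∈ Metric.sphere (0 : ℂ) (1 / (8 * n)), E v ≠ 0 :=
    fun v hv => (exp_mul_sub_one_ne_zero hn hv).2
  have hslit : ∀ v ∈ Metric.sphere (0 : ℂ) (1 / (8 * n)), Φ v / E v ∈ Complex.slitPlane := by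
    intro v hv
    have := one_add_sum_expRatio a (hEne v hv)
    change _ = Φ v / E v at this
    rw [← this]
    refine Complex.mem_slitPlane_of_norm_lt_one ?_
    exact (norm_sum_le_of_le _ fun k _ => norm_expRatio_le hn ha k hv).trans_lt
      (sum_expRatio_bound_lt_one hn)
  have hΦne : ∀ v ∈ Metric.sphere (0 : ℂ) (1 / (8 * n)), Φ v ≠ 0 := fun v hv h0 => by
    have := Complex.slitPlane_ne_zero (hslit v hv)
    rw [h0, zero_div] at this
    exact this rfl
  have key : ∮ v in C(0, 1 / (8 * n)), (Complex.log (Φ v / E v) +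
      (v * deriv Φ v / Φ v - v * deriv E v / E v)) = 0 := by
    refine circleIntegral.integral_eq_zero_of_hasDerivWithinAt
      (f := fun v => v * Complex.log (Φ v / E v)) hR.le fun v hv => ?_
    have h1 := (((hΦ1 v).hasDerivAt.div (hE1 v).hasDerivAt (hEne v hv)).clog (hslit v hv))
    refine (((hasDerivAt_id v).mul h1).congr_deriv ?_).hasDerivWithinAt
    have := hEne v hv
    have := hΦne v hv
    simp only [Pi.div_apply, id]
    field_simp
  have c1 : CircleIntegrable (fun v => Complex.log (Φ v / E v)) 0 (1 / (8 * n)) :=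
    ContinuousOn.circleIntegrable hR.le ((hΦ1.continuous.continuousOn.div
      hE1.continuous.continuousOn hEne).clog hslit)
  have c2 : CircleIntegrable (fun v => v * deriv Φ v / Φ v) 0 (1 / (8 * n)) :=
    ContinuousOn.circleIntegrable hR.le ((continuous_id.mul hdΦ.continuous).continuousOn.div
      hΦ1.continuous.continuousOn hΦne)
  have c3 : CircleIntegrable (fun v => v * deriv E v / E v) 0 (1 / (8 * n)) :=
    ContinuousOn.circleIntegrable hR.le ((continuous_id.mul hdE.continuous).continuousOn.div
      hE1.continuous.continuousOn hEne)
  have key := (circleIntegral.integral_add c1 (c2.sub c3)).symm.trans key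
  simp only [Pi.sub_apply] at key
  rw [circleIntegral.integral_sub c2 c3, i1, i2] at key
  have h2 : ∮ v in C(0, 1 / (8 * n)), Complex.log (1 + ∑ k, expRatio n a k v) =
      ∮ v in C(0, 1 / (8 * n)), Complex.log (Φ v / E v) := by
    refine circleIntegral.integral_congr hR.le fun v hv => ?_
    rw [one_add_sum_expRatio a (hEne v hv)]
  rw [logIntegral, h2, eq_neg_of_add_eq_zero_left key]
  field_simp [Complex.two_pi_I_ne_zero]
  ring

/-- The weight `∑ k b(k)` of a multidegree. -/
def weight {n : ℕ} (b : Fin (n - 1) → ℕ) : ℕ := ∑ k : Fin (n - 1), ((k : ℕ) + 1) * b k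

/-- The term of multidegree `b` in the expansion of the logarithm of a root. -/
def rootTerm (n : ℕ) (a : Fin (n - 1) → ℂ) (b : Fin (n - 1) → ℕ) : ℂ :=
  if ∑ k, b k = 0 then 0 else
    1 / n * (∏ i ∈ Finset.range (∑ k, b k - 1),
      ((weight b : ℂ) / n - ((i : ℂ) + 1))) *
      ((∏ k, a k ^ b k) / ∏ k, ((b k).factorial : ℂ))

theorem hasSum_rootTerm {n : ℕ} (hn : 0 < n) {a : Fin (n - 1) → ℂ}
    (ha : ∀ k, ‖a k‖ ≤ 1 / (100 * n)) : HasSum (rootTerm n a) (logIntegral n a) := by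
  have hR : 0 ≤ 1 / (8 * (n : ℝ)) := by positivity
  have hEne : ∀ v ∈ Metric.sphere (0 : ℂ) (1 / (8 * n)), Complex.exp (n * v) - 1 ≠ 0 :=
    fun v hv => (exp_mul_sub_one_ne_zero hn hv).2
  have := hasSum_circleIntegral_log hR 0 (expRatio n a) (fun _ => 48 / (100 * n)) (fun _ => 1)
    (fun k => by
      unfold expRatio
      exact ContinuousOn.div (by fun_prop) (by fun_prop) hEne)
    continuousOn_const (fun k v hv => norm_expRatio_le hn ha k hv) (sum_expRatio_bound_lt_one hn)
  refine hasSum_of_eq (this.mul_left (-(2 * Real.pi * Complex.I)⁻¹)) (fun b => ?_) (by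
    simp [logIntegral])
  unfold rootTerm logCoeff
  split_ifs with h
  · simp
  obtain ⟨m, hm⟩ : ∃ m, ∑ k, b k = m + 1 := ⟨_, (Nat.succ_pred h).symm⟩
  have h1 : ∀ v, ∏ k, expRatio n a k v ^ b k = ((-1) ^ (m + 1) * ∏ k, a k ^ b k) *
      (Complex.exp ((weight b : ℂ) * v) /
        (Complex.exp (n * v) - 1) ^ (m + 1)) := by
    intro v
    rw [← hm, weight]
    simp only [← Finset.prod_pow_eq_pow_sum]
    push_cast
    rw [Finset.sum_mul, Complex.exp_sum, ← Finset.prod_mul_distrib, ← Finset.prod_div_distrib,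
      ← Finset.prod_mul_distrib]
    refine Finset.prod_congr rfl fun k _ => ?_
    rw [expRatio, show ((k : ℕ) + 1 : ℂ) * b k * v = b k * (((k : ℕ) + 1 : ℂ) * v) by ring,
      Complex.exp_nat_mul (((k : ℕ) + 1 : ℂ) * v), div_pow, neg_pow, mul_pow, mul_div_assoc',
      mul_assoc]
  simp only [h1, one_mul]
  rw [circleIntegral.integral_const_mul, circleIntegral_exp_div_pow hn, hm, Nat.add_sub_cancel]
  have hpi := Complex.two_pi_I_ne_zero
  have hf : (m.factorial : ℂ) ≠ 0 := by exact_mod_cast m.factorial_ne_zero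
  -- The signs (-1)^m of the logarithm and (-1)^(m+1) of the ratios leave -1, which cancels the sign
  -- in front of `logIntegral`.
  have hs : ((-1 : ℂ)) ^ m * (-1) ^ (m + 1) = -1 := by
    rw [← pow_add, show m + (m + 1) = 2 * m + 1 by ring, pow_succ, pow_mul]; simp
  push_cast
  set P := ∏ i ∈ Finset.range m, ((weight b : ℂ) / n - ((i : ℂ) + 1))
  set B := ∏ k, a k ^ b k
  set D := ∏ k, ((b k).factorial : ℂ)
  calc _ = -((-1 : ℂ) ^ m * (-1) ^ (m + 1)) * (1 / n * P * (B / D)) := by rw [hs]; ring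
    _ = _ := by
      field_simp

/-! ### Comparison of the expansion of a root with the flat co-ordinates for the orbifold -/

theorem betaN_eq (n : ℕ) (b : Fin (n - 1) → ℕ) : -betaN n b = (weight b : ℚ) / n := by
  unfold betaN weight
  push_cast
  ring

theorem beta0_eq {n : ℕ} (hn : 0 < n) (b : Fin (n - 1) → ℕ) :
    beta0 n b = (weight b : ℚ) / n - (∑ k, b k : ℕ) := by
  have hn' : (n : ℚ) ≠ 0 := by exact_mod_cast hn.ne'
  unfold beta0 weight
  simp only [sub_mul, Finset.sum_sub_distrib, ← Finset.mul_sum]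
  push_cast
  field_simp
  ring

theorem mul_fract_betaN {n : ℕ} (hn : 0 < n) (b : Fin (n - 1) → ℕ) :
    (n : ℚ) * Int.fract (-betaN n b) = ((weight b % n : ℕ) : ℚ) := by
  have hn' : (n : ℚ) ≠ 0 := by exact_mod_cast hn.ne'
  rw [betaN_eq]
  have := Int.fract_div_natCast_eq_div_natCast_mod (k := ℚ) (m := weight b) (n := n)
  rw [this]
  field_simp

theorem Gamma_eq_prod_mul {z : ℂ} (m : ℕ) (hz : ∀ j : ℤ, z ≠ j) :
    Complex.Gamma z = (∏ i ∈ Finset.range m, (z - (i + 1))) * Complex.Gamma (z - m) := by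
  induction m with
  | zero => simp
  | succ m ih =>
    have h : z - (m + 1) ≠ 0 := fun h => hz (m + 1) (by push_cast; exact sub_eq_zero.1 h)
    rw [ih, Finset.prod_range_succ, show z - m = z - (m + 1) + 1 by ring,
      Complex.Gamma_add_one _ h]
    push_cast
    ring

theorem sin_pi_add_nat (z : ℂ) (m : ℕ) :
    Complex.sin (Real.pi * (z + m)) = (-1) ^ m * Complex.sin (Real.pi * z) := by
  rw [mul_add, mul_comm (Real.pi : ℂ) m, Complex.sin_antiperiodic.add_nat_mul_eq]

/-- The reflection formula at k/n and at k/n + q: the two values of π/sin differ by (-1)^q. What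
remains is a quotient of Gamma values whose arguments differ by m, which is the product. As 0 < k <
n, no argument is an integer and no pole or zero interferes. -/
theorem Gamma_quotient {n k q m : ℕ} (hk : 1 ≤ k) (hkn : k < n) :
    Complex.Gamma (1 - (k : ℂ) / n) * Complex.Gamma ((k : ℂ) / n) /
      (Complex.Gamma (1 + ((k : ℂ) / n + q - (m + 1))) * Complex.Gamma (1 - ((k : ℂ) / n + q))) =
      (-1) ^ q * ∏ i ∈ Finset.range m, ((k : ℂ) / n + q - (i + 1)) := by
  have hn : (n : ℂ) ≠ 0 := by exact_mod_cast (by omega : n ≠ 0)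
  have hz : ∀ j : ℤ, (k : ℂ) / n + q ≠ j := by
    intro j h
    have h1 : (k : ℂ) = n * (j - q) := by
      rw [← h]; field_simp; ring
    have h2 : (k : ℤ) = n * (j - q) := by exact_mod_cast h1
    have h3 : (n : ℤ) ∣ k := ⟨_, h2⟩
    have h4 := Int.natCast_dvd_natCast.1 h3
    exact absurd (Nat.le_of_dvd hk h4) (by omega)
  have hsin : Complex.sin (Real.pi * ((k : ℂ) / n)) ≠ 0 := by
    intro h
    obtain ⟨j, hj⟩ := Complex.sin_eq_zero_iff.1 h
    have hpi : (Real.pi : ℂ) ≠ 0 := by exact_mod_cast Real.pi_ne_zero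
    refine hz (j + q) ?_
    have : (k : ℂ) / n = j := mul_left_cancel₀ hpi (hj.trans (mul_comm _ _))
    rw [this]; push_cast; ring
  have r1 := Complex.Gamma_mul_Gamma_one_sub ((k : ℂ) / n)
  have r2 := Complex.Gamma_mul_Gamma_one_sub ((k : ℂ) / n + q)
  rw [sin_pi_add_nat] at r2
  have hpi : (Real.pi : ℂ) ≠ 0 := by exact_mod_cast Real.pi_ne_zero
  have hs : ((-1 : ℂ)) ^ q * (-1) ^ q = 1 := by rw [← mul_pow]; simp
  have hs0 : ((-1 : ℂ)) ^ q ≠ 0 := pow_ne_zero _ (by norm_num)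
  have r3 := Gamma_eq_prod_mul m hz
  have e1 : 1 + ((k : ℂ) / n + q - (m + 1)) = (k : ℂ) / n + q - m := by ring
  have g0 : Complex.Gamma ((k : ℂ) / n + q) * Complex.Gamma (1 - ((k : ℂ) / n + q)) ≠ 0 := by
    rw [r2]
    exact div_ne_zero hpi (mul_ne_zero hs0 hsin)
  have g1 := right_ne_zero_of_mul g0
  have g2 : Complex.Gamma ((k : ℂ) / n + q - m) ≠ 0 := by
    intro h
    rw [r3, h, mul_zero] at g0
    simp at g0
  rw [e1, mul_comm (Complex.Gamma (1 - (k : ℂ) / n)), r1, div_eq_iff (mul_ne_zero g2 g1)]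
  have : (∏ i ∈ Finset.range m, ((k : ℂ) / n + q - (i + 1))) *
      Complex.Gamma ((k : ℂ) / n + q - m) * Complex.Gamma (1 - ((k : ℂ) / n + q)) =
      Real.pi / ((-1) ^ q * Complex.sin (Real.pi * ((k : ℂ) / n))) := by
    rw [← r3, r2]
  calc _ = (-1) ^ q * (Real.pi / ((-1) ^ q * Complex.sin (Real.pi * ((k : ℂ) / n)))) := by
        field_simp
    _ = _ := by rw [← this]; ring

/-- Here b(n) = -weight/n and b(0) = weight/n - |b|, so the condition on b selects a residue class
of the weight modulo n. With weight = k + nq and |b| = m + 1 the Gamma factors are those of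
`Gamma_quotient`. -/
theorem fTerm_eq {n k : ℕ} (hk : 1 ≤ k) (hkn : k < n) (x : Chart n) (b : Fin (n - 1) → ℕ) :
    fTerm n k x b = if weight b % n = k then (-1) ^ (weight b / n) *
      (∏ i ∈ Finset.range (∑ k, b k - 1), ((weight b : ℂ) / n - ((i : ℂ) + 1))) *
      ((∏ j, x.2 j ^ b j) / ∏ j, ((b j).factorial : ℂ)) else 0 := by
  have hn : 0 < n := by omega
  have hnC : (n : ℂ) ≠ 0 := by exact_mod_cast hn.ne'
  unfold fTerm
  rw [mul_fract_betaN hn]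
  refine if_ctx_congr Nat.cast_inj (fun h => ?_) (fun _ => rfl)
  obtain ⟨m, hm⟩ : ∃ m, ∑ k, b k = m + 1 := by
    refine ⟨_, (Nat.succ_pred fun h0 => ?_).symm⟩
    have : weight b = 0 := by
      refine Finset.sum_eq_zero fun j _ => ?_
      rw [Finset.sum_eq_zero_iff.1 h0 j (Finset.mem_univ j), mul_zero]
    rw [this, Nat.zero_mod] at h
    omega
  have hw : (weight b : ℂ) / n = (k : ℂ) / n + (weight b / n : ℕ) := by
    have := Nat.mod_add_div (weight b) n
    rw [h] at this
    have : ((k + n * (weight b / n) : ℕ) : ℂ) = weight b := by rw [this]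
    rw [← this]
    push_cast
    field_simp
  have h0 : ((beta0 n b : ℚ) : ℂ) = (k : ℂ) / n + (weight b / n : ℕ) - (m + 1) := by
    rw [beta0_eq hn, ← hw, hm]
    push_cast
    ring
  have h1 : ((betaN n b : ℚ) : ℂ) = -((k : ℂ) / n + (weight b / n : ℕ)) := by
    rw [← hw, ← neg_neg (betaN n b), betaN_eq]
    push_cast
    ring
  rw [h0, h1, hm, Nat.add_sub_cancel, hw, ← Gamma_quotient hk hkn]
  rw [← sub_eq_add_neg, div_mul_div_comm]

/-- No f_k accounts for weights divisible by n, so these must drop out of the expansion of a root.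
If weight = nq, then 1 ≤ q < |b| because every index lies in [1, n - 1], and the factor with i = q -
1 is 0. -/
theorem prod_range_eq_zero_of_mod_eq_zero {n : ℕ} (hn : 2 ≤ n) {b : Fin (n - 1) → ℕ}
    (hb : ∑ k, b k ≠ 0) (h : weight b % n = 0) :
    ∏ i ∈ Finset.range (∑ k, b k - 1), ((weight b : ℂ) / n - ((i : ℂ) + 1)) = 0 := by
  have hnC : (n : ℂ) ≠ 0 := by exact_mod_cast (by omega : n ≠ 0)
  obtain ⟨q, hq⟩ := Nat.dvd_of_mod_eq_zero h
  have h1 : ∑ k, b k ≤ weight b :=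
    Finset.sum_le_sum fun k _ => Nat.le_mul_of_pos_left _ (Nat.succ_pos _)
  have h2 : weight b ≤ (n - 1) * ∑ k, b k := by
    rw [weight, Finset.mul_sum]
    exact Finset.sum_le_sum fun k _ => Nat.mul_le_mul_right _ (by omega)
  have h3 : 1 ≤ q := by
    rcases Nat.eq_zero_or_pos q with rfl | h
    · omega
    · exact h
  have h4 : q < ∑ k, b k := by
    by_contra hlt
    have h5 : (n - 1) * ∑ k, b k ≤ (n - 1) * q := Nat.mul_le_mul_left _ (by omega)
    have h6 : n * q = (n - 1) * q + q := by
      obtain ⟨l, rfl⟩ : ∃ l, n = l + 1 := ⟨n - 1, by omega⟩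
      rw [Nat.add_sub_cancel]; ring
    omega
  refine Finset.prod_eq_zero (i := q - 1) (Finset.mem_range.2 (by omega)) ?_
  obtain ⟨p, rfl⟩ : ∃ p, q = p + 1 := ⟨q - 1, by omega⟩
  rw [hq]
  push_cast [Nat.add_sub_cancel]
  field_simp
  ring

/-- At most one k contributes, namely weight mod n. Since c^n = -1, the power c^weight splits as
c^(weight mod n) (-1)^(weight div n), and the sign is the one produced by the Gamma factors. -/
theorem rootTerm_eq_sum_fTerm {n : ℕ} (hn : 2 ≤ n) (x : Chart n) {c : ℂ} (hc : c ^ n = -1)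
    (b : Fin (n - 1) → ℕ) : rootTerm n (fun k => c ^ ((k : ℕ) + 1) * x.2 k) b =
      1 / n * ∑ k ∈ Finset.Ico 1 n, c ^ k * fTerm n k x b := by
  have hf : ∀ k ∈ Finset.Ico 1 n, c ^ k * fTerm n k x b = if weight b % n = k then c ^ k *
      ((-1) ^ (weight b / n) *
      (∏ i ∈ Finset.range (∑ k, b k - 1), ((weight b : ℂ) / n - ((i : ℂ) + 1))) *
      ((∏ j, x.2 j ^ b j) / ∏ j, ((b j).factorial : ℂ))) else 0 := by
    intro k hk
    rw [Finset.mem_Ico] at hk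
    rw [fTerm_eq hk.1 hk.2, mul_ite, mul_zero]
  rw [Finset.sum_congr rfl hf, Finset.sum_ite_eq]
  unfold rootTerm
  by_cases hb : ∑ k, b k = 0
  · have hw : weight b = 0 := by
      refine Finset.sum_eq_zero fun j _ => ?_
      rw [Finset.sum_eq_zero_iff.1 hb j (Finset.mem_univ j), mul_zero]
    simp [hb, hw]
  rw [if_neg hb]
  have hmod : weight b % n < n := Nat.mod_lt _ (by omega)
  by_cases hw : weight b % n = 0
  · rw [prod_range_eq_zero_of_mod_eq_zero hn hb hw, hw]
    simp
  · rw [if_pos (Finset.mem_Ico.2 ⟨by omega, hmod⟩)]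
    have h1 : ∏ k : Fin (n - 1), (c ^ ((k : ℕ) + 1) * x.2 k) ^ b k =
        c ^ (weight b % n) * (-1) ^ (weight b / n) * ∏ j, x.2 j ^ b j := by
      rw [← hc, ← pow_mul, ← pow_add, Nat.mod_add_div, weight, ← Finset.prod_pow_eq_pow_sum,
        ← Finset.prod_mul_distrib]
      refine Finset.prod_congr rfl fun k _ => ?_
      rw [mul_pow, ← pow_mul]
    rw [h1]
    ring

/-- The flat co-ordinates for the orbifold. -/
def flatX (n k : ℕ) (x : Chart n) : ℂ := if k = 0 then x.1 else ∑' b, fTerm n k x b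

theorem exists_pow_eq_neg_one {n : ℕ} (hn : 0 < n) : ∃ c : ℂ, c ^ n = -1 ∧ ‖c‖ = 1 := by
  have hnC : (n : ℂ) ≠ 0 := by exact_mod_cast hn.ne'
  refine ⟨Complex.exp ((Real.pi / n : ℝ) * Complex.I), ?_, Complex.norm_exp_ofReal_mul_I _⟩
  rw [← Complex.exp_nat_mul, ← Complex.exp_pi_mul_I]
  congr 1
  push_cast
  field_simp

theorem norm_pow_mul_le {n : ℕ} {x : Chart n} (hx : ∀ k, ‖x.2 k‖ ≤ 1 / (100 * n)) {c : ℂ}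
    (hc : ‖c‖ = 1) (k : Fin (n - 1)) : ‖c ^ ((k : ℕ) + 1) * x.2 k‖ ≤ 1 / (100 * n) := by
  rw [norm_mul, norm_pow, hc, one_pow, one_mul]
  exact hx k

/-- On its residue class the term is n times a term of the root expansion, up to a number of modulus
1; elsewhere it is 0. Convergence is thus inherited from the logarithmic series. -/
theorem summable_fTerm {n k : ℕ} (hn : 2 ≤ n) (hk : 1 ≤ k) (hkn : k < n) {x : Chart n}
    (hx : ∀ k, ‖x.2 k‖ ≤ 1 / (100 * n)) : Summable (fTerm n k x) := by
  obtain ⟨c, hc, hc1⟩ := exists_pow_eq_neg_one (n := n) (by omega)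
  have hs := (hasSum_rootTerm (by omega) (norm_pow_mul_le hx hc1)).summable
  refine Summable.of_norm_bounded (hs.norm.mul_left (n : ℝ)) fun b => ?_
  by_cases h : weight b % n = k
  · rw [rootTerm_eq_sum_fTerm hn x hc, Finset.sum_eq_single k]
    · have hn' : (n : ℝ) ≠ 0 := by exact_mod_cast (by omega : n ≠ 0)
      rw [norm_mul, norm_mul, norm_pow, hc1, one_pow, one_mul, norm_div, norm_one,
        Complex.norm_natCast, ← mul_assoc, mul_one_div_cancel hn', one_mul]
    · intro j hj hjk
      rw [Finset.mem_Ico] at hj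
      rw [fTerm_eq hj.1 hj.2, if_neg (by omega), mul_zero]
    · intro h
      exact absurd (Finset.mem_Ico.2 ⟨hk, hkn⟩) h
  · rw [fTerm_eq hk hkn, if_neg h, norm_zero]
    positivity

theorem hasFlatCoordinatesX_flatX {n : ℕ} (hn : 2 ≤ n) {x : Chart n}
    (hx : ∀ k, ‖x.2 k‖ ≤ 1 / (100 * n)) : HasFlatCoordinatesX n x fun k => flatX n k x := by
  refine ⟨by simp [flatX], fun k hk hkn => ?_⟩
  simp only [flatX, if_neg (by omega : k ≠ 0)]
  exact (summable_fTerm hn hk hkn hx).hasSum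

theorem logIntegral_eq_flatX {n : ℕ} (hn : 2 ≤ n) {x : Chart n}
    (hx : ∀ k, ‖x.2 k‖ ≤ 1 / (100 * n)) {c : ℂ} (hc : c ^ n = -1) (hc1 : ‖c‖ = 1) :
    logIntegral n (fun k => c ^ ((k : ℕ) + 1) * x.2 k) =
      1 / n * ∑ k ∈ Finset.Ico 1 n, c ^ k * flatX n k x := by
  refine (hasSum_rootTerm (by omega) (norm_pow_mul_le hx hc1)).unique ?_
  refine hasSum_of_eq ((hasSum_sum fun k hk => ?_ :
    HasSum _ (∑ k ∈ Finset.Ico 1 n, c ^ k * flatX n k x)).mul_left (1 / (n : ℂ)))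
    (rootTerm_eq_sum_fTerm hn x hc) rfl
  rw [Finset.mem_Ico] at hk
  exact ((hasFlatCoordinatesX_flatX hn hx).2 k hk.1 hk.2).mul_left _

/-! ### Analytic continuation of the logarithm of a simple root -/

theorem exists_analytic_root {E : Type*} [NormedAddCommGroup E] [NormedSpace ℂ E]
    [CompleteSpace E] {G : E × ℂ → ℂ} {x₀ : E} {u₀ : ℂ} (hG : AnalyticAt ℂ G (x₀, u₀))
    (h0 : G (x₀, u₀) = 0) {d : ℂ} (hd : HasDerivAt (fun u => G (x₀, u)) d u₀) (hd0 : d ≠ 0) :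
    ∃ U : E → ℂ, AnalyticAt ℂ U x₀ ∧ U x₀ = u₀ ∧
      ∀ᶠ z in 𝓝 (x₀, u₀), G z = 0 ↔ z.2 = U z.1 := by
  have hcd : ContDiffAt ℂ ⊤ G (x₀, u₀) := hG.contDiffAt
  have h1 : (fderiv ℂ G (x₀, u₀) ∘L .inr ℂ E ℂ) = ContinuousLinearMap.toSpanSingleton ℂ d := by
    have hu : HasFDerivAt (fun u : ℂ => (x₀, u)) (ContinuousLinearMap.inr ℂ E ℂ) u₀ :=
      hasFDerivAt_prodMk_right x₀ u₀
    exact (hG.differentiableAt.hasFDerivAt.comp u₀ hu).unique hd.hasFDerivAt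
  have h2 : (fderiv ℂ G (x₀, u₀) ∘L .inr ℂ E ℂ).IsInvertible := by
    rw [h1]
    refine ⟨ContinuousLinearEquiv.unitsEquivAut ℂ (Units.mk0 d hd0), ?_⟩
    ext
    simp
  refine ⟨hcd.implicitFunction (by simp) h2, (hcd.contDiffAt_implicitFunction (by simp) h2).analyticAt,
    hcd.implicitFunction_apply_self (by simp) h2, ?_⟩
  filter_upwards [hcd.eventually_apply_eq_iff_implicitFunction (by simp) h2] with z hz
  rw [← h0, hz, eq_comm]

/-- Near (p t, l t) the zero set of G is the graph of `U t`. For s close to t the graph of `U s`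
near p s lies inside that window, so the two germs agree at p s. -/
theorem exists_continuation_of_simple_zero {E : Type*} [NormedAddCommGroup E] [NormedSpace ℂ E]
    [CompleteSpace E] {G : E × ℂ → ℂ} {I : Set ℝ} {p : ℝ → E} {l : ℝ → ℂ}
    (hG : ∀ z, AnalyticAt ℂ G z) (hp : ContinuousOn p I) (hl : ContinuousOn l I)
    (h0 : ∀ t ∈ I, G (p t, l t) = 0)
    (hd : ∀ t ∈ I, ∃ d : ℂ, d ≠ 0 ∧ HasDerivAt (fun u => G (p t, u)) d (l t)) :
    ∃ U : ℝ → E → ℂ, IsAnalyticContinuation I p U ∧ ∀ t ∈ I, U t (p t) = l t ∧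
      ∀ᶠ z in 𝓝 (p t, l t), G z = 0 ↔ z.2 = U t z.1 := by
  have h : ∀ t, ∃ U : E → ℂ, t ∈ I → AnalyticAt ℂ U (p t) ∧ U (p t) = l t ∧
      ∀ᶠ z in 𝓝 (p t, l t), G z = 0 ↔ z.2 = U z.1 := by
    intro t
    by_cases ht : t ∈ I
    · obtain ⟨d, hd0, hd1⟩ := hd t ht
      obtain ⟨U, hU⟩ := exists_analytic_root (hG _) (h0 t ht) hd1 hd0
      exact ⟨U, fun _ => hU⟩
    · exact ⟨0, fun h => absurd h ht⟩
  choose U hU using h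
  refine ⟨U, fun t ht => ⟨(hU t ht).1, ?_⟩, fun t ht => (hU t ht).2⟩
  have h1 : Tendsto (fun s => (p s, l s)) (𝓝[I] t) (𝓝 (p t, l t)) :=
    (hp t ht).prodMk_nhds (hl t ht)
  filter_upwards [h1.eventually (hU t ht).2.2.eventually_nhds, self_mem_nhdsWithin] with s hs hsI
  have h2 : Tendsto (fun x => (x, U s x)) (𝓝 (p s)) (𝓝 (p s, l s)) := by
    have := (hU s hsI).1.continuousAt
    have h3 : Tendsto (U s) (𝓝 (p s)) (𝓝 (l s)) := (hU s hsI).2.1 ▸ this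
    exact tendsto_id.prodMk_nhds h3
  filter_upwards [h2.eventually hs, h2.eventually (hU s hsI).2.2] with x hx1 hx2
  exact hx1.1 (hx2.2 rfl)

theorem IsAnalyticContinuation.sub {E : Type*} [NormedAddCommGroup E] [NormedSpace ℂ E]
    {I : Set ℝ} {p : ℝ → E} {F G : ℝ → E → ℂ} (hF : IsAnalyticContinuation I p F)
    (hG : IsAnalyticContinuation I p G) :
    IsAnalyticContinuation I p fun t x => F t x - G t x := by
  intro t ht
  refine ⟨(hF t ht).1.sub (hG t ht).1, ?_⟩
  filter_upwards [(hF t ht).2, (hG t ht).2] with s h1 h2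
  exact h1.sub h2

/-- The equation satisfied by the logarithms `u` of the roots of `W_X`. -/
def rootEq (n : ℕ) (z : Chart n × ℂ) : ℂ := (WX n z.1).eval (Complex.exp z.2)

theorem eval_WX (n : ℕ) (x : Chart n) (w : ℂ) :
    (WX n x).eval w = w ^ n + ∑ k, x.2 k * w ^ ((k : ℕ) + 1) + 1 := by
  simp [WX, Polynomial.eval_finsetSum]

theorem analyticAt_rootEq (n : ℕ) (z : Chart n × ℂ) : AnalyticAt ℂ (rootEq n) z := by
  have : rootEq n = fun z : Chart n × ℂ => Complex.exp z.2 ^ n +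
      ∑ k, z.1.2 k * Complex.exp z.2 ^ ((k : ℕ) + 1) + 1 := funext fun z => eval_WX n _ _
  rw [this]
  have hx : ∀ k : Fin (n - 1), AnalyticAt ℂ (fun z : Chart n × ℂ => z.1.2 k) z := fun k =>
    (((ContinuousLinearMap.proj k : (Fin (n - 1) → ℂ) →L[ℂ] ℂ).comp
      (ContinuousLinearMap.snd ℂ ℂ (Fin (n - 1) → ℂ))).comp
      (ContinuousLinearMap.fst ℂ (Chart n) ℂ)).analyticAt z
  have he : AnalyticAt ℂ (fun z : Chart n × ℂ => Complex.exp z.2) z :=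
    analyticAt_snd.cexp
  refine ((he.pow n).add ?_).add analyticAt_const
  exact Finset.analyticAt_fun_sum _ fun k _ => (hx k).mul (he.pow _)

theorem hasDerivAt_rootEq (n : ℕ) (x : Chart n) (u : ℂ) :
    HasDerivAt (fun u => rootEq n (x, u))
      ((WX n x).derivative.eval (Complex.exp u) * Complex.exp u) u :=
  ((WX n x).hasDerivAt (Complex.exp u)).comp u (Complex.hasDerivAt_exp u)

/-- Solving for u = log κ rather than for κ fixes the branch of the logarithm along the path. The
zero is simple in u because it is simple in κ and e^u ≠ 0. -/
theorem exists_continuation_log_root {n : ℕ} {I : Set ℝ} {p : ℝ → Chart n} {l : ℝ → ℂ}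
    (hp : ContinuousOn p I) (hl : ContinuousOn l I)
    (h0 : ∀ t ∈ I, (WX n (p t)).eval (Complex.exp (l t)) = 0)
    (hsep : ∀ t ∈ I, (WX n (p t)).Separable) :
    ∃ U : ℝ → Chart n → ℂ, IsAnalyticContinuation I p U ∧ ∀ t ∈ I, U t (p t) = l t ∧
      ∀ᶠ z in 𝓝 (p t, l t), rootEq n z = 0 ↔ z.2 = U t z.1 := by
  refine exists_continuation_of_simple_zero (analyticAt_rootEq n) hp hl h0 fun t ht =>
    ⟨_, mul_ne_zero ?_ (Complex.exp_ne_zero _), hasDerivAt_rootEq n (p t) (l t)⟩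
  exact (hsep t ht).eval₂_derivative_ne_zero (RingHom.id ℂ) (h0 t ht)

/-- With κ = e^l e^v and v = U - l, the equation of the root becomes e^{nv} = 1 + ∑ a_k e^{kv}, a_k
= e^{kl} x_k. Continuity puts v in the disc in which `eq_logIntegral` applies. -/
theorem eventually_root_eq_flatX {n : ℕ} (hn : 2 ≤ n) {l : ℂ} (hl : Complex.exp l ^ n = -1)
    (hl1 : ‖Complex.exp l‖ = 1) {U : Chart n → ℂ} (hU : ContinuousAt U 0) (hU0 : U 0 = l)
    (hroot : ∀ᶠ z in 𝓝 ((0 : Chart n), l), rootEq n z = 0 ↔ z.2 = U z.1) :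
    U =ᶠ[𝓝 0] fun x => l + 1 / n * ∑ k ∈ Finset.Ico 1 n, Complex.exp l ^ k * flatX n k x := by
  have hn' : (0 : ℝ) < n := by exact_mod_cast (by omega : 0 < n)
  have h1 : Tendsto (fun x => (x, U x)) (𝓝 0) (𝓝 ((0 : Chart n), l)) := by
    have h3 : Tendsto U (𝓝 0) (𝓝 l) := hU0 ▸ hU
    exact tendsto_id.prodMk_nhds h3
  have h2 : ∀ᶠ x in 𝓝 (0 : Chart n), ‖U x - l‖ < 1 / (8 * n) := by
    have h3 : Tendsto (fun x => ‖U x - l‖) (𝓝 0) (𝓝 0) := by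
      have : ContinuousAt (fun x => ‖U x - l‖) 0 := (hU.sub continuousAt_const).norm
      have h4 : ‖U 0 - l‖ = 0 := by rw [hU0]; simp
      rw [ContinuousAt, h4] at this
      exact this
    exact h3.eventually_lt_const (by positivity)
  have h3 : ∀ᶠ x in 𝓝 (0 : Chart n), ∀ k, ‖x.2 k‖ ≤ 1 / (100 * n) := by
    refine eventually_all.2 fun k => ?_
    have : ContinuousAt (fun x : Chart n => ‖x.2 k‖) 0 :=
      Continuous.continuousAt (by fun_prop)
    have h4 : Tendsto (fun x : Chart n => ‖x.2 k‖) (𝓝 0) (𝓝 0) := by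
      simpa [ContinuousAt] using this
    exact (h4.eventually_lt_const (by positivity : (0 : ℝ) < 1 / (100 * n))).mono fun _ h => h.le
  filter_upwards [h1.eventually hroot, h2, h3] with x hx1 hx2 hx3
  rw [← logIntegral_eq_flatX hn hx3 hl hl1, ← eq_logIntegral (by omega)
    (norm_pow_mul_le hx3 hl1) hx2]
  · ring
  · have h5 : rootEq n (x, U x) = 0 := hx1.2 rfl
    rw [rootEq, eval_WX] at h5
    simp only at h5
    have h6 : Complex.exp (U x) = Complex.exp l * Complex.exp (U x - l) := by
      rw [← Complex.exp_add]; congr 1; ring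
    rw [h6, mul_pow, hl, ← Complex.exp_nat_mul] at h5
    have h7 : expSum n (fun k => Complex.exp l ^ ((k : ℕ) + 1) * x.2 k) (U x - l) =
        ∑ k : Fin (n - 1), x.2 k * (Complex.exp l * Complex.exp (U x - l)) ^ ((k : ℕ) + 1) := by
      refine Finset.sum_congr rfl fun k _ => ?_
      rw [mul_pow, ← Complex.exp_nat_mul (U x - l)]
      push_cast
      ring
    rw [h7]
    linear_combination -h5

/-! ### Gaussian binomial coefficients -/

/-- The Gaussian binomial coefficients. -/
def gauss (Q : ℂ) : ℕ → ℕ → ℂ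
  | _, 0 => 1
  | 0, _ + 1 => 0
  | m + 1, i + 1 => gauss Q m (i + 1) + Q ^ (m - i) * gauss Q m i

theorem gauss_zero_right (Q : ℂ) (m : ℕ) : gauss Q m 0 = 1 := by cases m <;> rfl

/-- The truncated exponent m - i is harmless, since `gauss Q m i` = 0 for i > m. -/
theorem gauss_succ_succ (Q : ℂ) (m i : ℕ) :
    gauss Q (m + 1) (i + 1) = gauss Q m (i + 1) + Q ^ (m - i) * gauss Q m i := rfl

theorem gauss_of_lt (Q : ℂ) {m i : ℕ} (h : m < i) : gauss Q m i = 0 := by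
  induction m generalizing i with
  | zero => obtain ⟨i, rfl⟩ : ∃ j, i = j + 1 := ⟨i - 1, by omega⟩; rfl
  | succ m ih =>
    obtain ⟨i, rfl⟩ : ∃ j, i = j + 1 := ⟨i - 1, by omega⟩
    rw [gauss_succ_succ, ih (by omega), ih (by omega), mul_zero, add_zero]

theorem gauss_self (Q : ℂ) (m : ℕ) : gauss Q m m = 1 := by
  induction m with
  | zero => rfl
  | succ m ih => rw [gauss_succ_succ, gauss_of_lt Q (Nat.lt_succ_self m), ih]; simp

/-- Because of this value the coefficients of W along the path are, to leading order as t → 0, pure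
powers of q. -/
theorem gauss_at_zero {m i : ℕ} (h : i ≤ m) : gauss 0 m i = 1 := by
  induction m generalizing i with
  | zero => obtain rfl : i = 0 := by omega
            rfl
  | succ m ih =>
    rcases i with _ | i
    · rfl
    rcases Nat.lt_or_ge i m with h1 | h1
    · rw [gauss_succ_succ, ih (by omega), zero_pow (by omega), zero_mul, add_zero]
    · obtain rfl : i = m := by omega
      exact gauss_self 0 _

theorem continuous_gauss (m i : ℕ) : Continuous fun Q => gauss Q m i := by
  induction m generalizing i with
  | zero => rcases i with _ | i <;> exact continuous_const
  | succ m ih =>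
    rcases i with _ | i
    · exact continuous_const
    · exact (ih _).add ((continuous_id.pow _).mul (ih _))

theorem prod_one_add_eq_sum_gauss (q T : ℂ) (m : ℕ) :
    ∏ k ∈ Finset.range m, (1 + q ^ (2 * k) * T) =
      ∑ i ∈ Finset.range (m + 1), q ^ (i * (i - 1)) * gauss (q ^ 2) m i * T ^ i := by
  induction m with
  | zero => simp [gauss_zero_right]
  | succ m ih =>
    rw [Finset.prod_range_succ, ih, Finset.sum_range_succ' _ (m + 1)]
    have h1 : ∑ i ∈ Finset.range (m + 1), q ^ (i * (i - 1)) * gauss (q ^ 2) m i * T ^ i =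
        ∑ i ∈ Finset.range (m + 1), q ^ ((i + 1) * (i + 1 - 1)) * gauss (q ^ 2) m (i + 1) *
          T ^ (i + 1) + 1 := by
      have := Finset.sum_range_succ' (fun i => q ^ (i * (i - 1)) * gauss (q ^ 2) m i * T ^ i) (m + 1)
      rw [Finset.sum_range_succ, gauss_of_lt _ (Nat.lt_succ_self m)] at this
      simpa [gauss_zero_right] using this
    rw [mul_add, mul_one]
    nth_rewrite 1 [h1]
    simp only [gauss_succ_succ, gauss_zero_right]
    have h2 : ∀ i ∈ Finset.range (m + 1), q ^ ((i + 1) * (i + 1 - 1)) *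
        (gauss (q ^ 2) m (i + 1) + (q ^ 2) ^ (m - i) * gauss (q ^ 2) m i) * T ^ (i + 1) =
        q ^ ((i + 1) * (i + 1 - 1)) * gauss (q ^ 2) m (i + 1) * T ^ (i + 1) +
          q ^ (i * (i - 1)) * gauss (q ^ 2) m i * T ^ i * (q ^ (2 * m) * T) := by
      intro i hi
      rw [Finset.mem_range] at hi
      have : q ^ ((i + 1) * (i + 1 - 1)) * (q ^ 2) ^ (m - i) = q ^ (i * (i - 1)) * q ^ (2 * m) := by
        rw [← pow_mul, ← pow_add, ← pow_add]
        congr 1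
        obtain ⟨r, rfl⟩ : ∃ r, m = i + r := ⟨m - i, by omega⟩
        rcases i with _ | i
        · simp
        · simp only [Nat.add_sub_cancel, Nat.add_sub_cancel_left]
          ring
      calc _ = q ^ ((i + 1) * (i + 1 - 1)) * gauss (q ^ 2) m (i + 1) * T ^ (i + 1) +
            (q ^ ((i + 1) * (i + 1 - 1)) * (q ^ 2) ^ (m - i)) * gauss (q ^ 2) m i * T ^ (i + 1) := by
              ring
        _ = _ := by rw [this]; ring
    rw [Finset.sum_congr rfl h2, Finset.sum_add_distrib, ← Finset.sum_mul]
    simp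
    ring

/-- The q-binomial theorem with T = q^{1-n} w and q = e^l. The exponents n - 1 - 2k sum to 0, so the
constant coefficient is 1 like the leading one, as the form of W requires. -/
theorem prod_add_exp_eq_sum_gauss (n : ℕ) (l w : ℂ) :
    ∏ k ∈ Finset.range n, (w + Complex.exp (((n : ℂ) - 1 - 2 * k) * l)) =
      ∑ i ∈ Finset.range (n + 1),
        Complex.exp ((i : ℂ) * (i - n) * l) * gauss (Complex.exp (2 * l)) n i * w ^ i := by
  have h1 : ∀ k ∈ Finset.range n, w + Complex.exp (((n : ℂ) - 1 - 2 * k) * l) =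
      Complex.exp (((n : ℂ) - 1 - 2 * k) * l) *
        (1 + Complex.exp l ^ (2 * k) * (Complex.exp ((1 - n) * l) * w)) := by
    intro k _
    rw [mul_add, mul_one, ← Complex.exp_nat_mul, add_comm, ← mul_assoc, ← mul_assoc,
      ← Complex.exp_add, ← Complex.exp_add]
    congr 1
    conv_lhs => rw [← one_mul w, ← Complex.exp_zero]
    congr 2
    push_cast
    ring
  have h2 : ∏ k ∈ Finset.range n, Complex.exp (((n : ℂ) - 1 - 2 * k) * l) = 1 := by
    rw [← Complex.exp_sum, ← Finset.sum_mul, Finset.sum_sub_distrib, ← Finset.mul_sum]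
    have : ∀ m : ℕ, 2 * ∑ k ∈ Finset.range m, (k : ℂ) = m * (m - 1) := by
      intro m
      induction m with
      | zero => simp
      | succ m ih => rw [Finset.sum_range_succ, mul_add, ih]; push_cast; ring
    rw [this, Finset.sum_const, Finset.card_range, nsmul_eq_mul, sub_self, zero_mul,
      Complex.exp_zero]
  rw [Finset.prod_congr rfl h1, Finset.prod_mul_distrib, h2, one_mul, prod_one_add_eq_sum_gauss]
  refine Finset.sum_congr rfl fun i _ => ?_
  have h3 : Complex.exp l ^ 2 = Complex.exp (2 * l) := by
    rw [← Complex.exp_nat_mul]; norm_num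
  have h4 : Complex.exp l ^ (i * (i - 1)) * Complex.exp ((1 - n) * l) ^ i =
      Complex.exp ((i : ℂ) * (i - n) * l) := by
    rw [← Complex.exp_nat_mul, ← Complex.exp_nat_mul, ← Complex.exp_add]
    congr 1
    rcases i with _ | i
    · simp
    · push_cast [Nat.add_sub_cancel]
      ring
  rw [h3, mul_pow, ← h4]
  ring

/-! ### Coefficients of W, with x_0 = x_n = 1 adjoined -/

theorem entry_of_mem {R : Type*} {n : ℕ} (v : Fin (n - 1) → R) (a : R) (k : Fin (n - 1)) :
    entry v a ((k : ℕ) + 1) = v k := by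
  unfold entry
  rw [dif_pos ⟨by omega, by omega⟩]
  congr 1

theorem entry_of_not_mem {R : Type*} {n : ℕ} (v : Fin (n - 1) → R) (a : R) {j : ℕ}
    (h : ¬ (1 ≤ j ∧ j ≤ n - 1)) : entry v a j = a := dif_neg h

theorem eval_WX_eq_sum {n : ℕ} (hn : 2 ≤ n) (x : Chart n) (w : ℂ) :
    (WX n x).eval w = ∑ i ∈ Finset.range (n + 1), entry x.2 1 i * w ^ i := by
  obtain ⟨m, rfl⟩ : ∃ m, n = m + 1 := ⟨n - 1, by omega⟩
  rw [eval_WX, Finset.sum_range_succ, Finset.sum_range_succ', entry_of_not_mem _ _ (by omega),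
    entry_of_not_mem _ _ (by omega)]
  have h := Fin.sum_univ_eq_sum_range (fun i => entry x.2 1 (i + 1) * w ^ (i + 1)) m
  rw [← h]
  have : ∀ k : Fin (m + 1 - 1), x.2 k * w ^ ((k : ℕ) + 1) =
      entry x.2 1 ((k : ℕ) + 1) * w ^ ((k : ℕ) + 1) := fun k => by rw [entry_of_mem]
  simp only [this]
  change w ^ (m + 1) + (∑ k : Fin m, entry x.2 1 ((k : ℕ) + 1) * w ^ ((k : ℕ) + 1)) + 1 = _
  ring

/-! ### The path -/

/-- The logarithm of the parameter `q = t e^{-π i t / n}`. -/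
def pathParam (n : ℕ) (t : ℝ) : ℂ := (Real.log t : ℂ) - (Real.pi * t / n : ℝ) * Complex.I

/-- The logarithms of the roots `-q^{n - 1 - 2 k}` of `W_X` along the path. -/
def logRoot (n k : ℕ) (t : ℝ) : ℂ :=
  Real.pi * Complex.I + ((n : ℂ) - 1 - 2 * k) * pathParam n t

/-- The path from `y = 0` to `x = 0`. -/
def path (n : ℕ) (t : ℝ) : Chart n :=
  (0, fun j => Complex.exp ((((j : ℕ) + 1 : ℕ) : ℂ) * ((((j : ℕ) + 1 : ℕ) : ℂ) - n) *
    pathParam n t) * gauss (Complex.exp (2 * pathParam n t)) n ((j : ℕ) + 1))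

theorem entry_path {n i : ℕ} (hi : i ≤ n) (t : ℝ) : entry (path n t).2 1 i =
    Complex.exp ((i : ℂ) * (i - n) * pathParam n t) *
      gauss (Complex.exp (2 * pathParam n t)) n i := by
  by_cases h : 1 ≤ i ∧ i ≤ n - 1
  · have := entry_of_mem (path n t).2 1 ⟨i - 1, by omega⟩
    simp only [Nat.sub_add_cancel h.1] at this
    rw [this]
    simp only [path, Nat.sub_add_cancel h.1]
  · rw [entry_of_not_mem _ _ h]
    rcases Nat.eq_zero_or_pos i with rfl | h0
    · simp [gauss_zero_right]
    · obtain rfl : i = n := by omega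
      simp [gauss_self]

theorem eval_WX_path {n : ℕ} (hn : 2 ≤ n) (t : ℝ) (w : ℂ) : (WX n (path n t)).eval w =
    ∏ k ∈ Finset.range n, (w - Complex.exp (logRoot n k t)) := by
  have h1 : ∀ k ∈ Finset.range n, w - Complex.exp (logRoot n k t) =
      w + Complex.exp (((n : ℂ) - 1 - 2 * k) * pathParam n t) := by
    intro k _
    rw [logRoot, Complex.exp_add, Complex.exp_pi_mul_I]
    ring
  rw [Finset.prod_congr rfl h1, prod_add_exp_eq_sum_gauss, eval_WX_eq_sum hn]
  refine Finset.sum_congr rfl fun i hi => ?_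
  rw [entry_path (Nat.lt_succ_iff.1 (Finset.mem_range.1 hi))]

theorem WX_path {n : ℕ} (hn : 2 ≤ n) (t : ℝ) : WX n (path n t) =
    ∏ k ∈ Finset.range n, (Polynomial.X - Polynomial.C (Complex.exp (logRoot n k t))) := by
  refine Polynomial.funext fun w => ?_
  rw [eval_WX_path hn, Polynomial.eval_prod]
  simp

theorem pathParam_re (n : ℕ) (t : ℝ) : (pathParam n t).re = Real.log t := by
  simp [pathParam]

theorem pathParam_im (n : ℕ) (t : ℝ) : (pathParam n t).im = -(Real.pi * t / n) := by
  simp [pathParam]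

/-- For t < 1 the moduli t^{n-1-2k} are distinct. At t = 1, where q = e^{-πi/n}, a coincidence
forces k - k' to be a multiple of n. -/
theorem exp_logRoot_injOn {n : ℕ} (hn : 2 ≤ n) {t : ℝ} (ht : t ∈ Set.Ioc (0 : ℝ) 1) :
    Set.InjOn (fun k => Complex.exp (logRoot n k t)) (Finset.range n : Set ℕ) := by
  intro k hk k' hk' h
  have hk := Finset.mem_range.1 (Finset.mem_coe.1 hk)
  have hk' := Finset.mem_range.1 (Finset.mem_coe.1 hk')
  obtain ⟨m, hm⟩ := Complex.exp_eq_exp_iff_exists_int.1 h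
  have h1 : (2 * ((k' : ℝ) - k) : ℝ) * pathParam n t = (m * (2 * Real.pi) : ℝ) * Complex.I := by
    simp only [logRoot] at hm
    push_cast
    linear_combination hm
  have hre := congrArg Complex.re h1
  have him := congrArg Complex.im h1
  rw [Complex.re_ofReal_mul, pathParam_re, Complex.re_ofReal_mul] at hre
  rw [Complex.im_ofReal_mul, pathParam_im, Complex.im_ofReal_mul] at him
  simp only [Complex.I_re, Complex.I_im, mul_zero, mul_one] at hre him
  rcases mul_eq_zero.1 hre with h2 | h2
  · have : (k : ℝ) = k' := by linarith
    exact_mod_cast this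
  · have ht1 : t = 1 := by
      rcases ht.2.lt_or_eq with h3 | h3
      · exact absurd h2 (Real.log_neg ht.1 h3).ne
      · exact h3
    subst ht1
    have hn' : (n : ℝ) ≠ 0 := by exact_mod_cast (by omega : n ≠ 0)
    have hpi := Real.pi_ne_zero
    have h4 : (k : ℝ) - k' = n * m := by
      field_simp at him
      linear_combination him
    have h5 : (k : ℤ) - k' = n * m := by exact_mod_cast h4
    have h6 : m = 0 := by
      by_contra hm0
      have h7 : (n : ℤ) ≤ |(n : ℤ) * m| := by
        rw [abs_mul, Nat.abs_cast]
        exact le_mul_of_one_le_right (by positivity) (Int.one_le_abs hm0)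
      rw [← h5] at h7
      have h8 : |(k : ℤ) - k'| < n := by
        rw [abs_lt]; constructor <;> omega
      omega
    rw [h6] at h5
    omega

theorem separable_WX_path {n : ℕ} (hn : 2 ≤ n) {t : ℝ} (ht : t ∈ Set.Ioc (0 : ℝ) 1) :
    (WX n (path n t)).Separable := by
  rw [WX_path hn]
  exact Polynomial.separable_prod_X_sub_C_iff'.2 (exp_logRoot_injOn hn ht)

theorem continuousOn_pathParam (n : ℕ) : ContinuousOn (pathParam n) (Set.Ioc 0 1) := by
  unfold pathParam
  refine ContinuousOn.sub ?_ (by fun_prop)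
  exact Complex.continuous_ofReal.comp_continuousOn
    (Real.continuousOn_log.mono fun t ht => ht.1.ne')

theorem continuousOn_logRoot (n k : ℕ) : ContinuousOn (logRoot n k) (Set.Ioc 0 1) :=
  continuousOn_const.add (continuousOn_const.mul (continuousOn_pathParam n))

theorem continuousOn_path (n : ℕ) : ContinuousOn (path n) (Set.Ioc 0 1) := by
  refine continuousOn_const.prodMk (continuousOn_pi.2 fun j => ?_)
  refine ((continuousOn_const.mul (continuousOn_pathParam n)).cexp).mul ?_
  exact (continuous_gauss n _).comp_continuousOn
    (continuousOn_const.mul (continuousOn_pathParam n)).cexp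

theorem logRoot_one {n : ℕ} (hn : 2 ≤ n) (k : ℕ) :
    logRoot n k 1 = (2 * k + 1 : ℕ) * (Real.pi * Complex.I / n) := by
  have hnC : (n : ℂ) ≠ 0 := by exact_mod_cast (by omega : n ≠ 0)
  simp only [logRoot, pathParam, Real.log_one]
  push_cast
  field_simp
  ring

theorem exp_logRoot_one {n : ℕ} (hn : 2 ≤ n) (k : ℕ) :
    Complex.exp (logRoot n k 1) = Complex.exp (Real.pi * Complex.I / n) ^ (2 * k + 1) := by
  rw [logRoot_one hn, Complex.exp_nat_mul]

theorem exp_pi_div_pow {n : ℕ} (hn : 2 ≤ n) : Complex.exp (Real.pi * Complex.I / n) ^ n = -1 := by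
  have hnC : (n : ℂ) ≠ 0 := by exact_mod_cast (by omega : n ≠ 0)
  rw [← Complex.exp_nat_mul, mul_div_cancel₀ _ hnC, Complex.exp_pi_mul_I]

theorem exp_logRoot_one_pow {n : ℕ} (hn : 2 ≤ n) (k : ℕ) :
    Complex.exp (logRoot n k 1) ^ n = -1 := by
  rw [exp_logRoot_one hn, ← pow_mul, mul_comm (2 * k + 1), pow_mul, exp_pi_div_pow hn, pow_succ, pow_mul]
  simp

theorem norm_exp_logRoot_one {n : ℕ} (hn : 2 ≤ n) (k : ℕ) :
    ‖Complex.exp (logRoot n k 1)‖ = 1 := by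
  have := congrArg norm (exp_logRoot_one_pow hn k)
  rw [norm_pow, norm_neg, norm_one] at this
  exact (pow_eq_one_iff_of_nonneg (norm_nonneg _) (by omega)).1 this

/-- At t = 1 all n distinct roots satisfy κ^n = -1, so W - κ^n - 1, of degree below n, has n zeros.
-/
theorem path_one {n : ℕ} (hn : 2 ≤ n) : path n 1 = 0 := by
  let P : Polynomial ℂ := ∑ k : Fin (n - 1),
    Polynomial.C ((path n 1).2 k) * Polynomial.X ^ ((k : ℕ) + 1)
  have hP : P = 0 := by
    refine Polynomial.eq_zero_of_degree_lt_of_eval_index_eq_zero _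
      (exp_logRoot_injOn hn (t := 1) (by simp)) ?_ fun k hk => ?_
    · rw [Finset.card_range]
      refine (Polynomial.degree_sum_le _ _).trans_lt ?_
      refine (Finset.sup_lt_iff (WithBot.bot_lt_coe n)).2 fun k _ => ?_
      refine (Polynomial.degree_C_mul_X_pow_le _ _).trans_lt ?_
      exact WithBot.coe_lt_coe.2 (by omega : (k : ℕ) + 1 < n)
    · have h1 := eval_WX_path hn 1 (Complex.exp (logRoot n k 1))
      rw [Finset.prod_eq_zero hk (sub_self _), eval_WX, exp_logRoot_one_pow hn] at h1
      simp only [P, Polynomial.eval_finsetSum, Polynomial.eval_mul, Polynomial.eval_C,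
        Polynomial.eval_pow, Polynomial.eval_X]
      linear_combination h1
  have h2 : (path n 1).2 = 0 := by
    funext j
    have := congrArg (fun p => p.coeff ((j : ℕ) + 1)) hP
    simp only [P, Polynomial.finsetSum_coeff, Polynomial.coeff_C_mul, Polynomial.coeff_X_pow,
      Polynomial.coeff_zero] at this
    rw [Finset.sum_eq_single j] at this
    · simpa using this
    · intro k _ hk
      rw [if_neg, mul_zero]
      intro h
      exact hk (Fin.ext (by omega))
    · simp
  exact Prod.ext rfl h2

theorem norm_exp_mul_pathParam (n : ℕ) {t : ℝ} (ht : 0 < t) (c : ℝ) :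
    ‖Complex.exp ((c : ℂ) * pathParam n t)‖ = t ^ c := by
  rw [Complex.norm_exp, Complex.re_ofReal_mul, pathParam_re, Real.rpow_def_of_pos ht, mul_comm]

theorem tendsto_exp_two_mul_pathParam (n : ℕ) :
    Tendsto (fun t => Complex.exp (2 * pathParam n t)) (𝓝[>] 0) (𝓝 0) := by
  rw [tendsto_zero_iff_norm_tendsto_zero]
  have h1 : Tendsto (fun t : ℝ => t ^ 2) (𝓝[>] 0) (𝓝 0) := by
    have : Continuous fun t : ℝ => t ^ 2 := by fun_prop
    simpa using (this.tendsto 0).mono_left nhdsWithin_le_nhds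
  refine h1.congr' ?_
  filter_upwards [self_mem_nhdsWithin] with t ht
  have := norm_exp_mul_pathParam n (Set.mem_Ioi.1 ht) 2
  push_cast at this
  rw [this, Real.rpow_two]

theorem tendsto_gauss_path {n i : ℕ} (hi : i ≤ n) :
    Tendsto (fun t => gauss (Complex.exp (2 * pathParam n t)) n i) (𝓝[>] 0) (𝓝 1) := by
  have := (continuous_gauss n i).tendsto 0
  rw [gauss_at_zero hi] at this
  exact this.comp (tendsto_exp_two_mul_pathParam n)

/-- The exponents i(i - n) of q in the coefficients have second difference 2, whence the common
factor q². -/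
theorem toY_path {n : ℕ} (t : ℝ) (k : Fin (n - 1)) :
    (toY n (path n t)).2 k = Complex.exp (2 * pathParam n t) *
      (gauss (Complex.exp (2 * pathParam n t)) n k *
        (gauss (Complex.exp (2 * pathParam n t)) n (k + 1) ^ 2)⁻¹ *
          gauss (Complex.exp (2 * pathParam n t)) n (k + 2)) := by
  simp only [toY]
  rw [← entry_of_mem (path n t).2 1 k, entry_path (by omega), entry_path (by omega),
    entry_path (by omega)]
  have h : Complex.exp (2 * pathParam n t) =
      Complex.exp (((k : ℕ) : ℂ) * (((k : ℕ) : ℂ) - n) * pathParam n t) *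
      (Complex.exp ((((k : ℕ) + 1 : ℕ) : ℂ) * ((((k : ℕ) + 1 : ℕ) : ℂ) - n) *
        pathParam n t) ^ 2)⁻¹ *
      Complex.exp ((((k : ℕ) + 2 : ℕ) : ℂ) * ((((k : ℕ) + 2 : ℕ) : ℂ) - n) * pathParam n t) := by
    rw [← Complex.exp_nat_mul, ← Complex.exp_neg, ← Complex.exp_add, ← Complex.exp_add]
    congr 1
    push_cast
    ring
  set G := gauss (Complex.exp (2 * pathParam n t)) n
  rw [h, mul_pow, mul_inv]
  ring

theorem tendsto_toY_path_aux {n : ℕ} (k : Fin (n - 1)) :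
    Tendsto (fun t => gauss (Complex.exp (2 * pathParam n t)) n k *
        (gauss (Complex.exp (2 * pathParam n t)) n (k + 1) ^ 2)⁻¹ *
          gauss (Complex.exp (2 * pathParam n t)) n (k + 2)) (𝓝[>] 0) (𝓝 1) := by
  have := ((tendsto_gauss_path (n := n) (i := k) (by omega)).mul
    (((tendsto_gauss_path (n := n) (i := k + 1) (by omega)).pow 2).inv₀ (by simp))).mul
    (tendsto_gauss_path (n := n) (i := k + 2) (by omega))
  simpa using this

theorem tendsto_toY_path (n : ℕ) : Tendsto (fun t => toY n (path n t)) (𝓝[>] 0) (𝓝 0) := by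
  refine (tendsto_const_nhds : Tendsto (fun _ => (0 : ℂ)) _ _).prodMk_nhds
    (tendsto_pi_nhds.2 fun k => ?_)
  have := (tendsto_exp_two_mul_pathParam n).mul (tendsto_toY_path_aux k)
  rw [zero_mul] at this
  exact this.congr fun t => (toY_path t k).symm

theorem eventually_toY_path_mem (n : ℕ) {δ : ℝ} (hδ : 0 < δ) : ∀ᶠ t in 𝓝[>] (0 : ℝ), ∀ k,
    (toY n (path n t)).2 k ∈ Complex.slitPlane ∧ |((toY n (path n t)).2 k).arg| < δ := by
  refine eventually_all.2 fun k => ?_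
  have h1 : Tendsto (fun t : ℝ => Complex.exp ((-(Real.pi * t / n) * 2 : ℝ) * Complex.I))
      (𝓝[>] 0) (𝓝 1) := by
    have : Continuous fun t : ℝ => Complex.exp ((-(Real.pi * t / n) * 2 : ℝ) * Complex.I) := by
      fun_prop
    simpa using (this.tendsto 0).mono_left nhdsWithin_le_nhds
  have h2 := h1.mul (tendsto_toY_path_aux k)
  rw [one_mul] at h2
  have h3 : ∀ᶠ z in 𝓝 (1 : ℂ), z ∈ Complex.slitPlane ∧ |z.arg| < δ := by
    refine Filter.Eventually.and (Complex.isOpen_slitPlane.mem_nhds Complex.one_mem_slitPlane) ?_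
    have := (Complex.continuousAt_arg Complex.one_mem_slitPlane).abs
    have h4 : Tendsto (fun z : ℂ => |z.arg|) (𝓝 1) (𝓝 0) := by
      simpa [ContinuousAt] using this
    exact h4.eventually_lt_const hδ
  filter_upwards [h2.eventually h3, self_mem_nhdsWithin] with t ht ht0
  have ht0 : 0 < t := ht0
  -- Splitting off the positive factor t² from q² changes neither the argument nor membership in the
  -- slit plane; what is left tends to 1.
  have h5 : Complex.exp (2 * pathParam n t) = ((t ^ 2 : ℝ) : ℂ) *
      Complex.exp ((-(Real.pi * t / n) * 2 : ℝ) * Complex.I) := by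
    have h6 : ((t ^ 2 : ℝ) : ℂ) = Complex.exp (2 * (Real.log t : ℂ)) := by
      rw [← Real.exp_log ht0]
      push_cast
      rw [← Complex.exp_nat_mul, Real.log_exp]
      push_cast
      rfl
    rw [h6, ← Complex.exp_add, pathParam]
    congr 1
    push_cast
    ring
  rw [toY_path, h5, mul_assoc]
  have hpos : (0 : ℝ) < t ^ 2 := by positivity
  refine ⟨?_, ?_⟩
  · rcases ht.1 with h | h
    · exact Or.inl (by rw [Complex.re_ofReal_mul, ← h5]; exact mul_pos hpos h)
    · exact Or.inr (by rw [Complex.im_ofReal_mul, ← h5]; exact mul_ne_zero hpos.ne' h)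
  · rw [← h5, Complex.arg_real_mul _ hpos]
    exact ht.2

/-! ### Degrees of the toric divisors -/

/-- Summation by parts, as D is the second difference of d and d vanishes at both ends. Constant f
gives ∑ D_i = 0. Later, linear f gives the vanishing first moment, quadratic f the total degree, and
f = log x_i the monomial in y. -/
theorem sum_degD_smul {n : ℕ} (hn : 2 ≤ n) (d : Fin (n - 1) → ℕ) {M : Type*} [AddCommGroup M]
    (f : ℕ → M) : ∑ i ∈ Finset.range (n + 1), degD n d i • f i =
      ∑ k : Fin (n - 1), (d k : ℤ) • (f k - 2 • f (k + 1) + f (k + 2)) := by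
  obtain ⟨m, rfl⟩ : ∃ m, n = m + 1 := ⟨n - 1, by omega⟩
  set δ : ℕ → ℤ := fun i => entry (fun i => (d i : ℤ)) 0 i with hδ
  have h0 : δ 0 = 0 := entry_of_not_mem _ _ (by omega)
  have h1 : δ (m + 1) = 0 := entry_of_not_mem _ _ (by omega)
  have h2 : δ (m + 1 + 1) = 0 := entry_of_not_mem _ _ (by omega)
  have hd : ∀ i, degD (m + 1) d i = δ (i - 1) - 2 * δ i + δ (i + 1) := fun i => rfl
  have hk : ∀ k : Fin (m + 1 - 1), (d k : ℤ) = δ ((k : ℕ) + 1) :=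
    fun k => (entry_of_mem (fun i => (d i : ℤ)) 0 k).symm
  simp only [hd, hk]
  have hF := Fin.sum_univ_eq_sum_range
    (fun k => δ (k + 1) • (f k - 2 • f (k + 1) + f (k + 2))) m
  refine Eq.trans ?_ hF.symm
  simp only [add_smul, sub_smul, smul_add, smul_sub, Finset.sum_add_distrib,
    Finset.sum_sub_distrib, mul_smul]
  have A : ∑ i ∈ Finset.range (m + 1 + 1), δ (i - 1) • f i =
      ∑ i ∈ Finset.range m, δ (i + 1) • f (i + 2) := by
    rw [Finset.sum_range_succ', Finset.sum_range_succ']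
    simp [h0]
  have B : ∑ i ∈ Finset.range (m + 1 + 1), (2 : ℤ) • δ i • f i =
      ∑ i ∈ Finset.range m, δ (i + 1) • 2 • f (i + 1) := by
    rw [Finset.sum_range_succ', Finset.sum_range_succ, h0, h1]
    simp only [zero_smul, smul_zero, add_zero]
    exact Finset.sum_congr rfl fun i _ => by rw [smul_comm, two_smul, two_smul]
  have C : ∑ i ∈ Finset.range (m + 1 + 1), δ (i + 1) • f i =
      ∑ i ∈ Finset.range m, δ (i + 1) • f i := by
    rw [Finset.sum_range_succ, Finset.sum_range_succ, h1, h2]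
    simp
  rw [A, B, C]
  abel

theorem sum_degD {n : ℕ} (hn : 2 ≤ n) (d : Fin (n - 1) → ℕ) :
    ∑ i ∈ Finset.range (n + 1), degD n d i = 0 := by
  have := sum_degD_smul hn d (fun _ => (1 : ℤ))
  simpa using this

/-- D_i determines d_{i+1} from d_{i-1} and d_i, starting from d_0 = 0. -/
theorem degD_injective {n : ℕ} {d d' : Fin (n - 1) → ℕ}
    (h : ∀ i ≤ n, degD n d i = degD n d' i) : d = d' := by
  have key : ∀ i, i ≤ n → entry (fun i => (d i : ℤ)) 0 i = entry (fun i => (d' i : ℤ)) 0 i := by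
    intro i
    induction i using Nat.strong_induction_on with
    | _ i ih =>
      intro hi
      rcases i with _ | i
      · rw [entry_of_not_mem _ _ (by omega), entry_of_not_mem _ _ (by omega)]
      · have h1 := h i (by omega)
        unfold degD at h1
        have h2 := ih (i - 1) (by omega) (by omega)
        have h3 := ih i (by omega) (by omega)
        omega
  funext k
  have := key (k + 1) (by omega)
  rw [entry_of_mem, entry_of_mem] at this
  exact_mod_cast this

theorem degD_zero (n j : ℕ) : degD n 0 j = 0 := by
  have : ∀ i, entry (fun i : Fin (n - 1) => (((0 : Fin (n - 1) → ℕ) i : ℕ) : ℤ)) 0 i = 0 := by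
    intro i
    unfold entry
    split_ifs <;> simp
  unfold degD
  rw [this, this, this]
  rfl

theorem eq_zero_of_degD_nonneg {n : ℕ} (hn : 2 ≤ n) {d : Fin (n - 1) → ℕ}
    (h : ∀ i ≤ n, 0 ≤ degD n d i) : d = 0 := by
  refine degD_injective fun i hi => ?_
  rw [degD_zero]
  have h1 : ∀ j ∈ Finset.range (n + 1), 0 ≤ degD n d j := fun j hj =>
    h j (Nat.lt_succ_iff.1 (Finset.mem_range.1 hj))
  exact (Finset.sum_eq_zero_iff_of_nonneg h1).1 (sum_degD hn d) i
    (Finset.mem_range.2 (Nat.lt_succ_iff.2 hi))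

theorem degD_left_nonneg (n : ℕ) (d : Fin (n - 1) → ℕ) : 0 ≤ degD n d 0 := by
  unfold degD
  rw [entry_of_not_mem _ _ (by omega)]
  unfold entry
  split_ifs <;> simp

theorem degD_right_nonneg {n : ℕ} (d : Fin (n - 1) → ℕ) {j : ℕ} (hj : n ≤ j) :
    0 ≤ degD n d j := by
  unfold degD
  rw [entry_of_not_mem (j := j + 1) _ _ (by omega), entry_of_not_mem (j := j) _ _ (by omega)]
  unfold entry
  split_ifs <;> simp

/-! ### The coefficient of `z⁰` in the `I`-function -/

section Laurent

variable {R : Type*} [CommRing R]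

theorem prod_C_add_intCast_mul_zVar (w : R) (f : ℕ → ℤ) (N : ℕ) :
    ∏ i ∈ Finset.range N, (HahnSeries.C w + (f i : LaurentSeries R) * zVar R) =
      HahnSeries.single (-(N : ℤ)) 1 * HahnSeries.ofPowerSeries ℤ R
        (∏ i ∈ Finset.range N, (PowerSeries.C (f i : R) + PowerSeries.C w * PowerSeries.X)) := by
  induction N with
  | zero => simp
  | succ N ih =>
    rw [Finset.prod_range_succ, ih, Finset.prod_range_succ, map_mul, map_add, map_mul,
      HahnSeries.ofPowerSeries_C, HahnSeries.ofPowerSeries_C, HahnSeries.ofPowerSeries_X]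
    have h1 : (HahnSeries.single (-((N + 1 : ℕ) : ℤ)) (1 : R) : LaurentSeries R) =
        HahnSeries.single (-(N : ℤ)) 1 * zVar R := by
      rw [zVar, HahnSeries.single_mul_single, mul_one,
        show -((N + 1 : ℕ) : ℤ) = -(N : ℤ) + -1 by push_cast; ring]
    have h2 : zVar R * HahnSeries.single (1 : ℤ) (1 : R) = 1 := by
      rw [zVar, HahnSeries.single_mul_single]
      simp
    have h3 : (HahnSeries.C ((f N : ℤ) : R) : LaurentSeries R) = (f N : LaurentSeries R) :=
      map_intCast _ _
    rw [h1, h3]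
    linear_combination -(HahnSeries.single (-(N : ℤ)) 1 * (HahnSeries.ofPowerSeries ℤ R)
      (∏ i ∈ Finset.range N, (PowerSeries.C (f i : R) + PowerSeries.C w * PowerSeries.X)) *
      HahnSeries.C w) * h2

theorem constantCoeff_prod_C_add (w : R) (f : ℕ → ℤ) (N : ℕ) :
    PowerSeries.constantCoeff
      (∏ i ∈ Finset.range N, (PowerSeries.C (f i : R) + PowerSeries.C w * PowerSeries.X)) =
      ((∏ i ∈ Finset.range N, f i : ℤ) : R) := by
  rw [map_prod, Int.cast_prod]
  refine Finset.prod_congr rfl fun i _ => ?_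
  simp

theorem prod_Ioc_zero_natCast {M : Type*} [CommMonoid M] (f : ℤ → M) (N : ℕ) :
    ∏ m ∈ Finset.Ioc (0 : ℤ) N, f m = ∏ i ∈ Finset.range N, f ((i : ℤ) + 1) := by
  refine Finset.prod_nbij' (fun m => (m - 1).toNat) (fun i => (i : ℤ) + 1) ?_ ?_ ?_ ?_ ?_
  · intro m hm; rw [Finset.mem_Ioc] at hm; rw [Finset.mem_range]; omega
  · intro i hi; rw [Finset.mem_range] at hi; rw [Finset.mem_Ioc]; omega
  · intro m hm; rw [Finset.mem_Ioc] at hm; omega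
  · intro i hi; omega
  · intro m hm; rw [Finset.mem_Ioc] at hm; congr 1; omega

theorem prod_Ioc_neg_natCast {M : Type*} [CommMonoid M] (f : ℤ → M) (N : ℕ) :
    ∏ m ∈ Finset.Ioc (-(N : ℤ)) 0, f m = ∏ i ∈ Finset.range N, f (-(i : ℤ)) := by
  refine Finset.prod_nbij' (fun m => (-m).toNat) (fun i => -(i : ℤ)) ?_ ?_ ?_ ?_ ?_
  · intro m hm; rw [Finset.mem_Ioc] at hm; rw [Finset.mem_range]; omega
  · intro i hi; rw [Finset.mem_range] at hi; rw [Finset.mem_Ioc]; omega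
  · intro m hm; rw [Finset.mem_Ioc] at hm; omega
  · intro i hi; omega
  · intro m hm; rw [Finset.mem_Ioc] at hm; congr 1; omega

theorem prod_single_one {ι : Type*} (s : Finset ι) (e : ι → ℤ) :
    ∏ i ∈ s, (HahnSeries.single (e i) (1 : R) : LaurentSeries R) =
      HahnSeries.single (∑ i ∈ s, e i) 1 := by
  classical
  induction s using Finset.induction_on with
  | empty => simp
  | insert a s ha ih =>
    rw [Finset.prod_insert ha, ih, Finset.sum_insert ha, HahnSeries.single_mul_single, mul_one]

theorem coeff_single_mul_ofPowerSeries (e : ℕ) (k : ℤ) (P : PowerSeries R) (h : k = -(e : ℤ)) :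
    (HahnSeries.single k (1 : R) * HahnSeries.ofPowerSeries ℤ R P).coeff 0 =
      PowerSeries.coeff e P := by
  subst h
  have := HahnSeries.coeff_single_mul_add (r := (1 : R)) (x := HahnSeries.ofPowerSeries ℤ R P)
    (a := (e : ℤ)) (b := -(e : ℤ))
  rw [add_neg_cancel, one_mul] at this
  rw [this]
  exact HahnSeries.ofPowerSeries_apply_coeff P e

theorem coeff_single_mul_ofPowerSeries_of_pos {k : ℤ} (h : 0 < k) (P : PowerSeries R) :
    (HahnSeries.single k (1 : R) * HahnSeries.ofPowerSeries ℤ R P).coeff 0 = 0 := by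
  have := HahnSeries.coeff_single_mul_add (r := (1 : R)) (x := HahnSeries.ofPowerSeries ℤ R P)
    (a := -k) (b := k)
  rw [neg_add_cancel, one_mul] at this
  rw [this]
  have := PowerSeries.coeff_coe P (-k)
  rw [if_pos (by omega)] at this
  exact this

variable [Algebra ℂ R]

/-- The leading coefficient, in `z⁻¹`, of a modification factor of degree `D`. -/
def leadingValue (w : R) (D : ℤ) : R :=
  if D < 0 then ((-1) ^ ((-D).toNat - 1) * (((-D).toNat - 1).factorial : ℂ)) • w
  else ((D.toNat.factorial : ℂ)⁻¹) • (1 : R)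

/-- For D < 0 the factor with m = 0 is w alone and the other -D - 1 factors grow like z; for D ≥ 0
there are D factors growing like z, all in the denominator. So the order in z⁻¹ is D, raised by 1
when D < 0. -/
theorem modification_factor (w : R) (D : ℤ) : ∃ P : PowerSeries R,
    (∏ m ∈ Finset.Ioc D 0, (HahnSeries.C w + (m : LaurentSeries R) * zVar R)) *
      Ring.inverse (∏ m ∈ Finset.Ioc 0 D, (HahnSeries.C w + (m : LaurentSeries R) * zVar R)) =
      HahnSeries.single (D + if D < 0 then 1 else 0) 1 * HahnSeries.ofPowerSeries ℤ R P ∧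
    PowerSeries.constantCoeff P = leadingValue w D := by
  unfold leadingValue
  rcases lt_or_ge D 0 with hD | hD
  · obtain ⟨N, rfl⟩ : ∃ N : ℕ, D = -((N + 1 : ℕ) : ℤ) := ⟨(-D - 1).toNat, by omega⟩
    have hpos : Finset.Ioc (0 : ℤ) (-((N + 1 : ℕ) : ℤ)) = ∅ := Finset.Ioc_eq_empty_of_le (by omega)
    rw [prod_Ioc_neg_natCast, hpos, Finset.prod_empty, Ring.inverse_one, mul_one,
      Finset.prod_range_succ', if_pos hD, if_pos hD]
    refine ⟨PowerSeries.C w * ∏ i ∈ Finset.range N,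
      (PowerSeries.C ((-((i + 1 : ℕ) : ℤ) : ℤ) : R) + PowerSeries.C w * PowerSeries.X), ?_, ?_⟩
    · rw [prod_C_add_intCast_mul_zVar w (fun i => -((i + 1 : ℕ) : ℤ)), map_mul,
        HahnSeries.ofPowerSeries_C, show -((N + 1 : ℕ) : ℤ) + 1 = -(N : ℤ) by push_cast; ring]
      simp only [Nat.cast_zero, neg_zero, Int.cast_zero, zero_mul, add_zero]
      ring
    · rw [map_mul, constantCoeff_prod_C_add, PowerSeries.constantCoeff_C]
      have h1 : ∏ i ∈ Finset.range N, (-((i + 1 : ℕ) : ℤ)) = (-1) ^ N * (N.factorial : ℤ) := by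
        rw [Finset.prod_neg, Finset.card_range, ← Finset.prod_range_add_one_eq_factorial]
        push_cast
        rfl
      have h2 : (-(-((N + 1 : ℕ) : ℤ))).toNat - 1 = N := by omega
      rw [h1, h2, Algebra.smul_def, mul_comm]
      simp
  · obtain ⟨N, rfl⟩ : ∃ N : ℕ, D = N := ⟨D.toNat, by omega⟩
    have hneg : Finset.Ioc (N : ℤ) 0 = ∅ := Finset.Ioc_eq_empty_of_le (by omega)
    rw [hneg, Finset.prod_empty, one_mul, prod_Ioc_zero_natCast, if_neg (by omega),
      if_neg (by omega), add_zero, Int.toNat_natCast]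
    have h0 := prod_C_add_intCast_mul_zVar w (fun i => (i : ℤ) + 1) N
    have h1 := constantCoeff_prod_C_add w (fun i => (i : ℤ) + 1) N
    set Q := ∏ i ∈ Finset.range N,
      (PowerSeries.C (((i : ℤ) + 1 : ℤ) : R) + PowerSeries.C w * PowerSeries.X)
    have h2 : ((∏ i ∈ Finset.range N, ((i : ℤ) + 1) : ℤ) : R) =
        algebraMap ℂ R (N.factorial : ℂ) := by
      rw [← Finset.prod_range_add_one_eq_factorial]
      push_cast
      simp
    have hf : (N.factorial : ℂ) ≠ 0 := by exact_mod_cast N.factorial_ne_zero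
    have h3 : algebraMap ℂ R (N.factorial : ℂ) * algebraMap ℂ R ((N.factorial : ℂ)⁻¹) = 1 := by
      rw [← map_mul, mul_inv_cancel₀ hf, map_one]
    have hu : IsUnit Q := by
      rw [PowerSeries.isUnit_iff_constantCoeff, h1, h2]
      exact IsUnit.of_mul_eq_one _ h3
    obtain ⟨P, hP⟩ := hu.exists_right_inv
    refine ⟨P, ?_, ?_⟩
    · have h4 : HahnSeries.single (-(N : ℤ)) (1 : R) * HahnSeries.ofPowerSeries ℤ R Q *
          (HahnSeries.single (N : ℤ) (1 : R) * HahnSeries.ofPowerSeries ℤ R P) = 1 := by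
        have h5 : HahnSeries.single (-(N : ℤ)) (1 : R) * HahnSeries.single (N : ℤ) (1 : R) = 1 := by
          rw [HahnSeries.single_mul_single]; simp
        rw [mul_mul_mul_comm, h5, one_mul, ← map_mul, hP, map_one]
      rw [h0]
      exact Ring.inverse_unit (Units.mk _ _ h4 (by rw [mul_comm]; exact h4))
    · have h5 := congrArg PowerSeries.constantCoeff hP
      rw [map_mul, h1, h2, map_one] at h5
      rw [Algebra.smul_def, mul_one]
      calc PowerSeries.constantCoeff P = (algebraMap ℂ R (N.factorial : ℂ) *
            algebraMap ℂ R ((N.factorial : ℂ)⁻¹)) * PowerSeries.constantCoeff P := by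
              rw [h3, one_mul]
        _ = (algebraMap ℂ R (N.factorial : ℂ) * PowerSeries.constantCoeff P) *
            algebraMap ℂ R ((N.factorial : ℂ)⁻¹) := by ring
        _ = _ := by rw [h5, one_mul]

end Laurent

open Classical in
/-- The contribution of `d` to the correction `S_j`: the flat co-ordinates for `Y` are
`g_i = log y_i + S_{i-1} - 2 S_i + S_{i+1}`. -/
def toricTerm (n j : ℕ) (y : Chart n) (d : Fin (n - 1) → ℕ) : ℂ :=
  if degD n d j < 0 ∧ ∀ i ≤ n, i ≠ j → 0 ≤ degD n d i then
    (logCoeff (fun i : Fin (n + 1) => (degD n d i).toNat) : ℂ) * ∏ k, y.2 k ^ d k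
  else 0

theorem toricTerm_eq_zero {n j : ℕ} (hj : j = 0 ∨ n ≤ j) (y : Chart n) (d : Fin (n - 1) → ℕ) :
    toricTerm n j y d = 0 := by
  refine if_neg fun h => ?_
  rcases hj with rfl | hj
  · exact absurd (degD_left_nonneg n d) (not_le.2 h.1)
  · exact absurd (degD_right_nonneg d hj) (not_le.2 h.1)

theorem sum_toNat_degD {n j : ℕ} (hn : 2 ≤ n) (hj : j ≤ n) {d : Fin (n - 1) → ℕ}
    (h : degD n d j < 0 ∧ ∀ i ≤ n, i ≠ j → 0 ≤ degD n d i) :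
    ∑ i ∈ Finset.range (n + 1), (degD n d i).toNat = (-degD n d j).toNat := by
  have hmem : j ∈ Finset.range (n + 1) := Finset.mem_range.2 (by omega)
  have h1 := sum_degD hn d
  rw [← Finset.add_sum_erase _ _ hmem] at h1 ⊢
  have h2 : ((∑ i ∈ (Finset.range (n + 1)).erase j, (degD n d i).toNat : ℕ) : ℤ) =
      ∑ i ∈ (Finset.range (n + 1)).erase j, degD n d i := by
    push_cast
    refine Finset.sum_congr rfl fun i hi => ?_
    rw [Finset.mem_erase, Finset.mem_range] at hi
    exact Int.toNat_of_nonneg (h.2 i (by omega) hi.1)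
  omega

/-- The degrees sum to 0, so -D_j is the sum of the others. The sign and the factorial (-D_j - 1)!
from the negative degree are therefore those of `logCoeff`. -/
theorem prod_leadingValue {R : Type*} [CommRing R] [Algebra ℂ R] {n j : ℕ} (hn : 2 ≤ n)
    (hj : j ≤ n) {d : Fin (n - 1) → ℕ} (w : ℕ → R)
    (h : degD n d j < 0 ∧ ∀ i ≤ n, i ≠ j → 0 ≤ degD n d i) :
    ∏ i ∈ Finset.range (n + 1), leadingValue (w i) (degD n d i) =
      (logCoeff (fun i : Fin (n + 1) => (degD n d i).toNat) : ℂ) • w j := by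
  have hmem : j ∈ Finset.range (n + 1) := Finset.mem_range.2 (by omega)
  have hs := sum_toNat_degD hn hj h
  have hsF := Fin.sum_univ_eq_sum_range (fun i => (degD n d i).toNat) (n + 1)
  have hpF := Fin.prod_univ_eq_prod_range (fun i => ((degD n d i).toNat.factorial : ℝ)) (n + 1)
  rw [logCoeff, hsF, hs, hpF, if_neg (by omega), ← Finset.mul_prod_erase _ _ hmem,
    ← Finset.mul_prod_erase (Finset.range (n + 1))
      (fun i => ((degD n d i).toNat.factorial : ℝ)) hmem]
  have h1 : ∏ i ∈ (Finset.range (n + 1)).erase j, leadingValue (w i) (degD n d i) =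
      algebraMap ℂ R (∏ i ∈ (Finset.range (n + 1)).erase j,
        ((degD n d i).toNat.factorial : ℂ))⁻¹ := by
    rw [← Finset.prod_inv_distrib, map_prod]
    refine Finset.prod_congr rfl fun i hi => ?_
    rw [Finset.mem_erase, Finset.mem_range] at hi
    rw [leadingValue, if_neg (not_lt.2 (h.2 i (by omega) hi.1)), Algebra.smul_def, mul_one]
  have h2 : (degD n d j).toNat = 0 := by omega
  rw [h1, leadingValue, if_pos h.1, h2, Algebra.smul_def, Algebra.smul_def, mul_right_comm,
    ← map_mul]
  congr 2
  push_cast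
  rw [Nat.factorial_zero]
  simp [div_eq_mul_inv]

theorem coeff_one_prod {R ι : Type*} [CommRing R] (s : Finset ι) (P : ι → PowerSeries R)
    (h : ∀ i ∈ s, PowerSeries.constantCoeff (P i) = 1) :
    PowerSeries.constantCoeff (∏ i ∈ s, P i) = 1 ∧
      PowerSeries.coeff 1 (∏ i ∈ s, P i) = ∑ i ∈ s, PowerSeries.coeff 1 (P i) := by
  classical
  induction s using Finset.induction_on with
  | empty => simp
  | insert a s ha ih =>
    have ih := ih fun i hi => h i (Finset.mem_insert_of_mem hi)
    have h1 := h a (Finset.mem_insert_self a s)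
    rw [Finset.prod_insert ha, Finset.sum_insert ha, map_mul, PowerSeries.coeff_one_mul, ih.1, ih.2,
      h1]
    simp

/-- The power series in `z⁻¹` of `exp (a / z)`. -/
def expSeries {R : Type*} [CommRing R] [Algebra ℂ R] (a : R) : PowerSeries R :=
  PowerSeries.mk fun m => ((m.factorial : ℂ)⁻¹) • a ^ m

theorem constantCoeff_expSeries {R : Type*} [CommRing R] [Algebra ℂ R] (a : R) :
    PowerSeries.constantCoeff (expSeries a) = 1 := by
  rw [← PowerSeries.coeff_zero_eq_constantCoeff_apply, expSeries, PowerSeries.coeff_mk]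
  simp

theorem coeff_one_expSeries {R : Type*} [CommRing R] [Algebra ℂ R] (a : R) :
    PowerSeries.coeff 1 (expSeries a) = a := by
  rw [expSeries, PowerSeries.coeff_mk]
  simp

/-- As ∑ D_j = 0, the summand of d has order at least -1 + #{j : D_j < 0} in z⁻¹. For d = 0 the
linear terms of the exponentials survive; one negative degree leaves the leading coefficient; two or
more leave nothing. If d ≠ 0, some degree is negative. -/
theorem coeff_zero_IYterm {n : ℕ} (hn : 2 ≤ n) (y : Chart n) (d : Fin (n - 1) → ℕ) :
    (IYterm n y d).coeff 0 = (if d = 0 then algebraMap ℂ (HTY n) y.1 +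
      ∑ k : Fin (n - 1), Complex.log (y.2 k) • gam n ((k : ℕ) + 1) else 0) +
      ∑ j ∈ Finset.range (n + 1), toricTerm n j y d • om n j := by
  set E : PowerSeries (HTY n) := expSeries (algebraMap ℂ (HTY n) y.1) *
    ∏ k : Fin (n - 1), expSeries (Complex.log (y.2 k) • gam n ((k : ℕ) + 1)) with hE
  have hE0 : PowerSeries.constantCoeff E = 1 := by
    rw [hE, map_mul, constantCoeff_expSeries, one_mul]
    exact (coeff_one_prod _ _ fun i _ => constantCoeff_expSeries _).1
  have hexp : expOverZ (algebraMap ℂ (HTY n) y.1) *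
      ∏ k : Fin (n - 1), expOverZ (Complex.log (y.2 k) • gam n ((k : ℕ) + 1)) =
      HahnSeries.ofPowerSeries ℤ (HTY n) E := by
    rw [hE, map_mul, map_prod]
    rfl
  clear_value E
  by_cases hd : d = 0
  · subst hd
    have h0 : ∑ j ∈ Finset.range (n + 1), toricTerm n j y 0 • om n j = 0 := by
      refine Finset.sum_eq_zero fun j _ => ?_
      rw [toricTerm, if_neg (fun h => ?_), zero_smul]
      rw [degD_zero] at h
      exact lt_irrefl _ h.1
    rw [if_pos rfl, h0, add_zero]
    · have h1 : IYterm n y 0 = HahnSeries.single (-1) 1 * HahnSeries.ofPowerSeries ℤ (HTY n) E := by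
        rw [IYterm, mul_assoc (zVar (HTY n)), hexp, zVar, Finset.prod_eq_one fun j _ => ?_]
        · simp
        · rw [degD_zero]
          simp
      rw [h1, coeff_single_mul_ofPowerSeries 1 _ _ (by norm_num), hE, PowerSeries.coeff_one_mul,
        constantCoeff_expSeries, coeff_one_expSeries,
        (coeff_one_prod _ _ fun i _ => constantCoeff_expSeries _).1,
        (coeff_one_prod _ _ fun i _ => constantCoeff_expSeries _).2]
      simp only [coeff_one_expSeries]
      ring
  · rw [if_neg hd, zero_add]
    choose P hP hP0 using fun j => modification_factor (om n j) (degD n d j)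
    set e : ℤ := -1 + ∑ j ∈ Finset.range (n + 1), (degD n d j + if degD n d j < 0 then 1 else 0)
      with he
    set Q : PowerSeries (HTY n) := E * (∏ j ∈ Finset.range (n + 1), P j) *
      PowerSeries.C (algebraMap ℂ (HTY n) (∏ k, y.2 k ^ d k)) with hQ
    have h1 : IYterm n y d = HahnSeries.single e 1 * HahnSeries.ofPowerSeries ℤ (HTY n) Q := by
      rw [IYterm, mul_assoc (zVar (HTY n)), hexp, Finset.prod_congr rfl fun j _ => hP j,
        Finset.prod_mul_distrib, prod_single_one, ← map_prod, hQ, map_mul, map_mul,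
        HahnSeries.ofPowerSeries_C, he]
      have : (HahnSeries.single e (1 : HTY n) : LaurentSeries (HTY n)) =
          zVar (HTY n) * HahnSeries.single (∑ j ∈ Finset.range (n + 1),
            (degD n d j + if degD n d j < 0 then 1 else 0)) 1 := by
        rw [zVar, HahnSeries.single_mul_single, mul_one]
      rw [← he, this]
      ring
    have he' : e = -1 + ((Finset.range (n + 1)).filter fun j => degD n d j < 0).card := by
      rw [he, Finset.sum_add_distrib, sum_degD hn, zero_add, Finset.sum_boole]
    have hex : ∃ j ≤ n, degD n d j < 0 := by
      by_contra! h
      exact hd (eq_zero_of_degD_nonneg hn h)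
    obtain ⟨j, hj, hjneg⟩ := hex
    have hjmem : j ∈ Finset.range (n + 1) := Finset.mem_range.2 (by omega)
    by_cases hone : ∀ i ≤ n, i ≠ j → 0 ≤ degD n d i
    · have hcard : (Finset.range (n + 1)).filter (fun j => degD n d j < 0) = {j} := by
        ext i
        rw [Finset.mem_filter, Finset.mem_range, Finset.mem_singleton]
        refine ⟨fun h => ?_, ?_⟩
        · by_contra hij
          exact absurd (hone i (by omega) hij) (not_le.2 h.2)
        · rintro rfl
          exact ⟨by omega, hjneg⟩
      rw [hcard, Finset.card_singleton] at he'
      rw [h1, coeff_single_mul_ofPowerSeries 0 _ _ (by rw [he']; norm_num),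
        PowerSeries.coeff_zero_eq_constantCoeff_apply, hQ, map_mul, map_mul, hE0, one_mul,
        map_prod, Finset.prod_congr rfl fun j _ => hP0 j,
        prod_leadingValue hn hj _ ⟨hjneg, hone⟩, PowerSeries.constantCoeff_C,
        Finset.sum_eq_single j]
      · rw [toricTerm, if_pos ⟨hjneg, hone⟩, Algebra.smul_def, Algebra.smul_def, map_mul]
        ring
      · intro i hi hij
        rw [toricTerm, if_neg (fun h => ?_), zero_smul]
        exact absurd (hone i (by have := Finset.mem_range.1 hi; omega) hij) (not_le.2 h.1)
      · exact fun h => absurd hjmem h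
    · push Not at hone
      obtain ⟨i, hi, hij, hineg⟩ := hone
      have hcard : 2 ≤ ((Finset.range (n + 1)).filter fun j => degD n d j < 0).card := by
        have : ({i, j} : Finset ℕ) ⊆ (Finset.range (n + 1)).filter fun j => degD n d j < 0 := by
          intro k hk
          rw [Finset.mem_insert, Finset.mem_singleton] at hk
          rw [Finset.mem_filter, Finset.mem_range]
          rcases hk with rfl | rfl
          · exact ⟨by omega, hineg⟩
          · exact ⟨by omega, hjneg⟩
        rw [← Finset.card_pair hij]
        exact Finset.card_le_card this
      rw [h1, coeff_single_mul_ofPowerSeries_of_pos (by omega), Finset.sum_eq_zero]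
      intro k hk
      have hk := Finset.mem_range.1 hk
      rw [toricTerm, if_neg (fun h => ?_), zero_smul]
      by_cases hki : k = i
      · exact absurd (h.2 j hj (by rintro rfl; exact hij hki.symm)) (not_le.2 hjneg)
      · exact absurd (h.2 i hi fun h => hki h.symm) (not_le.2 hineg)

/-! ### Closed form of the flat co-ordinates for Y -/

/-- The corrections to the flat co-ordinates for `Y`. -/
def toricSum (n j : ℕ) (y : Chart n) : ℂ := ∑' d, toricTerm n j y d

/-- The principal branches of the flat co-ordinates for `Y`. -/
def flatY (n i : ℕ) (y : Chart n) : ℂ :=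
  if i = 0 then y.1 else Complex.log (entry y.2 1 i) + (toricSum n (i - 1) y -
    2 * toricSum n i y + toricSum n (i + 1) y)

theorem om_eq {n j : ℕ} (hj0 : j ≠ 0) (hjn : j ≠ n) :
    om n j = gam n (j - 1) - 2 * gam n j + gam n (j + 1) := by
  simp only [om, omegaPoly, if_neg hj0, if_neg hjn, add_zero, map_add, map_sub, map_mul, map_ofNat]
  rfl

theorem gam_eq_zero {n j : ℕ} (hj : ¬ (1 ≤ j ∧ j ≤ n - 1)) : gam n j = 0 := by
  rw [gam, gammaPoly, entry_of_not_mem _ _ hj]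
  exact map_zero _

/-- Summation by parts moves the second difference from the classes ω_j to their coefficients. The
vanishing of s at 0 and n removes ω_0 and ω_n, and with them λ₁ and λ₂. -/
theorem sum_toricTerm_smul_om {n : ℕ} (hn : 2 ≤ n) (s : ℕ → ℂ) (h0 : s 0 = 0)
    (hs : ∀ j, n ≤ j → s j = 0) :
    ∑ j ∈ Finset.range (n + 1), s j • om n j = ∑ k : Fin (n - 1),
      (s k - 2 * s (k + 1) + s (k + 2)) • gam n ((k : ℕ) + 1) := by
  obtain ⟨m, rfl⟩ : ∃ m, n = m + 1 := ⟨n - 1, by omega⟩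
  have h1 : ∀ j ∈ Finset.range (m + 1 + 1), s j • om (m + 1) j =
      s j • gam (m + 1) (j - 1) - (2 * s j) • gam (m + 1) j + s j • gam (m + 1) (j + 1) := by
    intro j hj
    by_cases hj0 : j = 0
    · subst hj0; simp [h0]
    by_cases hjn : j = m + 1
    · rw [hs j hjn.ge]; simp
    rw [om_eq hj0 hjn, Algebra.smul_def, Algebra.smul_def, Algebra.smul_def, Algebra.smul_def, map_mul,
      map_ofNat]
    ring
  rw [Finset.sum_congr rfl h1, Finset.sum_add_distrib, Finset.sum_sub_distrib]
  have hF := Fin.sum_univ_eq_sum_range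
    (fun k => (s k - 2 * s (k + 1) + s (k + 2)) • gam (m + 1) (k + 1)) m
  refine Eq.trans ?_ hF.symm
  simp only [add_smul, sub_smul, Finset.sum_add_distrib, Finset.sum_sub_distrib]
  have g0 : gam (m + 1) 0 = 0 := gam_eq_zero (by omega)
  have g1 : gam (m + 1) (m + 1) = 0 := gam_eq_zero (by omega)
  have A : ∑ j ∈ Finset.range (m + 1 + 1), s j • gam (m + 1) (j - 1) =
      ∑ k ∈ Finset.range m, s (k + 2) • gam (m + 1) (k + 1) := by
    rw [Finset.sum_range_succ', Finset.sum_range_succ']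
    simp [h0, g0]
  have B : ∑ j ∈ Finset.range (m + 1 + 1), (2 * s j) • gam (m + 1) j =
      ∑ k ∈ Finset.range m, (2 * s (k + 1)) • gam (m + 1) (k + 1) := by
    rw [Finset.sum_range_succ', Finset.sum_range_succ, h0, hs (m + 1) le_rfl]
    simp
  have C : ∑ j ∈ Finset.range (m + 1 + 1), s j • gam (m + 1) (j + 1) =
      ∑ k ∈ Finset.range m, s k • gam (m + 1) (k + 1) := by
    rw [Finset.sum_range_succ, Finset.sum_range_succ, g1, hs (m + 1) le_rfl]
    simp
  rw [A, B, C]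
  abel

/-- The component along `γ_i` of the contribution of `d` to the `I`-function. -/
def flatYTerm (n : ℕ) (y : Chart n) (d : Fin (n - 1) → ℕ) (i : ℕ) : ℂ :=
  if i = 0 then (if d = 0 then y.1 else 0) else
    (if d = 0 then Complex.log (entry y.2 1 i) else 0) +
      (toricTerm n (i - 1) y d - 2 * toricTerm n i y d + toricTerm n (i + 1) y d)

theorem hasFlatCoordinatesY_flatY {n : ℕ} (hn : 2 ≤ n) {y : Chart n}
    (hs : ∀ j, Summable (toricTerm n j y)) : HasFlatCoordinatesY n y fun i => flatY n i y := by
  -- No λ survives, so the components are constant polynomials.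
  refine ⟨fun d i => MvPolynomial.C (flatYTerm n y d i), fun d => ?_, fun l i _ => ?_⟩
  · rw [coeff_zero_IYterm hn, sum_toricTerm_smul_om hn _ (toricTerm_eq_zero (Or.inl rfl) y d)
      fun j hj => toricTerm_eq_zero (Or.inr hj) y d]
    obtain ⟨m, rfl⟩ : ∃ m, n = m + 1 := ⟨n - 1, by omega⟩
    have hC : ∀ (a : ℂ) (v : HTY (m + 1)), (MvPolynomial.C a : LambdaRing) • v = a • v :=
      fun a v => algebraMap_smul LambdaRing a v
    simp only [hC]
    rw [Finset.sum_range_succ']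
    have hF := Fin.sum_univ_eq_sum_range
      (fun k => flatYTerm (m + 1) y d (k + 1) • gammaBasis (m + 1) (k + 1)) m
    rw [← hF]
    have h1 : ∀ k : Fin m, flatYTerm (m + 1) y d (k + 1) • gammaBasis (m + 1) (k + 1) =
        (if d = 0 then Complex.log (y.2 k) • gam (m + 1) (k + 1) else 0) +
        (toricTerm (m + 1) k y d - 2 * toricTerm (m + 1) (k + 1) y d +
          toricTerm (m + 1) (k + 2) y d) • gam (m + 1) (k + 1) := by
      intro k
      rw [flatYTerm, if_neg (Nat.succ_ne_zero _), gammaBasis, if_neg (Nat.succ_ne_zero _),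
        entry_of_mem y.2 1 k, add_smul, ite_smul, zero_smul]
      rfl
    simp only [h1, Finset.sum_add_distrib]
    rw [flatYTerm, if_pos rfl, gammaBasis, if_pos rfl, ite_smul, zero_smul,
      Algebra.smul_def, mul_one]
    split_ifs
    · abel
    · rw [Finset.sum_const_zero, zero_add, zero_add, add_zero]
      rfl
  · simp only [MvPolynomial.eval_C]
    have hd : ∀ a : ℂ, HasSum (fun d : Fin (n - 1) → ℕ => if d = 0 then a else 0) a :=
      fun a => hasSum_ite_eq 0 a
    by_cases hi : i = 0
    · simp only [flatYTerm, flatY, if_pos hi]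
      exact hd _
    · simp only [flatYTerm, flatY, if_neg hi]
      exact (hd _).add ((((hs _).hasSum).sub ((hs _).hasSum.mul_left 2)).add (hs _).hasSum)

/-! ### Reindexing the corrections by the degrees of the divisors -/

/-- The degrees of the divisors, with the negative ones replaced by `0`. -/
def degE (n : ℕ) (d : Fin (n - 1) → ℕ) (i : Fin (n + 1)) : ℕ := (degD n d i).toNat

/-- The classes that contribute to the correction `S_j`. -/
def IsNegAt (n j : ℕ) (d : Fin (n - 1) → ℕ) : Prop :=
  degD n d j < 0 ∧ ∀ i ≤ n, i ≠ j → 0 ≤ degD n d i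

theorem toricTerm_of_isNegAt {n j : ℕ} {d : Fin (n - 1) → ℕ} (h : IsNegAt n j d) (y : Chart n) :
    toricTerm n j y d = (logCoeff (degE n d) : ℂ) * ∏ k, y.2 k ^ d k := if_pos h

theorem toricTerm_of_not_isNegAt {n j : ℕ} {d : Fin (n - 1) → ℕ} (h : ¬ IsNegAt n j d)
    (y : Chart n) : toricTerm n j y d = 0 := if_neg h

theorem sum_degE_smul {n j : ℕ} (hn : 2 ≤ n) {d : Fin (n - 1) → ℕ} (h : IsNegAt n j d)
    {M : Type*} [AddCommGroup M] (f : ℕ → M) (hf : f j = 0) :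
    ∑ i, degE n d i • f i = ∑ k : Fin (n - 1), (d k : ℤ) • (f k - 2 • f (k + 1) + f (k + 2)) := by
  rw [← sum_degD_smul hn, ← Fin.sum_univ_eq_sum_range (fun i => degD n d i • f i)]
  refine Finset.sum_congr rfl fun i _ => ?_
  by_cases hi : (i : ℕ) = j
  · rw [hi, hf, smul_zero, smul_zero]
  · rw [← natCast_zsmul]
    congr 1
    exact Int.toNat_of_nonneg (h.2 i (by omega) hi)

/-- Truncation loses only D_j, which is minus the sum of the other degrees. -/
theorem degE_injOn {n j : ℕ} (hn : 2 ≤ n) (hj : j ≤ n) {d d' : Fin (n - 1) → ℕ}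
    (h : IsNegAt n j d) (h' : IsNegAt n j d') (he : degE n d = degE n d') : d = d' := by
  have h1 : ∀ i ≤ n, (degD n d i).toNat = (degD n d' i).toNat := fun i hi =>
    congrFun he ⟨i, by omega⟩
  refine degD_injective fun i hi => ?_
  by_cases hij : i = j
  · subst hij
    have h2 := sum_toNat_degD hn hj h
    have h3 := sum_toNat_degD hn hj h'
    have h4 : ∑ i ∈ Finset.range (n + 1), (degD n d i).toNat =
        ∑ i ∈ Finset.range (n + 1), (degD n d' i).toNat :=
      Finset.sum_congr rfl fun i hi => h1 i (Nat.lt_succ_iff.1 (Finset.mem_range.1 hi))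
    have h5 := h.1
    have h6 := h'.1
    omega
  · have h2 := h1 i hi
    have h3 := h.2 i hi hij
    have h4 := h'.2 i hi hij
    omega

/-- Setting D_j = -∑ e_i makes D orthogonal to all affine functions. Hence D is the second
difference of δ(m) = ∑ D_i max(m - i, 0), which vanishes for m ≥ n and so provides d. -/
theorem exists_degE_eq {n : ℕ} (hn : 2 ≤ n) (j : Fin (n + 1)) {e : Fin (n + 1) → ℕ} (he : e j = 0)
    (hpos : ∑ i, e i ≠ 0) (hm : ∑ i, (e i : ℤ) * ((i : ℕ) - (j : ℕ) : ℤ) = 0) :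
    ∃ d : Fin (n - 1) → ℕ, IsNegAt n j d ∧ degE n d = e := by
  classical
  set D : Fin (n + 1) → ℤ := fun i => if i = j then -∑ i, (e i : ℤ) else e i with hD
  have hsum : ∑ i, D i = 0 := by
    rw [← Finset.add_sum_erase _ _ (Finset.mem_univ j)]
    have : ∑ i ∈ Finset.univ.erase j, D i = ∑ i ∈ Finset.univ.erase j, (e i : ℤ) :=
      Finset.sum_congr rfl fun i hi => if_neg (Finset.ne_of_mem_erase hi)
    have h2 : ∑ i, (e i : ℤ) = ∑ i ∈ Finset.univ.erase j, (e i : ℤ) := by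
      rw [← Finset.add_sum_erase _ _ (Finset.mem_univ j), he]; simp
    rw [this, hD]
    simp only [if_pos]
    rw [h2]
    ring
  have hmom : ∑ i, D i * ((i : ℕ) - (j : ℕ) : ℤ) = 0 := by
    rw [← hm]
    refine Finset.sum_congr rfl fun i _ => ?_
    by_cases hij : i = j
    · rw [hij, sub_self, mul_zero, mul_zero]
    · simp only [hD, if_neg hij]
  have hlin : ∀ m : ℤ, ∑ i, D i * (m - (i : ℕ)) = 0 := by
    intro m
    have : ∀ i : Fin (n + 1), D i * (m - (i : ℕ)) =
        (m - (j : ℕ)) * D i - D i * ((i : ℕ) - (j : ℕ) : ℤ) := fun i => by ring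
    rw [Finset.sum_congr rfl fun i _ => this i, Finset.sum_sub_distrib, ← Finset.mul_sum, hsum,
      hmom]
    ring
  set δ : ℕ → ℤ := fun m => ∑ i : Fin (n + 1), D i * (max (m - (i : ℕ) : ℤ) 0) with hδ
  -- Only D_j is negative. For m ≤ j its weight max(m - j, 0) is 0; for m > j orthogonality to m - i
  -- replaces the weights by max(i - m, 0), again 0 at i = j.
  have hnonneg : ∀ m, 0 ≤ δ m := by
    intro m
    rcases Nat.lt_or_ge (j : ℕ) m with h | h
    · have : δ m = ∑ i, D i * (max ((i : ℕ) - m : ℤ) 0) := by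
        refine sub_eq_zero.1 (Eq.trans ?_ (hlin m))
        rw [hδ, ← Finset.sum_sub_distrib]
        refine Finset.sum_congr rfl fun i _ => ?_
        rw [← mul_sub]
        congr 1
        omega
      rw [this]
      refine Finset.sum_nonneg fun i _ => ?_
      by_cases hij : i = j
      · rw [hij, max_eq_right (by omega), mul_zero]
      · simp only [hD, if_neg hij]; positivity
    · refine Finset.sum_nonneg fun i _ => ?_
      by_cases hij : i = j
      · rw [hij, max_eq_right (by omega), mul_zero]
      · simp only [hD, if_neg hij]; positivity
  have hlast : ∀ m, n ≤ m → δ m = 0 := by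
    intro m hnm
    rw [← hlin m]
    refine Finset.sum_congr rfl fun i _ => ?_
    rw [max_eq_left (by omega)]
  have hzero : δ 0 = 0 := by
    refine Finset.sum_eq_zero fun i _ => ?_
    rw [max_eq_right (by omega), mul_zero]
  have hsecond : ∀ i : Fin (n + 1), δ ((i : ℕ) - 1) - 2 * δ i + δ ((i : ℕ) + 1) = D i := by
    intro i
    have h1 : ∀ k : Fin (n + 1), D k * max ((((i : ℕ) - 1 : ℕ) : ℤ) - (k : ℕ)) 0 -
        2 * (D k * max (((i : ℕ) : ℤ) - (k : ℕ)) 0) +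
        D k * max ((((i : ℕ) + 1 : ℕ) : ℤ) - (k : ℕ)) 0 = if k = i then D k else 0 := by
      intro k
      split_ifs with hki
      · subst hki
        rw [max_eq_right (by omega), max_eq_right (by omega), max_eq_left (by omega)]
        push_cast
        ring
      · have hki' : (k : ℕ) ≠ i := fun h => hki (Fin.ext h)
        rcases Nat.lt_or_ge (k : ℕ) i with h | h
        · rw [max_eq_left (by omega), max_eq_left (by omega), max_eq_left (by omega)]
          push_cast [Nat.cast_sub (by omega : 1 ≤ (i : ℕ))]
          ring
        · rw [max_eq_right (by omega), max_eq_right (by omega), max_eq_right (by omega)]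
          ring
    simp only [hδ]
    rw [Finset.mul_sum, ← Finset.sum_sub_distrib, ← Finset.sum_add_distrib,
      Finset.sum_congr rfl fun k _ => h1 k, Finset.sum_ite_eq' Finset.univ i]
    simp
  set d : Fin (n - 1) → ℕ := fun k => (δ ((k : ℕ) + 1)).toNat with hd
  have hentry : ∀ m, entry (fun i => (d i : ℤ)) 0 m = δ m := by
    intro m
    by_cases h : 1 ≤ m ∧ m ≤ n - 1
    · have := entry_of_mem (fun i => (d i : ℤ)) 0 (⟨m - 1, by omega⟩ : Fin (n - 1))
      simp only [Nat.sub_add_cancel h.1] at this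
      rw [this, hd]
      simp only [Nat.sub_add_cancel h.1]
      exact Int.toNat_of_nonneg (hnonneg m)
    · rw [entry_of_not_mem _ _ h]
      rcases Nat.eq_zero_or_pos m with rfl | h0
      · exact hzero.symm
      · exact (hlast m (by omega)).symm
  have hdeg : ∀ i : Fin (n + 1), degD n d i = D i := by
    intro i
    rw [degD, hentry, hentry, hentry, hsecond]
  refine ⟨d, ⟨?_, fun i hi hij => ?_⟩, ?_⟩
  · rw [hdeg, hD]
    simp only [if_pos]
    have h1 : ((∑ i, e i : ℕ) : ℤ) ≠ 0 := by exact_mod_cast hpos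
    have h2 : (0 : ℤ) ≤ ((∑ i, e i : ℕ) : ℤ) := by positivity
    push_cast at h1 h2
    omega
  · have := hdeg ⟨i, by omega⟩
    simp only at this
    rw [this, hD]
    simp only
    rw [if_neg fun h => hij (by rw [← h])]
    positivity
  · funext i
    rw [degE, hdeg, hD]
    simp only
    split_ifs with hij
    · rw [hij, he]
      have h2 : (0 : ℤ) ≤ ((∑ i, e i : ℕ) : ℤ) := by positivity
      push_cast at h2
      omega
    · simp

theorem degE_self {n j : ℕ} {d : Fin (n - 1) → ℕ} (h : IsNegAt n j d) (i : Fin (n + 1))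
    (hi : (i : ℕ) = j) : degE n d i = 0 := by
  have := h.1
  rw [degE, hi]
  omega

/-! ### Convergence of the corrections -/

/-- Take β_i = s^{(i-j)²} for i ≠ j. Since ∑ e_i (i - j)² = 2 ∑ d_k, the product of the β_i^{e_i} is
s^{2|d|}, which bounds the monomial in y. As ∑ β_i < 1, the logarithmic series is a majorant through
the injection d ↦ e. -/
theorem summable_toricTerm {n : ℕ} (hn : 2 ≤ n) {s : ℝ} (hs0 : 0 ≤ s) (hs : (n + 1) * s < 1)
    {y : Chart n} (hy : ∀ k, ‖y.2 k‖ ≤ s ^ 2) (j : ℕ) : Summable (toricTerm n j y) := by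
  by_cases hj : n ≤ j
  · exact summable_zero.congr fun d => (toricTerm_eq_zero (Or.inr hj) y d).symm
  have hs1 : s ≤ 1 := by
    have : (1 : ℝ) ≤ n + 1 := by linarith [(Nat.cast_nonneg n : (0 : ℝ) ≤ n)]
    nlinarith
  set β : Fin (n + 1) → ℝ := fun i => if (i : ℕ) = j then 0 else
    s ^ (((i : ℕ) - (j : ℕ) : ℤ) ^ 2).toNat with hβ
  have hβ0 : ∀ i, 0 ≤ β i := fun i => by
    simp only [hβ]
    split_ifs
    · exact le_rfl
    · positivity
  have hβ1 : ∑ i, β i < 1 := by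
    refine lt_of_le_of_lt (Finset.sum_le_sum (g := fun _ => s) fun i _ => ?_) ?_
    · simp only [hβ]
      split_ifs with h
      · exact hs0
      · refine pow_le_of_le_one hs0 hs1 ?_
        have : (0 : ℤ) < (((i : ℕ) - (j : ℕ) : ℤ)) ^ 2 := by
          have : (((i : ℕ) - (j : ℕ) : ℤ)) ≠ 0 := by omega
          positivity
        omega
    · rw [Finset.sum_const, Finset.card_univ, Fintype.card_fin, nsmul_eq_mul]
      push_cast
      exact hs
  have hsum := summable_abs_logCoeff β hβ0 hβ1
  have hinj : Function.Injective fun d : {d // IsNegAt n j d} => degE n (d : Fin (n - 1) → ℕ) :=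
    fun d d' h => Subtype.ext (degE_injOn hn (by omega) d.2 d'.2 h)
  have h1 := hsum.comp_injective hinj
  have h2 := (summable_subtype_iff_indicator (s := {d | IsNegAt n j d})
    (f := fun d => |logCoeff (degE n d)| * ∏ i, β i ^ degE n d i)).1 h1
  refine Summable.of_norm_bounded h2 fun d => ?_
  by_cases hd : IsNegAt n j d
  · rw [Set.indicator_of_mem (by exact hd), toricTerm_of_isNegAt hd, norm_mul, Complex.norm_real,
      Real.norm_eq_abs, norm_prod]
    refine mul_le_mul_of_nonneg_left ?_ (abs_nonneg _)
    have h3 : ∏ i, β i ^ degE n d i = s ^ (2 * ∑ k, d k) := by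
      have h4 : ∀ i, β i ^ degE n d i =
          s ^ (degE n d i * (((i : ℕ) - (j : ℕ) : ℤ) ^ 2).toNat) := by
        intro i
        by_cases hij : (i : ℕ) = j
        · rw [degE_self hd i hij]; simp
        · simp only [hβ, if_neg hij]
          rw [← pow_mul, mul_comm]
      rw [Finset.prod_congr rfl fun i _ => h4 i, Finset.prod_pow_eq_pow_sum]
      congr 1
      have h5 := sum_degE_smul hn hd (fun i => ((i : ℕ) - (j : ℕ) : ℤ) ^ 2) (by simp)
      have h6 : ∀ k : Fin (n - 1), (d k : ℤ) • ((((k : ℕ) - j : ℤ)) ^ 2 -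
          2 • ((((k : ℕ) + 1 : ℕ) - (j : ℕ) : ℤ)) ^ 2 + (((((k : ℕ) + 2 : ℕ) : ℤ) - j)) ^ 2) =
          2 * d k := by
        intro k
        push_cast
        rw [zsmul_eq_mul, nsmul_eq_mul]
        push_cast
        ring
      rw [Finset.sum_congr rfl fun k _ => h6 k, ← Finset.mul_sum] at h5
      zify
      rw [← h5]
      refine Finset.sum_congr rfl fun i _ => ?_
      rw [nsmul_eq_mul, Int.toNat_of_nonneg (sq_nonneg _)]
    rw [h3, mul_comm 2, pow_mul', ← Finset.prod_pow_eq_pow_sum]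
    refine Finset.prod_le_prod (fun k _ => norm_nonneg _) fun k _ => ?_
    rw [norm_pow]
    exact pow_le_pow_left₀ (norm_nonneg _) (hy k) _
  · rw [toricTerm_of_not_isNegAt hd, Set.indicator_of_notMem (by exact hd), norm_zero]

/-! ### The corrections as contour integrals -/

theorem circleIntegral_inv_mul_zpow {ρ : ℝ} (hρ : 0 < ρ) (m : ℤ) :
    ∮ w in C(0, ρ), w⁻¹ * w ^ m = if m = 0 then 2 * Real.pi * Complex.I else 0 := by
  split_ifs with h
  · subst h
    simpa using circleIntegral.integral_sub_center_inv 0 hρ.ne'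
  · have h1 := circleIntegral.integral_sub_zpow_of_ne (n := m - 1) (by omega) 0 0 ρ
    refine Eq.trans ?_ h1
    refine circleIntegral.integral_congr hρ.le fun w hw => ?_
    have hw0 : w ≠ 0 := by
      rintro rfl
      rw [mem_sphere_zero_iff_norm, norm_zero] at hw
      exact hρ.ne hw
    simp only [sub_zero]
    rw [zpow_sub_one₀ hw0, mul_comm]

theorem ne_zero_of_mem_sphere {ρ : ℝ} (hρ : 0 < ρ) {w : ℂ} (hw : w ∈ Metric.sphere (0 : ℂ) ρ) :
    w ≠ 0 := by
  rintro rfl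
  rw [mem_sphere_zero_iff_norm, norm_zero] at hw
  exact hρ.ne hw

theorem continuousOn_const_mul_zpow {ρ : ℝ} (hρ : 0 < ρ) (a : ℂ) (m : ℤ) :
    ContinuousOn (fun w : ℂ => a * w ^ m) (Metric.sphere 0 ρ) :=
  continuousOn_const.mul (continuousOn_id.zpow₀ m fun _ hw => Or.inl (ne_zero_of_mem_sphere hρ hw))

theorem continuousOn_inv_sphere {ρ : ℝ} (hρ : 0 < ρ) :
    ContinuousOn (fun w : ℂ => w⁻¹) (Metric.sphere 0 ρ) :=
  continuousOn_inv₀.mono fun _ hw => ne_zero_of_mem_sphere hρ hw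

/-- Only non-zero powers of w occur in the logarithm, so its constant term is 0. -/
theorem circleIntegral_inv_mul_log {ρ : ℝ} (hρ : 0 < ρ) (a : ℂ) {m : ℤ} (hm : m ≠ 0)
    (h : ‖a‖ * ρ ^ m < 1) : ∮ w in C(0, ρ), w⁻¹ * Complex.log (1 + a * w ^ m) = 0 := by
  have h1 := hasSum_circleIntegral_log hρ.le 0 (fun (_ : Unit) w => a * w ^ m)
    (fun _ => ‖a‖ * ρ ^ m) (fun w => w⁻¹) (fun _ => continuousOn_const_mul_zpow hρ a m)
    (continuousOn_inv_sphere hρ) (fun _ w hw => by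
      rw [norm_mul, norm_zpow, mem_sphere_zero_iff_norm.1 hw]) (by simpa using h)
  simp only [Finset.univ_unique, Finset.sum_singleton, Finset.prod_singleton] at h1
  refine h1.unique (hasSum_of_eq hasSum_zero (fun e => ?_) rfl)
  by_cases he : e default = 0
  · rw [logCoeff, if_pos (by simpa using he)]
    simp
  · have h2 : ∀ w : ℂ, w⁻¹ * (a * w ^ m) ^ e default =
        a ^ e default * (w⁻¹ * w ^ (m * (e default : ℤ))) := by
      intro w
      rw [mul_pow, zpow_mul, zpow_natCast]
      ring
    simp only [h2]
    rw [circleIntegral.integral_const_mul, circleIntegral_inv_mul_zpow hρ,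
      if_neg (mul_ne_zero hm (by exact_mod_cast he)), mul_zero, mul_zero]

/-- The summands of `W_X(w) / (x_j w^j) - 1`. -/
def ratioTerm (n : ℕ) (x : Chart n) (j : ℕ) (i : Fin (n + 1)) (w : ℂ) : ℂ :=
  if (i : ℕ) = j then 0 else entry x.2 1 i / entry x.2 1 j * w ^ ((i : ℕ) - (j : ℕ) : ℤ)

theorem prod_ratioTerm_pow {n : ℕ} (x : Chart n) {j : ℕ} {e : Fin (n + 1) → ℕ}
    (he : ∀ i : Fin (n + 1), (i : ℕ) = j → e i = 0) (w : ℂ) (hw : w ≠ 0) :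
    ∏ i, ratioTerm n x j i w ^ e i = (∏ i : Fin (n + 1), (entry x.2 1 i / entry x.2 1 j) ^ e i) *
      w ^ (∑ i, (e i : ℤ) * ((i : ℕ) - (j : ℕ) : ℤ)) := by
  have h1 : w ^ (∑ i, (e i : ℤ) * ((i : ℕ) - (j : ℕ) : ℤ)) =
      ∏ i : Fin (n + 1), w ^ ((e i : ℤ) * ((i : ℕ) - (j : ℕ) : ℤ)) := by
    induction (Finset.univ : Finset (Fin (n + 1))) using Finset.induction_on with
    | empty => simp
    | insert a s ha ih => rw [Finset.sum_insert ha, Finset.prod_insert ha, zpow_add₀ hw, ih]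
  rw [h1, ← Finset.prod_mul_distrib]
  refine Finset.prod_congr rfl fun i _ => ?_
  by_cases hij : (i : ℕ) = j
  · rw [he i hij]; simp
  · rw [ratioTerm, if_neg hij, mul_pow, mul_comm (e i : ℤ), zpow_mul, zpow_natCast]

/-- `sum_degE_smul` applied to f i = log x_i - log x_j. Only exponentials are compared, so the
branches of the logarithms do not matter. -/
theorem prod_toY_pow {n j : ℕ} (hn : 2 ≤ n) {x : Chart n} (hx : ∀ i ≤ n, entry x.2 1 i ≠ 0)
    {d : Fin (n - 1) → ℕ} (hj : j ≤ n) (hd : IsNegAt n j d) :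
    ∏ k, (toY n x).2 k ^ d k =
      ∏ i : Fin (n + 1), (entry x.2 1 i / entry x.2 1 j) ^ degE n d i := by
  set l : ℕ → ℂ := fun i => Complex.log (entry x.2 1 i) with hl
  have hexp : ∀ i ≤ n, entry x.2 1 i = Complex.exp (l i) := fun i hi =>
    (Complex.exp_log (hx i hi)).symm
  have h1 := sum_degE_smul hn hd (fun i => l i - l j) (sub_self _)
  have h2 : ∏ i : Fin (n + 1), (entry x.2 1 i / entry x.2 1 j) ^ degE n d i =
      Complex.exp (∑ i : Fin (n + 1), degE n d i • (l i - l j)) := by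
    rw [Complex.exp_sum]
    refine Finset.prod_congr rfl fun i _ => ?_
    rw [hexp i (by omega), hexp j hj, ← Complex.exp_sub, nsmul_eq_mul, Complex.exp_nat_mul]
  rw [h2, h1, Complex.exp_sum]
  refine Finset.prod_congr rfl fun k _ => ?_
  rw [zsmul_eq_mul, Int.cast_natCast, Complex.exp_nat_mul]
  congr 1
  rw [toY]
  simp only
  rw [← entry_of_mem x.2 1 k, hexp k (by omega), hexp (k + 1) (by omega), hexp (k + 2) (by omega),
    ← Complex.exp_nat_mul, ← Complex.exp_neg, ← Complex.exp_add, ← Complex.exp_add]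
  congr 1
  rw [nsmul_eq_mul]
  push_cast
  ring

/-- Integrating the expansion of log(W(w) / (x_j w^j)) against dw/w keeps the exponents e with e_j =
0 and ∑ e_i (i - j) = 0. Apart from e = 0, these are the truncated degrees of the classes whose only
negative degree is D_j. -/
theorem hasSum_toricTerm {n j : ℕ} (hn : 2 ≤ n) (hj : j ≤ n) {x : Chart n}
    (hx : ∀ i ≤ n, entry x.2 1 i ≠ 0) {ρ : ℝ} (hρ : 0 < ρ) (β : Fin (n + 1) → ℝ)
    (hβ : ∀ i, ∀ w ∈ Metric.sphere (0 : ℂ) ρ, ‖ratioTerm n x j i w‖ ≤ β i) (hβ1 : ∑ i, β i < 1) :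
    HasSum (toricTerm n j (toY n x)) ((2 * Real.pi * Complex.I)⁻¹ *
      ∮ w in C(0, ρ), w⁻¹ * Complex.log (1 + ∑ i, ratioTerm n x j i w)) := by
  have hpi := Complex.two_pi_I_ne_zero
  set jj : Fin (n + 1) := ⟨j, by omega⟩ with hjj
  have h1 := (hasSum_circleIntegral_log hρ.le 0 (ratioTerm n x j) β (fun w => w⁻¹)
    (fun i => by
      unfold ratioTerm
      split_ifs
      · exact continuousOn_const
      · exact continuousOn_const_mul_zpow hρ _ _)
    (continuousOn_inv_sphere hρ) hβ hβ1).mul_left (2 * Real.pi * Complex.I)⁻¹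
  have hv : ∀ e : Fin (n + 1) → ℕ, (2 * Real.pi * Complex.I)⁻¹ *
      ((logCoeff e : ℂ) * ∮ w in C(0, ρ), w⁻¹ * ∏ i, ratioTerm n x j i w ^ e i) =
      if e jj = 0 ∧ ∑ i, (e i : ℤ) * ((i : ℕ) - (j : ℕ) : ℤ) = 0 then
        (logCoeff e : ℂ) * ∏ i : Fin (n + 1), (entry x.2 1 i / entry x.2 1 j) ^ e i else 0 := by
    intro e
    by_cases he : e jj = 0
    · have he' : ∀ i : Fin (n + 1), (i : ℕ) = j → e i = 0 := fun i hi => by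
        rw [← he]; congr 1; exact Fin.ext hi
      have h2 : ∮ w in C(0, ρ), w⁻¹ * ∏ i, ratioTerm n x j i w ^ e i =
          ∮ w in C(0, ρ), (∏ i : Fin (n + 1), (entry x.2 1 i / entry x.2 1 j) ^ e i) *
            (w⁻¹ * w ^ (∑ i, (e i : ℤ) * ((i : ℕ) - (j : ℕ) : ℤ))) := by
        refine circleIntegral.integral_congr hρ.le fun w hw => ?_
        rw [prod_ratioTerm_pow x he' w (ne_zero_of_mem_sphere hρ hw)]
        ring
      rw [h2, circleIntegral.integral_const_mul, circleIntegral_inv_mul_zpow hρ]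
      by_cases hm : ∑ i, (e i : ℤ) * ((i : ℕ) - (j : ℕ) : ℤ) = 0
      · rw [if_pos hm, if_pos ⟨he, hm⟩]
        field_simp
      · rw [if_neg hm, if_neg fun h => hm h.2]
        simp
    · rw [if_neg fun h => he h.1]
      have h2 : ∀ w, ∏ i, ratioTerm n x j i w ^ e i = 0 := fun w =>
        Finset.prod_eq_zero (Finset.mem_univ jj) (by rw [ratioTerm, if_pos rfl, zero_pow he])
      simp [h2, circleIntegral]
  have hval : ∀ d, IsNegAt n j d → (2 * Real.pi * Complex.I)⁻¹ * ((logCoeff (degE n d) : ℂ) *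
      ∮ w in C(0, ρ), w⁻¹ * ∏ i, ratioTerm n x j i w ^ degE n d i) =
      toricTerm n j (toY n x) d := by
    intro d hd
    have h2 := sum_degE_smul hn hd (fun i => ((i : ℕ) - (j : ℕ) : ℤ)) (sub_self _)
    simp only [nsmul_eq_mul] at h2
    have h3 : ∑ i, (degE n d i : ℤ) * ((i : ℕ) - (j : ℕ) : ℤ) = 0 := by
      rw [h2]
      refine Finset.sum_eq_zero fun k _ => ?_
      rw [zsmul_eq_mul]
      push_cast
      ring
    rw [hv, if_pos ⟨degE_self hd jj rfl, h3⟩, toricTerm_of_isNegAt hd, prod_toY_pow hn hx hj hd]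
  have hneg : ∀ d : Function.support (toricTerm n j (toY n x)), IsNegAt n j d := by
    intro d
    by_contra h
    exact d.2 (toricTerm_of_not_isNegAt h _)
  refine (hasSum_iff_hasSum_of_ne_zero_bij
    (fun d : Function.support (toricTerm n j (toY n x)) => degE n (d : Fin (n - 1) → ℕ))
    ?_ ?_ ?_).1 h1
  · intro d d' h
    exact Subtype.ext (degE_injOn hn hj (hneg d) (hneg d') h)
  · intro e he
    have he' := Function.mem_support.1 he
    rw [hv] at he'
    have h3 := (ite_ne_right_iff.1 he').1
    have h4 := left_ne_zero_of_mul (ite_ne_right_iff.1 he').2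
    have h5 : ∑ i, e i ≠ 0 := by
      intro h
      rw [logCoeff, if_pos h] at h4
      simp at h4
    obtain ⟨d, hd, hde⟩ := exists_degE_eq hn jj h3.1 h5 h3.2
    refine ⟨⟨d, ?_⟩, hde⟩
    rw [Function.mem_support, ← hval d hd, hde]
    exact he
  · intro d
    exact hval d (hneg d)

/-- On the circle W(w) / (x_j w^j) = K ∏_{k<j} (1 - κ_k/w) ∏_{k≥j} (1 - w/κ_k), with K the
right-hand quotient. The logarithms of the linear factors have no constant term, so S_j = log K; the
bounds 1/(16n) rule out a multiple of 2πi. -/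
theorem exp_toricSum {n j : ℕ} (hn : 2 ≤ n) (hj : j ≤ n) {x : Chart n} {κ : ℕ → ℂ}
    (hW : ∀ w, (WX n x).eval w = ∏ k ∈ Finset.range n, (w - κ k))
    (hx : ∀ i ≤ n, entry x.2 1 i ≠ 0) {ρ : ℝ} (hρ : 0 < ρ)
    (h1 : ∀ i ≤ n, i ≠ j →
      ‖entry x.2 1 i / entry x.2 1 j‖ * ρ ^ ((i : ℤ) - (j : ℤ)) ≤ 1 / (16 * n))
    (h2 : ∀ k < n, k < j → ‖κ k‖ * ρ⁻¹ ≤ 1 / (16 * n))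
    (h3 : ∀ k < n, j ≤ k → ρ * ‖κ k‖⁻¹ ≤ 1 / (16 * n)) (hκ : ∀ k < n, κ k ≠ 0) :
    Complex.exp (toricSum n j (toY n x)) =
      (∏ k ∈ Finset.Ico j n, (-κ k)) / entry x.2 1 j ∧
    ‖toricSum n j (toY n x)‖ ≤ 1 / 2 := by
  have hn' : (0 : ℝ) < n := by exact_mod_cast (by omega : 0 < n)
  have hn1 : (1 : ℝ) ≤ n := by exact_mod_cast (by omega : 1 ≤ n)
  have hε : 1 / (16 * (n : ℝ)) ≤ 1 / 16 := by
    rw [div_le_div_iff_of_pos_left one_pos (by positivity) (by positivity)]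
    linarith
  set K : ℂ := (∏ k ∈ Finset.Ico j n, (-κ k)) / entry x.2 1 j with hK
  set a : ℕ → ℂ := fun k => if k < j then -κ k else -(κ k)⁻¹ with ha
  set m : ℕ → ℤ := fun k => if k < j then -1 else 1 with hm
  have hm0 : ∀ k, m k ≠ 0 := fun k => by simp only [hm]; split_ifs <;> norm_num
  have ham : ∀ k ∈ Finset.range n, ‖a k‖ * ρ ^ m k ≤ 1 / (16 * n) := by
    intro k hk
    have hk := Finset.mem_range.1 hk
    by_cases hkj : k < j
    · simp only [ha, hm, if_pos hkj]
      rw [norm_neg, zpow_neg_one]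
      exact h2 k hk hkj
    · simp only [ha, hm, if_neg hkj]
      rw [norm_neg, norm_inv, zpow_one, mul_comm]
      exact h3 k hk (not_lt.1 hkj)
  have hnorm : ∀ w ∈ Metric.sphere (0 : ℂ) ρ, ∀ k ∈ Finset.range n,
      ‖a k * w ^ m k‖ ≤ 1 / (16 * n) := by
    intro w hw k hk
    rw [norm_mul, norm_zpow, mem_sphere_zero_iff_norm.1 hw]
    exact ham k hk
  have hβ : ∀ i, ∀ w ∈ Metric.sphere (0 : ℂ) ρ, ‖ratioTerm n x j i w‖ ≤ 1 / (16 * n) := by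
    intro i w hw
    rw [ratioTerm]
    split_ifs with hij
    · rw [norm_zero]; positivity
    · rw [norm_mul, norm_zpow, mem_sphere_zero_iff_norm.1 hw]
      exact h1 i (by omega) hij
  have hβ1 : ∑ _i : Fin (n + 1), 1 / (16 * (n : ℝ)) ≤ 1 / 8 := by
    rw [Finset.sum_const, Finset.card_univ, Fintype.card_fin, nsmul_eq_mul]
    push_cast
    calc ((n : ℝ) + 1) * (1 / (16 * n)) ≤ (n + n) * (1 / (16 * n)) := by gcongr
      _ = 1 / 8 := by field_simp; norm_num
  have hpt : ∀ w ∈ Metric.sphere (0 : ℂ) ρ, Complex.log (1 + ∑ i, ratioTerm n x j i w) =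
      Complex.log K + ∑ k ∈ Finset.range n, Complex.log (1 + a k * w ^ m k) ∧
      ‖Complex.log K‖ ≤ 1 / 2 ∧ K ≠ 0 := by
    intro w hw
    have hw0 := ne_zero_of_mem_sphere hρ hw
    have hA : ‖∑ i, ratioTerm n x j i w‖ ≤ 1 / 8 :=
      (norm_sum_le_of_le _ fun i _ => hβ i w hw).trans hβ1
    have hA0 : 1 + ∑ i, ratioTerm n x j i w ≠ 0 :=
      Complex.slitPlane_ne_zero (Complex.mem_slitPlane_of_norm_lt_one (hA.trans_lt (by norm_num)))
    have hf0 : ∀ k ∈ Finset.range n, 1 + a k * w ^ m k ≠ 0 := fun k hk =>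
      Complex.slitPlane_ne_zero (Complex.mem_slitPlane_of_norm_lt_one
        (((hnorm w hw k hk).trans hε).trans_lt (by norm_num)))
    have hL := Complex.norm_log_one_add_half_le_self (hA.trans (by norm_num))
    have hM : ‖∑ k ∈ Finset.range n, Complex.log (1 + a k * w ^ m k)‖ ≤ 3 / 32 := by
      refine (norm_sum_le_of_le _ fun k hk => (Complex.norm_log_one_add_half_le_self
        (((hnorm w hw k hk).trans hε).trans (by norm_num))).trans
        (mul_le_mul_of_nonneg_left (hnorm w hw k hk) (by norm_num))).trans ?_
      rw [Finset.sum_const, Finset.card_range, nsmul_eq_mul]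
      refine le_of_eq ?_
      field_simp
      norm_num
    have hfac : 1 + ∑ i, ratioTerm n x j i w =
        K * ∏ k ∈ Finset.range n, (1 + a k * w ^ m k) := by
      have e1 : entry x.2 1 j * w ^ j * (1 + ∑ i, ratioTerm n x j i w) = (WX n x).eval w := by
        rw [eval_WX_eq_sum hn, ← Fin.sum_univ_eq_sum_range (fun i => entry x.2 1 i * w ^ i),
          mul_add, Finset.mul_sum, mul_one]
        have e2 : ∀ i : Fin (n + 1), entry x.2 1 j * w ^ j * ratioTerm n x j i w =
            entry x.2 1 i * w ^ (i : ℕ) -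
              if i = ⟨j, by omega⟩ then entry x.2 1 j * w ^ j else 0 := by
          intro i
          by_cases hij : (i : ℕ) = j
          · rw [ratioTerm, if_pos hij, if_pos (Fin.ext hij), hij]; ring
          · rw [ratioTerm, if_neg hij, if_neg fun h => hij (by rw [h]), zpow_sub₀ hw0,
              zpow_natCast, zpow_natCast]
            have := hx j hj
            field_simp
            ring
        rw [Finset.sum_congr rfl fun i _ => e2 i, Finset.sum_sub_distrib, Finset.sum_ite_eq',
          if_pos (Finset.mem_univ _)]
        ring
      have e3 : ∀ k ∈ Finset.range n, w - κ k = (if k < j then w else -κ k) *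
          (1 + a k * w ^ m k) := by
        intro k hk
        have hk := Finset.mem_range.1 hk
        by_cases hkj : k < j
        · simp only [ha, hm, if_pos hkj]
          rw [zpow_neg_one]
          field_simp
          ring
        · simp only [ha, hm, if_neg hkj]
          have := hκ k hk
          rw [zpow_one]
          field_simp
          ring
      have e4 : ∏ k ∈ Finset.range n, (if k < j then w else -κ k) =
          w ^ j * ∏ k ∈ Finset.Ico j n, (-κ k) := by
        rw [← Finset.prod_range_mul_prod_Ico _ hj]
        congr 1
        · rw [Finset.prod_congr rfl fun k hk => if_pos (Finset.mem_range.1 hk), Finset.prod_const,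
            Finset.card_range]
        · exact Finset.prod_congr rfl fun k hk => if_neg (not_lt.2 (Finset.mem_Ico.1 hk).1)
      rw [hW, Finset.prod_congr rfl e3, Finset.prod_mul_distrib, e4] at e1
      have e5 := hx j hj
      refine mul_left_cancel₀ (mul_ne_zero e5 (pow_ne_zero j hw0)) (e1.trans ?_)
      rw [hK]
      field_simp
    have hK0 : K ≠ 0 := fun h => hA0 (by rw [hfac, h, zero_mul])
    have hexpM : Complex.exp (∑ k ∈ Finset.range n, Complex.log (1 + a k * w ^ m k)) =
        ∏ k ∈ Finset.range n, (1 + a k * w ^ m k) := by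
      rw [Complex.exp_sum]
      exact Finset.prod_congr rfl fun k hk => Complex.exp_log (hf0 k hk)
    set L := Complex.log (1 + ∑ i, ratioTerm n x j i w)
    set M := ∑ k ∈ Finset.range n, Complex.log (1 + a k * w ^ m k)
    have hexp : Complex.exp (L - M) = K := by
      rw [Complex.exp_sub, Complex.exp_log hA0, hexpM, hfac, mul_div_cancel_right₀]
      exact Finset.prod_ne_zero_iff.2 hf0
    -- ‖L‖ is at most (3/2)(1/8) and ‖M‖ at most 3/32; the sum is far below π, so L - M is the
    -- principal logarithm of K.
    have hLM : ‖L - M‖ ≤ 1 / 2 := by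
      refine (norm_sub_le _ _).trans ?_
      linarith
    have him := (Complex.abs_im_le_norm (L - M)).trans hLM
    have hpi3 := Real.pi_gt_three
    have hlog : Complex.log K = L - M := by
      rw [← hexp, Complex.log_exp]
      · linarith [neg_abs_le (L - M).im]
      · linarith [le_abs_self (L - M).im]
    refine ⟨by rw [hlog]; ring, hlog ▸ hLM, hK0⟩
  have hmem : (ρ : ℂ) ∈ Metric.sphere (0 : ℂ) ρ := by simp [abs_of_pos hρ]
  have hint : ∮ w in C(0, ρ), w⁻¹ * Complex.log (1 + ∑ i, ratioTerm n x j i w) =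
      2 * Real.pi * Complex.I * Complex.log K := by
    have e1 : ∮ w in C(0, ρ), w⁻¹ * Complex.log (1 + ∑ i, ratioTerm n x j i w) =
        ∮ w in C(0, ρ), (Complex.log K * w⁻¹ +
          ∑ k ∈ Finset.range n, w⁻¹ * Complex.log (1 + a k * w ^ m k)) := by
      refine circleIntegral.integral_congr hρ.le fun w hw => ?_
      rw [(hpt w hw).1, mul_add, Finset.mul_sum, mul_comm]
    have c1 : CircleIntegrable (fun w => Complex.log K * w⁻¹) 0 ρ :=
      (continuousOn_const.mul (continuousOn_inv_sphere hρ)).circleIntegrable hρ.le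
    have c2 : ∀ k ∈ Finset.range n,
        ContinuousOn (fun w => w⁻¹ * Complex.log (1 + a k * w ^ m k)) (Metric.sphere 0 ρ) := by
      intro k hk
      refine (continuousOn_inv_sphere hρ).mul
        (ContinuousOn.clog (continuousOn_const.add (continuousOn_const_mul_zpow hρ _ _))
          fun w hw => ?_)
      exact Complex.mem_slitPlane_of_norm_lt_one
        (((hnorm w hw k hk).trans hε).trans_lt (by norm_num))
    have c3 : CircleIntegrable
        (fun w => ∑ k ∈ Finset.range n, w⁻¹ * Complex.log (1 + a k * w ^ m k)) 0 ρ :=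
      (continuousOn_finsetSum _ c2).circleIntegrable hρ.le
    have e2 : ∮ w in C(0, ρ), w⁻¹ = 2 * Real.pi * Complex.I := by
      simpa using circleIntegral.integral_sub_center_inv 0 hρ.ne'
    rw [e1, circleIntegral.integral_add c1 c3, circleIntegral.integral_const_mul, e2,
      circleIntegral.integral_fun_sum fun k hk => (c2 k hk).circleIntegrable hρ.le,
      Finset.sum_eq_zero fun k hk => circleIntegral_inv_mul_log hρ (a k) (hm0 k)
        (((ham k hk).trans hε).trans_lt (by norm_num))]
    ring
  have hsum := hasSum_toricTerm hn hj hx hρ (fun _ => 1 / (16 * (n : ℝ))) hβ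
    (hβ1.trans_lt (by norm_num))
  have hS : toricSum n j (toY n x) = Complex.log K := by
    rw [toricSum, hsum.tsum_eq, hint, inv_mul_cancel_left₀ Complex.two_pi_I_ne_zero]
  obtain ⟨-, hlog, hK0⟩ := hpt _ hmem
  rw [hS]
  exact ⟨Complex.exp_log hK0, hlog⟩

/-! ### The flat co-ordinates for `Y` near the large-radius limit point -/

/-- The scales of the roots `κ` and of the coefficients of `W_X` are separated, as they are near the
large-radius limit point for `Y`. -/
structure IsScaled (n : ℕ) (t : ℝ) (x : Chart n) (κ : ℕ → ℂ) : Prop where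
  entry_ne_zero : ∀ i ≤ n, entry x.2 1 i ≠ 0
  root_ne_zero : ∀ k < n, κ k ≠ 0
  entry_lt : ∀ j ≤ n, ∀ i ≤ n, i ≠ j →
    ‖entry x.2 1 i / entry x.2 1 j‖ * (t ^ ((n : ℤ) - 2 * j)) ^ ((i : ℤ) - (j : ℤ)) < 1 / (16 * n)
  root_lt : ∀ j ≤ n, ∀ k < n, k < j → ‖κ k‖ * (t ^ ((n : ℤ) - 2 * j))⁻¹ < 1 / (16 * n)
  lt_root : ∀ j ≤ n, ∀ k < n, j ≤ k → t ^ ((n : ℤ) - 2 * j) * ‖κ k‖⁻¹ < 1 / (16 * n)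

/-- On the path the radius t^{n-2j} is the geometric mean of |κ_{j-1}| and |κ_j|. -/
theorem IsScaled.exp_toricSum {n : ℕ} (hn : 2 ≤ n) {t : ℝ} (ht : 0 < t) {x : Chart n} {κ : ℕ → ℂ}
    (h : IsScaled n t x κ) (hW : ∀ w, (WX n x).eval w = ∏ k ∈ Finset.range n, (w - κ k)) {j : ℕ}
    (hj : j ≤ n) : Complex.exp (toricSum n j (toY n x)) =
      (∏ k ∈ Finset.Ico j n, (-κ k)) / entry x.2 1 j ∧ ‖toricSum n j (toY n x)‖ ≤ 1 / 2 :=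
  CrepantA.exp_toricSum hn hj hW h.entry_ne_zero (zpow_pos ht _)
    (fun i hi hij => (h.entry_lt j hj i hi hij).le) (fun k hk hkj => (h.root_lt j hj k hk hkj).le)
    (fun k hk hkj => (h.lt_root j hj k hk hkj).le) h.root_ne_zero

theorem entry_toY {n i : ℕ} (hi : i + 1 < n) (x : Chart n) : entry (toY n x).2 1 (i + 1) =
    entry x.2 1 i * (entry x.2 1 (i + 1) ^ 2)⁻¹ * entry x.2 1 (i + 2) := by
  have h1 := entry_of_mem (toY n x).2 1 ⟨i, by omega⟩
  have h2 := entry_of_mem x.2 1 ⟨i, by omega⟩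
  simp only at h1 h2
  rw [h1, h2, toY]

/-- In y_i e^{S_{i-1} - 2 S_i + S_{i+1}} the coefficients of W cancel and the products over k ≥ j
telescope to κ_{i-1}/κ_i. The imaginary part of g_i is below 1 + (1/2 + 1 + 1/2) = 3 < π in size, so
equality of exponentials gives equality. -/
theorem flatY_toY_eq {n i : ℕ} (hn : 2 ≤ n) (hi : i + 1 < n) {t : ℝ} (ht : 0 < t) {x : Chart n}
    {κ : ℕ → ℂ} (h : IsScaled n t x κ)
    (hW : ∀ w, (WX n x).eval w = ∏ k ∈ Finset.range n, (w - κ k))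
    (hy : |(entry (toY n x).2 1 (i + 1)).arg| < 1) {l : ℂ}
    (hl : Complex.exp l = κ i / κ (i + 1)) (him : |l.im| < 1) :
    flatY n (i + 1) (toY n x) = l := by
  obtain ⟨e0, b0⟩ := h.exp_toricSum hn ht hW (j := i) (by omega)
  obtain ⟨e1, b1⟩ := h.exp_toricSum hn ht hW (j := i + 1) (by omega)
  obtain ⟨e2, b2⟩ := h.exp_toricSum hn ht hW (j := i + 2) (by omega)
  have c0 := h.entry_ne_zero i (by omega)
  have c1 := h.entry_ne_zero (i + 1) (by omega)
  have c2 := h.entry_ne_zero (i + 2) (by omega)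
  have k0 := h.root_ne_zero i (by omega)
  have k1 := h.root_ne_zero (i + 1) (by omega)
  have hP : ∏ k ∈ Finset.Ico (i + 2) n, (-κ k) ≠ 0 := Finset.prod_ne_zero_iff.2 fun k hk =>
    neg_ne_zero.2 (h.root_ne_zero k (Finset.mem_Ico.1 hk).2)
  have hP1 : ∏ k ∈ Finset.Ico (i + 1) n, (-κ k) =
      -κ (i + 1) * ∏ k ∈ Finset.Ico (i + 2) n, (-κ k) :=
    Finset.prod_eq_prod_Ico_succ_bot (by omega) _
  have hP0 : ∏ k ∈ Finset.Ico i n, (-κ k) = -κ i * ∏ k ∈ Finset.Ico (i + 1) n, (-κ k) :=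
    Finset.prod_eq_prod_Ico_succ_bot (by omega) _
  have hy0 : entry (toY n x).2 1 (i + 1) ≠ 0 := by
    rw [entry_toY hi]
    exact mul_ne_zero (mul_ne_zero c0 (inv_ne_zero (pow_ne_zero _ c1))) c2
  have hpi := Real.pi_gt_three
  have hS : ‖toricSum n i (toY n x) - 2 * toricSum n (i + 1) (toY n x) +
      toricSum n (i + 2) (toY n x)‖ ≤ 2 := by
    refine (norm_add_le _ _).trans ?_
    have := norm_sub_le (toricSum n i (toY n x)) (2 * toricSum n (i + 1) (toY n x))
    rw [norm_mul, Complex.norm_ofNat] at this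
    linarith
  have hSim := (Complex.abs_im_le_norm _).trans hS
  have hFim : |(flatY n (i + 1) (toY n x)).im| < 3 := by
    rw [flatY, if_neg (Nat.succ_ne_zero i), Complex.add_im, Complex.log_im]
    exact (abs_add_le _ _).trans_lt (by rw [Nat.add_sub_cancel]; linarith)
  rw [abs_lt] at hFim him
  refine Complex.exp_inj_of_neg_pi_lt_of_le_pi (by linarith) (by linarith) (by linarith)
    (by linarith) ?_
  rw [hl, flatY, if_neg (Nat.succ_ne_zero i), Complex.exp_add, Complex.exp_log hy0,
    Complex.exp_add, Complex.exp_sub, Nat.add_sub_cancel, two_mul, Complex.exp_add, e0, e1, e2,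
    entry_toY hi, hP0, hP1]
  field_simp

/-! ### Openness of the scaling condition and its validity on the path -/

theorem eventually_forall_lt {α : Type*} {l : Filter α} {n : ℕ} {P : ℕ → α → Prop}
    (h : ∀ k < n, ∀ᶠ x in l, P k x) : ∀ᶠ x in l, ∀ k < n, P k x :=
  (eventually_all_finite (Set.finite_Iio n)).2 h

theorem eventually_forall_le {α : Type*} {l : Filter α} {n : ℕ} {P : ℕ → α → Prop}
    (h : ∀ k ≤ n, ∀ᶠ x in l, P k x) : ∀ᶠ x in l, ∀ k ≤ n, P k x :=
  (eventually_all_finite (Set.finite_Iic n)).2 h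

theorem eventually_imp_of_imp {α : Type*} {l : Filter α} {p : Prop} {P : α → Prop}
    (h : p → ∀ᶠ x in l, P x) : ∀ᶠ x in l, p → P x :=
  eventually_imp_distrib_left.2 h

theorem continuous_entry {n : ℕ} (i : ℕ) : Continuous fun x : Chart n => entry x.2 1 i := by
  unfold entry
  split_ifs
  · fun_prop
  · exact continuous_const

/-- For fixed t these are finitely many strict inequalities between continuous functions, so they
spread from a point of the path to a neighbourhood. -/
theorem IsScaled.eventually {n : ℕ} {t : ℝ} {x₀ : Chart n} {V : ℕ → Chart n → ℂ}
    (hV : ∀ k < n, ContinuousAt (V k) x₀) (h : IsScaled n t x₀ fun k => V k x₀) :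
    ∀ᶠ x in 𝓝 x₀, IsScaled n t x fun k => V k x := by
  have hE : ∀ i, ContinuousAt (fun x : Chart n => entry x.2 1 i) x₀ := fun i =>
    (continuous_entry i).continuousAt
  have h1 : ∀ᶠ x : Chart n in 𝓝 x₀, ∀ i ≤ n, entry x.2 1 i ≠ 0 :=
    eventually_forall_le fun i hi => (hE i).eventually_ne (h.entry_ne_zero i hi)
  have h2 : ∀ᶠ x in 𝓝 x₀, ∀ k < n, V k x ≠ 0 :=
    eventually_forall_lt fun k hk => (hV k hk).eventually_ne (h.root_ne_zero k hk)
  have h3 : ∀ᶠ x : Chart n in 𝓝 x₀, ∀ j ≤ n, ∀ i ≤ n, i ≠ j →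
      ‖entry x.2 1 i / entry x.2 1 j‖ * (t ^ ((n : ℤ) - 2 * j)) ^ ((i : ℤ) - (j : ℤ)) <
        1 / (16 * n) :=
    eventually_forall_le fun j hj => eventually_forall_le fun i hi => eventually_imp_of_imp
      fun hij => (((hE i).div (hE j) (h.entry_ne_zero j hj)).norm.mul
        continuousAt_const).eventually_lt continuousAt_const (h.entry_lt j hj i hi hij)
  have h4 : ∀ᶠ x in 𝓝 x₀, ∀ j ≤ n, ∀ k < n, k < j →
      ‖V k x‖ * (t ^ ((n : ℤ) - 2 * j))⁻¹ < 1 / (16 * n) :=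
    eventually_forall_le fun j hj => eventually_forall_lt fun k hk => eventually_imp_of_imp
      fun hkj => ((hV k hk).norm.mul continuousAt_const).eventually_lt continuousAt_const
        (h.root_lt j hj k hk hkj)
  have h5 : ∀ᶠ x in 𝓝 x₀, ∀ j ≤ n, ∀ k < n, j ≤ k →
      t ^ ((n : ℤ) - 2 * j) * ‖V k x‖⁻¹ < 1 / (16 * n) :=
    eventually_forall_le fun j hj => eventually_forall_lt fun k hk => eventually_imp_of_imp
      fun hkj => (continuousAt_const.mul ((hV k hk).norm.inv₀
        (norm_ne_zero_iff.2 (h.root_ne_zero k hk)))).eventually_lt continuousAt_const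
        (h.lt_root j hj k hk hkj)
  filter_upwards [h1, h2, h3, h4, h5] with x h1 h2 h3 h4 h5
  exact ⟨h1, h2, h3, h4, h5⟩

theorem norm_exp_logRoot {n : ℕ} (k : ℕ) {t : ℝ} (ht : 0 < t) :
    ‖Complex.exp (logRoot n k t)‖ = t ^ ((n : ℤ) - 1 - 2 * k) := by
  have h := norm_exp_mul_pathParam n ht (((n : ℤ) - 1 - 2 * k : ℤ) : ℝ)
  rw [Real.rpow_intCast] at h
  rw [← h, logRoot, Complex.exp_add, Complex.exp_pi_mul_I, neg_one_mul, norm_neg]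
  push_cast
  rfl

theorem norm_entry_path {n i : ℕ} (hi : i ≤ n) {t : ℝ} (ht : 0 < t) :
    ‖entry (path n t).2 1 i‖ =
      t ^ ((i : ℤ) * (i - n)) * ‖gauss (Complex.exp (2 * pathParam n t)) n i‖ := by
  have h := norm_exp_mul_pathParam n ht (((i : ℤ) * (i - n) : ℤ) : ℝ)
  rw [Real.rpow_intCast] at h
  rw [entry_path hi, norm_mul, ← h]
  push_cast
  rfl

theorem eventually_isScaled_path {n : ℕ} (hn : 2 ≤ n) :
    ∀ᶠ t : ℝ in 𝓝[>] 0, IsScaled n t (path n t) fun k => Complex.exp (logRoot n k t) := by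
  have hn' : (0 : ℝ) < n := by exact_mod_cast (by omega : 0 < n)
  have hε : 0 < 1 / (16 * (n : ℝ)) := by positivity
  have hid : Tendsto (fun t : ℝ => t) (𝓝[>] 0) (𝓝 0) := nhdsWithin_le_nhds
  have hpos : ∀ᶠ t : ℝ in 𝓝[>] 0, 0 < t := self_mem_nhdsWithin
  have hlt1 : ∀ᶠ t : ℝ in 𝓝[>] 0, t < 1 := hid.eventually_lt_const one_pos
  have hltε : ∀ᶠ t : ℝ in 𝓝[>] 0, t < 1 / (16 * n) := hid.eventually_lt_const hε
  have hpow : ∀ {t : ℝ}, 0 < t → t < 1 → ∀ {m : ℤ}, 1 ≤ m → t ^ m ≤ t := by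
    intro t h0 h1 m hm
    simpa using zpow_le_zpow_right_of_le_one₀ h0 h1.le hm
  have h1 : ∀ᶠ t in 𝓝[>] (0 : ℝ), ∀ i ≤ n, gauss (Complex.exp (2 * pathParam n t)) n i ≠ 0 :=
    eventually_forall_le fun i hi => (tendsto_gauss_path hi).eventually_ne one_ne_zero
  have h2 : ∀ᶠ t in 𝓝[>] (0 : ℝ), ∀ j ≤ n, ∀ i ≤ n,
      t * (‖gauss (Complex.exp (2 * pathParam n t)) n i‖ /
        ‖gauss (Complex.exp (2 * pathParam n t)) n j‖) < 1 / (16 * n) := by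
    refine eventually_forall_le fun j hj => eventually_forall_le fun i hi => ?_
    have := hid.mul ((tendsto_gauss_path hi).norm.div (tendsto_gauss_path hj).norm (by simp))
    rw [zero_mul] at this
    exact this.eventually_lt_const hε
  filter_upwards [hpos, hlt1, hltε, h1, h2] with t h0 hlt1 hltε h1 h2
  refine ⟨fun i hi => ?_, fun k _ => Complex.exp_ne_zero _, fun j hj i hi hij => ?_,
    fun j _ k _ hkj => ?_, fun j _ k _ hkj => ?_⟩
  · rw [entry_path hi]
    exact mul_ne_zero (Complex.exp_ne_zero _) (h1 i hi)
  · rw [norm_div, norm_entry_path hi h0, norm_entry_path hj h0]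
    -- With radius t^{n-2j} the exponent completes to the square (i - j)², which is positive for i ≠
    -- j.
    have e : t ^ ((i : ℤ) * (i - n)) / t ^ ((j : ℤ) * (j - n)) *
        (t ^ ((n : ℤ) - 2 * j)) ^ ((i : ℤ) - (j : ℤ)) = t ^ (((i : ℤ) - j) ^ 2) := by
      rw [← zpow_sub₀ h0.ne', ← zpow_mul, ← zpow_add₀ h0.ne']
      congr 1
      ring
    have hsq : 1 ≤ ((i : ℤ) - j) ^ 2 := by
      have : (i : ℤ) - j ≠ 0 := by omega
      have := sq_pos_of_ne_zero this
      omega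
    rw [mul_div_mul_comm, mul_right_comm, e]
    exact (mul_le_mul_of_nonneg_right (hpow h0 hlt1 hsq) (by positivity)).trans_lt (h2 j hj i hi)
  · rw [norm_exp_logRoot k h0, ← zpow_neg, ← zpow_add₀ h0.ne']
    exact (hpow h0 hlt1 (by omega)).trans_lt hltε
  · rw [norm_exp_logRoot k h0, ← zpow_neg, ← zpow_add₀ h0.ne']
    exact (hpow h0 hlt1 (by omega)).trans_lt hltε

/-! ### Factorization of W near the path and matching with g_i -/

theorem eval_WX_eq_prod {n : ℕ} (hn : 2 ≤ n) {x : Chart n} {κ : ℕ → ℂ}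
    (h0 : ∀ k < n, (WX n x).eval (κ k) = 0)
    (hinj : Set.InjOn κ (Finset.range n : Set ℕ)) (w : ℂ) :
    (WX n x).eval w = ∏ k ∈ Finset.range n, (w - κ k) := by
  let P : Polynomial ℂ :=
    (∑ k : Fin (n - 1), Polynomial.C (x.2 k) * Polynomial.X ^ ((k : ℕ) + 1)) + 1
  have hWP : WX n x = Polynomial.X ^ n + P := add_assoc _ _ _
  have hP : P.degree < n := by
    refine (Polynomial.degree_add_le _ _).trans_lt (max_lt ?_ ?_)
    · refine (Polynomial.degree_sum_le _ _).trans_lt ((Finset.sup_lt_iff ?_).2 fun k _ => ?_)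
      · exact WithBot.bot_lt_coe n
      · refine (Polynomial.degree_C_mul_X_pow_le _ _).trans_lt ?_
        exact_mod_cast (by omega : (k : ℕ) + 1 < n)
    · refine Polynomial.degree_one_le.trans_lt ?_
      exact_mod_cast (by omega : 0 < n)
  have hWd : (WX n x).degree = n := by
    rw [hWP, Polynomial.degree_add_eq_left_of_degree_lt] <;> rw [Polynomial.degree_X_pow]
    exact hP
  have hWm : (WX n x).Monic := by
    rw [hWP]
    exact Polynomial.monic_X_pow_add hP
  have hQ := Polynomial.monic_prod_of_monic (Finset.range n)
    (fun k => Polynomial.X - Polynomial.C (κ k)) fun k _ => Polynomial.monic_X_sub_C _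
  have hQd : (∏ k ∈ Finset.range n, (Polynomial.X - Polynomial.C (κ k))).degree = (n : WithBot ℕ) := by
    rw [Polynomial.degree_prod]
    simp
  have := Polynomial.eq_of_degree_sub_lt_of_eval_index_eq (Finset.range n) hinj
    (f := WX n x) (g := ∏ k ∈ Finset.range n, (Polynomial.X - Polynomial.C (κ k))) ?_ ?_
  · rw [this, Polynomial.eval_prod]
    simp
  · rw [Finset.card_range, ← hWd]
    exact Polynomial.degree_sub_lt_left (hWd.trans hQd.symm) hWm.ne_zero
      (by rw [hWm.leadingCoeff, hQ.leadingCoeff])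
  · intro k hk
    rw [h0 k (Finset.mem_range.1 hk), Polynomial.eval_prod]
    exact (Finset.prod_eq_zero hk (by simp)).symm

theorem eventually_eval_eq_zero {n : ℕ} {x₀ : Chart n} {l : ℂ} {U : Chart n → ℂ}
    (hU : ContinuousAt U x₀) (hU0 : U x₀ = l)
    (hroot : ∀ᶠ z in 𝓝 (x₀, l), rootEq n z = 0 ↔ z.2 = U z.1) :
    ∀ᶠ x in 𝓝 x₀, (WX n x).eval (Complex.exp (U x)) = 0 := by
  have h : Tendsto (fun x => (x, U x)) (𝓝 x₀) (𝓝 (x₀, l)) :=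
    tendsto_id.prodMk_nhds (hU0 ▸ hU)
  filter_upwards [h.eventually hroot] with x hx
  exact hx.2 rfl

theorem eventually_eval_WX_eq_prod {n : ℕ} (hn : 2 ≤ n) {x₀ : Chart n} {V : ℕ → Chart n → ℂ}
    (hV : ∀ k < n, ContinuousAt (V k) x₀)
    (h0 : ∀ k < n, ∀ᶠ x in 𝓝 x₀, (WX n x).eval (V k x) = 0)
    (hinj : Set.InjOn (fun k => V k x₀) (Finset.range n : Set ℕ)) :
    ∀ᶠ x in 𝓝 x₀, ∀ w, (WX n x).eval w = ∏ k ∈ Finset.range n, (w - V k x) := by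
  have h1 : ∀ᶠ x in 𝓝 x₀, ∀ k < n, ∀ k' < n, k ≠ k' → V k x ≠ V k' x :=
    eventually_forall_lt fun k hk => eventually_forall_lt fun k' hk' => eventually_imp_of_imp
      fun hkk => by
        have hne : V k x₀ ≠ V k' x₀ := fun h =>
          hkk (hinj (by simpa using hk) (by simpa using hk') h)
        exact ((hV k hk).ne_iff_eventually_ne (hV k' hk')).1 hne
  filter_upwards [h1, eventually_forall_lt h0] with x h1 h0
  refine eval_WX_eq_prod hn h0 fun k hk k' hk' h => ?_
  by_contra hkk
  exact h1 k (by simpa using hk) k' (by simpa using hk') hkk h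

theorem continuousAt_entry_toY {n i : ℕ} (hi : i + 1 < n) {x : Chart n}
    (hx : entry x.2 1 (i + 1) ≠ 0) :
    ContinuousAt (fun x => entry (toY n x).2 1 (i + 1)) x := by
  simp only [entry_toY hi]
  exact ((continuous_entry i).continuousAt.mul
    (((continuous_entry (i + 1)).continuousAt.pow 2).inv₀ (pow_ne_zero _ hx))).mul
      (continuous_entry (i + 2)).continuousAt

/-- An identity of germs is needed, so the scaling, the factorization of W and both branch bounds
are first extended from the point of the path to a neighbourhood. -/
theorem eventually_flatY_eq {n i : ℕ} (hn : 2 ≤ n) (hi : i + 1 < n) {t : ℝ} (ht0 : 0 < t)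
    (ht1 : t < 1 / 8)
    {U : ℕ → Chart n → ℂ} (hU : ∀ k < n, ContinuousAt (U k) (path n t))
    (hU0 : ∀ k < n, U k (path n t) = logRoot n k t)
    (hroot : ∀ k < n, ∀ᶠ z in 𝓝 (path n t, logRoot n k t), rootEq n z = 0 ↔ z.2 = U k z.1)
    (hs : IsScaled n t (path n t) fun k => Complex.exp (logRoot n k t))
    (hy : entry (toY n (path n t)).2 1 (i + 1) ∈ Complex.slitPlane)
    (harg : |(entry (toY n (path n t)).2 1 (i + 1)).arg| < 1) :
    (fun x => U i x - U (i + 1) x) =ᶠ[𝓝 (path n t)] fun x => flatY n (i + 1) (toY n x) := by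
  have hn' : (2 : ℝ) ≤ n := by exact_mod_cast hn
  have hV : ∀ k < n, ContinuousAt (fun x => Complex.exp (U k x)) (path n t) := fun k hk =>
    (hU k hk).cexp
  have h1 := eventually_eval_WX_eq_prod hn hV
    (fun k hk => eventually_eval_eq_zero (hU k hk) (hU0 k hk) (hroot k hk)) (by
      intro k hk k' hk' h
      simp only [hU0 k (by simpa using hk), hU0 k' (by simpa using hk')] at h
      exact exp_logRoot_injOn hn ⟨ht0, by linarith⟩ hk hk' h)
  have h2 : IsScaled n t (path n t) fun k => Complex.exp (U k (path n t)) :=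
    { entry_ne_zero := hs.entry_ne_zero
      root_ne_zero := fun k _ => Complex.exp_ne_zero _
      entry_lt := hs.entry_lt
      root_lt := fun j hj k hk => by rw [hU0 k hk]; exact hs.root_lt j hj k hk
      lt_root := fun j hj k hk => by rw [hU0 k hk]; exact hs.lt_root j hj k hk }
  have h3 := IsScaled.eventually hV h2
  have hcy := continuousAt_entry_toY hi (hs.entry_ne_zero (i + 1) (by omega))
  have h4 : ∀ᶠ x in 𝓝 (path n t), |(entry (toY n x).2 1 (i + 1)).arg| < 1 :=
    (ContinuousAt.comp (f := fun x => entry (toY n x).2 1 (i + 1))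
      (Complex.continuousAt_arg hy) hcy).abs.eventually_lt continuousAt_const harg
  have h5 : ∀ᶠ x in 𝓝 (path n t), |(U i x - U (i + 1) x).im| < 1 := by
    refine (Complex.continuous_im.continuousAt.comp
      ((hU i (by omega)).sub (hU (i + 1) hi))).abs.eventually_lt continuousAt_const ?_
    simp only [Function.comp_apply, Pi.sub_apply]
    rw [hU0 i (by omega), hU0 (i + 1) hi]
    have e : logRoot n i t - logRoot n (i + 1) t = (2 : ℝ) * pathParam n t := by
      simp only [logRoot]
      push_cast
      ring
    rw [e, Complex.im_ofReal_mul, pathParam_im, abs_lt]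
    -- This is where t < 1/8 is used: with π ≤ 4 and n ≥ 2 the imaginary part of 2 log q is at most
    -- 1/2 in size.
    have h6 : Real.pi * t / n ≤ 4 * (1 / 8) / 2 := by
      gcongr
      exact Real.pi_le_four
    have h7 : 0 < Real.pi * t / n := by positivity
    constructor <;> linarith
  filter_upwards [h1, h3, h4, h5] with x h1 h3 h4 h5
  exact (flatY_toY_eq hn hi ht0 h3 h1 h4 (Complex.exp_sub _ _) h5).symm

/-- At t = 1 the root of index i is ζ^{2i+1}, so consecutive roots contribute ζ^{2k(i+1)} (ζ^{-k} -
ζ^k), and their logarithms differ by -2πi/n. -/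
theorem sub_eq_flatX_combination {n i : ℕ} (hn : 2 ≤ n) (x : Chart n) :
    (logRoot n i 1 + 1 / n * ∑ k ∈ Finset.Ico 1 n, Complex.exp (logRoot n i 1) ^ k * flatX n k x) -
      (logRoot n (i + 1) 1 + 1 / n * ∑ k ∈ Finset.Ico 1 n,
        Complex.exp (logRoot n (i + 1) 1) ^ k * flatX n k x) =
    -(2 * Real.pi * Complex.I) / n + (1 / (n : ℂ)) * ∑ k ∈ Finset.Ico 1 n,
      Complex.exp (Real.pi * Complex.I / n) ^ (2 * k * (i + 1)) *
        ((Complex.exp (Real.pi * Complex.I / n))⁻¹ ^ k -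
          Complex.exp (Real.pi * Complex.I / n) ^ k) * flatX n k x := by
  have h1 : ∑ k ∈ Finset.Ico 1 n, Complex.exp (Real.pi * Complex.I / n) ^ (2 * k * (i + 1)) *
        ((Complex.exp (Real.pi * Complex.I / n))⁻¹ ^ k -
          Complex.exp (Real.pi * Complex.I / n) ^ k) * flatX n k x =
      ∑ k ∈ Finset.Ico 1 n, Complex.exp (logRoot n i 1) ^ k * flatX n k x -
        ∑ k ∈ Finset.Ico 1 n, Complex.exp (logRoot n (i + 1) 1) ^ k * flatX n k x := by
    rw [← Finset.sum_sub_distrib]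
    refine Finset.sum_congr rfl fun k _ => ?_
    rw [exp_logRoot_one hn, exp_logRoot_one hn, ← sub_mul]
    congr 1
    have hz := Complex.exp_ne_zero (Real.pi * Complex.I / n)
    generalize Complex.exp (Real.pi * Complex.I / n) = z at hz
    rw [inv_pow]
    have e1 : z ^ (2 * k * (i + 1)) = (z ^ (2 * i + 1)) ^ k * z ^ k := by
      rw [← pow_mul, ← pow_add]
      congr 1
      ring
    have e2 : z ^ (2 * k * (i + 1)) * z ^ k = (z ^ (2 * (i + 1) + 1)) ^ k := by
      rw [← pow_mul, ← pow_add]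
      congr 1
      ring
    rw [mul_sub, e2, e1, mul_inv_cancel_right₀ (pow_ne_zero k hz)]
  rw [h1, logRoot_one hn, logRoot_one hn]
  push_cast
  ring

end CrepantA
end

/-! ### Assembly -/

theorem mainTheorem3 (n : ℕ) (hn : 2 ≤ n) :
    ∃ (r : ℝ) (f g : ℕ → CrepantA.Chart n → ℂ), 0 < r ∧
      -- `f k` and `g i` are the flat co-ordinates near the two large-radius limit points
      (∀ x : CrepantA.Chart n, (∀ k, ‖x.2 k‖ < r) →
        CrepantA.HasFlatCoordinatesX n x (fun k => f k x)) ∧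
      (∀ y : CrepantA.Chart n, (∀ k, y.2 k ≠ 0 ∧ ‖y.2 k‖ < r) →
        CrepantA.HasFlatCoordinatesY n y (fun i => g i y)) ∧
      -- the path `p`, from `y = 0` (as `t → 0`) to `x = 0` (at `t = 1`)
      ∃ p : ℝ → CrepantA.Chart n,
        ContinuousOn p (Set.Ioc 0 1) ∧
        (∀ t ∈ Set.Ioc (0 : ℝ) 1, (CrepantA.WX n (p t)).Separable) ∧
        (∀ᶠ t in 𝓝[>] (0 : ℝ), ∀ k, (CrepantA.toY n (p t)).2 k ∈ Complex.slitPlane) ∧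
        Tendsto (fun t => CrepantA.toY n (p t)) (𝓝[>] (0 : ℝ)) (𝓝 0) ∧
        p 1 = 0 ∧
        -- the continuation of each `g i` along `p`
        ∀ i : ℕ, 1 ≤ i → i < n →
          ∃ F : ℝ → CrepantA.Chart n → ℂ,
            CrepantA.IsAnalyticContinuation (Set.Ioc 0 1) p F ∧
            (∀ᶠ t in 𝓝[>] (0 : ℝ), F t =ᶠ[𝓝 (p t)] fun x => g i (CrepantA.toY n x)) ∧
            F 1 =ᶠ[𝓝 0] fun x =>
              -(2 * Real.pi * Complex.I) / n +
                (1 / (n : ℂ)) * ∑ k ∈ Finset.Ico 1 n,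
                  Complex.exp (Real.pi * Complex.I / n) ^ (2 * k * i) *
                    ((Complex.exp (Real.pi * Complex.I / n))⁻¹ ^ k -
                      Complex.exp (Real.pi * Complex.I / n) ^ k) * f k x := by
  have hn' : (0 : ℝ) < n := by exact_mod_cast (by omega : 0 < n)
  set s : ℝ := 1 / (2 * (n + 1)) with hs
  have hs0 : 0 < s := by positivity
  have hs1 : ((n : ℝ) + 1) * s < 1 := by
    rw [hs]
    field_simp
    norm_num
  -- The first radius is that of the root expansion at x = 0, the second that of
  -- `summable_toricTerm`, where (n + 1) s = 1/2.
  refine ⟨min (1 / (100 * n)) (s ^ 2), CrepantA.flatX n, CrepantA.flatY n,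
    lt_min (by positivity) (by positivity), fun x hx => ?_, fun y hy => ?_, CrepantA.path n,
    CrepantA.continuousOn_path n, fun t ht => CrepantA.separable_WX_path hn ht,
    (CrepantA.eventually_toY_path_mem n one_pos).mono fun t ht k => (ht k).1,
    CrepantA.tendsto_toY_path n, CrepantA.path_one hn, fun i hi hin => ?_⟩
  · exact CrepantA.hasFlatCoordinatesX_flatX hn fun k => ((hx k).trans_le (min_le_left _ _)).le
  · exact CrepantA.hasFlatCoordinatesY_flatY hn fun j =>
      CrepantA.summable_toricTerm hn hs0.le hs1
        (fun k => ((hy k).2.trans_le (min_le_right _ _)).le) j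
  obtain ⟨i, rfl⟩ : ∃ m, i = m + 1 := ⟨i - 1, by omega⟩
  have hroot : ∀ k : ℕ, ∃ U : ℝ → CrepantA.Chart n → ℂ, k < n →
      CrepantA.IsAnalyticContinuation (Set.Ioc 0 1) (CrepantA.path n) U ∧
      ∀ t ∈ Set.Ioc (0 : ℝ) 1, U t (CrepantA.path n t) = CrepantA.logRoot n k t ∧
        ∀ᶠ z in 𝓝 (CrepantA.path n t, CrepantA.logRoot n k t),
          CrepantA.rootEq n z = 0 ↔ z.2 = U t z.1 := by
    intro k
    by_cases hk : k < n
    · obtain ⟨U, hU⟩ := CrepantA.exists_continuation_log_root (CrepantA.continuousOn_path n)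
        (CrepantA.continuousOn_logRoot n k) (fun t _ => by
          rw [CrepantA.eval_WX_path hn]
          exact Finset.prod_eq_zero (Finset.mem_range.2 hk) (sub_self _))
        fun t ht => CrepantA.separable_WX_path hn ht
      exact ⟨U, fun _ => hU⟩
    · exact ⟨fun _ _ => 0, fun h => absurd h hk⟩
  choose U hU using hroot
  -- Roots are numbered from 0, so g_{i+1} belongs to the roots i and i + 1.
  refine ⟨fun t x => U i t x - U (i + 1) t x, (hU i (by omega)).1.sub (hU (i + 1) hin).1, ?_, ?_⟩
  · have h1 : ∀ᶠ t : ℝ in 𝓝[>] 0, 0 < t := self_mem_nhdsWithin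
    have h2 : ∀ᶠ t : ℝ in 𝓝[>] 0, t < 1 / 8 :=
      Tendsto.eventually_lt_const (by norm_num) nhdsWithin_le_nhds
    filter_upwards [h1, h2, CrepantA.eventually_isScaled_path hn,
      CrepantA.eventually_toY_path_mem n one_pos] with t h1 h2 h3 h4
    have ht : t ∈ Set.Ioc (0 : ℝ) 1 := ⟨h1, by linarith⟩
    have h5 := h4 ⟨i, by omega⟩
    rw [← CrepantA.entry_of_mem (CrepantA.toY n (CrepantA.path n t)).2 1 ⟨i, by omega⟩] at h5
    exact CrepantA.eventually_flatY_eq hn hin h1 h2 (U := fun k => U k t)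
      (fun k hk => ((hU k hk).1 t ht).1.continuousAt) (fun k hk => ((hU k hk).2 t ht).1)
      (fun k hk => ((hU k hk).2 t ht).2) h3 h5.1 h5.2
  · have h1 : (1 : ℝ) ∈ Set.Ioc (0 : ℝ) 1 := by simp
    have hflat : ∀ k < n, U k 1 =ᶠ[𝓝 0] fun x => CrepantA.logRoot n k 1 +
        1 / n * ∑ m ∈ Finset.Ico 1 n,
          Complex.exp (CrepantA.logRoot n k 1) ^ m * CrepantA.flatX n m x := by
      intro k hk
      obtain ⟨hA, hB⟩ := hU k hk
      have hA1 := (hA 1 h1).1.continuousAt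
      obtain ⟨hB1, hB2⟩ := hB 1 h1
      rw [CrepantA.path_one hn] at hA1 hB1 hB2
      exact CrepantA.eventually_root_eq_flatX hn (CrepantA.exp_logRoot_one_pow hn k)
        (CrepantA.norm_exp_logRoot_one hn k) hA1 hB1 hB2
    filter_upwards [hflat i (by omega), hflat (i + 1) hin] with x h2 h3
    rw [h2, h3]
    exact CrepantA.sub_eq_flatX_combination hn x
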